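/- **Notation.** Let $n\ge 1$ and $\lambda>n$. Equip $\mathrm{Symm}(n,\mathbb R)$ with the inner product $\mathrm{tr}(XY)$ and the associated Lebesgue measure $dX$. Let $\Omega_n\subset\mathrm{Symm}(n,\mathbb R)$ be the cone of positive definite matrices, $\mathscr S_n=\{Z=X+iY\in \mathrm{Symm}(n,\mathbb C): Y=\mathrm{Im}\,Z>0\}$ with $dZ=dX\,dY$, and $$\Gamma_{\Omega_n}(s)=(2\pi)^{\frac{n(n-1)}4}\prod_{j=1}^n\Gamma\Big(s-\frac{j-1}2\Big),\qquad C_{\lambda,n}=\frac{\Gamma_{\Omega_n}(\lambda)}{\pi^{\frac{n(n+1)}2}\,\Gamma_{\Omega_n}\big(\lambda-\frac{n+1}2\big)} .$$ Let $d\widehat v_\lambda(Z)=C_{\lambda,n}\det(2\,\mathrm{Im}Z)^{\lambda-n-1}dZ$ on $\mathscr S_n$, let $\mathcal A^2_\lambda(\mathscr S_n)\subset L^2(\mathscr S_n,\widehat v_\lambda)$ be the subspace of (classes of) holomorphic functions, which is closed, and let $B_\lambda$ be the orthogonal projection onto it. For $a\in L^\infty(\mathscr S_n)$ the Toeplitz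 operator is $T^{(\lambda)}_a f=B_\lambda(af)$ on $\mathcal A^2_\lambda(\mathscr S_n)$. Let $$U=\mathcal F\otimes I:\ L^2(\mathscr S_n,\widehat v_\lambda)\to L^2(\mathrm{Symm}(n,\mathbb R),dX)\otimes L^2\big(\Omega_n,C_{\lambda,n}\det(2Y)^{\lambda-n-1}dY\big),$$ where $(\mathcal F\varphi)(X)=(2\pi)^{-\frac{n(n+1)}4}\int_{\mathrm{Symm}(n,\mathbb R)} e^{-i\,\mathrm{tr}(X\xi)}\varphi(\xi)\,d\xi$ for $\varphi\in L^1\cap L^2$; this is a unitary operator. Let $S_\lambda$ be the isometry from $L^2(\Omega_n)$ into the target of $U$ given by $$(S_\lambda h)(X,Y)=\frac{(2\pi)^{\frac{n(n+1)}4}}{\Gamma_{\Omega_n}(\lambda)^{1/2}}\,\chi_{\Omega_n}(X)\,h(X)\det(X)^{\frac\lambda2-\frac{n+1}4}e^{-\mathrm{tr}(XY)},$$ and put $R_\lambda=S_\lambda^*U$. **Theorem.** The space $\mathcal A^2_\lambda(\mathscr S_n)$ is closed in $L^2(\mathscr S_n,\widehat v_\lambda)$ and the operators $U$, $S_\lambda$,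 $R_\lambda$ are well defined. The operator $R_\lambda$ is a partial isometry with initial space $\mathcal A^2_\lambda(\mathscr S_n)$ and final space $L^2(\Omega_n)$, and for every $h\in L^2(\Omega_n)$ $$(R_\lambda^*h)(Z)=\Gamma_{\Omega_n}(\lambda)^{-1/2}\int_{\Omega_n}h(\xi)\det(\xi)^{\frac\lambda2-\frac{n+1}4}e^{i\,\mathrm{tr}(\xi Z)}\,d\xi .$$ A symbol $a\in L^\infty(\mathscr S_n)$ is $\mathrm{Symm}(n,\mathbb R)$-invariant (that is, for every $S\in\mathrm{Symm}(n,\mathbb R)$, $a(Z+S)=a(Z)$ for a.e. $Z\in\mathscr S_n$) if and only if it is a parabolic moment-map symbol (that is, $a(Z)=f(-2\,\mathrm{Im}(Z)^{-1})$ a.e. for some measurable $f$). Let $a\in L^\infty(\mathscr S_n)$ be $\mathrm{Symm}(n,\mathbb R)$-invariant. Then there is a measurable $\alpha$ with $a(Z)=\alpha(\mathrm{Im}\,Z)$ for a.e. $Z\in\mathscr S_n$, and for any such $\alpha$ the integral $$\gamma_{a,\lambda}(X)=\frac{2^{\frac{n(n+1)}2}\det(X)^{\lambda-\frac{n+1}2}}{\Gamma_{\Omega_n}\big(\lambda-\frac{n+1}2\big)}\int_{\Omega_n}\alpha(Y)\,e^{-2\mathrm{tr}(XY)}\det(2Y)^{\lambda-n-1}\,dY$$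 converges absolutely for every $X\in\Omega_n$ and defines a function $\gamma_{a,\lambda}\in L^\infty(\Omega_n)$. Moreover $$R_\lambda T^{(\lambda)}_a=M_{\gamma_{a,\lambda}}R_\lambda \ \text{ on } \mathcal A^2_\lambda(\mathscr S_n),\qquad R_\lambda T^{(\lambda)}_aR_\lambda^*=M_{\gamma_{a,\lambda}}\ \text{ on } L^2(\Omega_n),$$ where $M_{\gamma_{a,\lambda}}$ is multiplication by $\gamma_{a,\lambda}$. -/

import Mathlib

open MeasureTheory
open scoped ENNReal

noncomputable section

namespace SiegelToeplitz

/-! ### Symmetric matrices -/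

/-- Symmetric `n × n` arrays, as a subspace of the space `𝕜^(n × n)` with its Euclidean
(Hilbert--Schmidt) inner product. -/
def symSubmodule (n : ℕ) (𝕜 : Type) [RCLike 𝕜] :
    Submodule 𝕜 (EuclideanSpace 𝕜 (Fin n × Fin n)) where
  carrier := {x | ∀ i j, x (i, j) = x (j, i)}
  add_mem' := by
    intro x y hx hy i j
    simp [hx i j, hy i j]
  zero_mem' := by
    intro i j
    simp
  smul_mem' := by
    intro c x hx i j
    simp [hx i j]

/-- The space `Symm(n, 𝕜)` of symmetric matrices.  For `𝕜 = ℝ` its inner product is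
`(X, Y) ↦ tr (X * Y)`, and `volume` is the Lebesgue measure of that Euclidean space. -/
def SymMat (n : ℕ) (𝕜 : Type) [RCLike 𝕜] : Type := symSubmodule n 𝕜

namespace SymMat

variable {n : ℕ} {𝕜 : Type} [RCLike 𝕜]

instance : NormedAddCommGroup (SymMat n 𝕜) :=
  inferInstanceAs (NormedAddCommGroup (symSubmodule n 𝕜))

instance : InnerProductSpace 𝕜 (SymMat n 𝕜) :=
  inferInstanceAs (InnerProductSpace 𝕜 (symSubmodule n 𝕜))

instance : FiniteDimensional 𝕜 (SymMat n 𝕜) :=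
  inferInstanceAs (FiniteDimensional 𝕜 (symSubmodule n 𝕜))

instance : MeasurableSpace (SymMat n 𝕜) := borel (SymMat n 𝕜)

instance : BorelSpace (SymMat n 𝕜) := ⟨rfl⟩

/-- The underlying matrix. -/
def toMatrix (X : SymMat n 𝕜) : Matrix (Fin n) (Fin n) 𝕜 := fun i j => X.1 (i, j)

/-- A symmetric matrix as an element of `Symm(n, 𝕜)`. -/
def ofMatrix (A : Matrix (Fin n) (Fin n) 𝕜) (hA : A.IsSymm) : SymMat n 𝕜 :=
  ⟨WithLp.toLp 2 fun p => A p.1 p.2, fun i j => hA.apply j i⟩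

theorem isSymm_toMatrix (X : SymMat n 𝕜) : X.toMatrix.IsSymm :=
  Matrix.IsSymm.ext fun i j => X.2 j i

/-- The inner product of `Symm(n, ℝ)` is the one induced by the trace. -/
theorem inner_eq_trace (X Y : SymMat n ℝ) :
    inner ℝ X Y = (X.toMatrix * Y.toMatrix).trace := by
  have h : inner ℝ X Y = inner ℝ X.1 Y.1 := rfl
  rw [h, PiLp.inner_apply, Fintype.sum_prod_type]
  simp only [Matrix.trace, Matrix.diag, Matrix.mul_apply, toMatrix]
  refine Finset.sum_congr rfl fun i _ => Finset.sum_congr rfl fun j _ => ?_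
  rw [Y.2 j i]
  simp [mul_comm]

/-- `Re Z`, entrywise. -/
def re (Z : SymMat n ℂ) : SymMat n ℝ :=
  ofMatrix (Z.toMatrix.map Complex.re) (Z.isSymm_toMatrix.map _)

/-- `Im Z`, entrywise. -/
def im (Z : SymMat n ℂ) : SymMat n ℝ :=
  ofMatrix (Z.toMatrix.map Complex.im) (Z.isSymm_toMatrix.map _)

/-- The complex symmetric matrix `X + i Y`. -/
def ofReIm (X Y : SymMat n ℝ) : SymMat n ℂ :=
  ofMatrix (fun i j => (X.toMatrix i j : ℂ) + Complex.I * (Y.toMatrix i j : ℂ))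
    (Matrix.IsSymm.ext fun i j => by
      rw [X.isSymm_toMatrix.apply, Y.isSymm_toMatrix.apply])

/-- The inverse of a symmetric matrix (only used for positive definite ones). -/
def inv (X : SymMat n ℝ) : SymMat n ℝ :=
  ofMatrix X.toMatrix⁻¹ (by
    rw [Matrix.IsSymm, Matrix.transpose_nonsing_inv, X.isSymm_toMatrix])

/-- `tr (X * Y)` for real symmetric matrices. -/
def trMul (X Y : SymMat n ℝ) : ℝ := (X.toMatrix * Y.toMatrix).trace

/-- `tr (ξ * Z)` for a real symmetric `ξ` and a complex symmetric `Z`. -/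
def trMulC (ξ : SymMat n ℝ) (Z : SymMat n ℂ) : ℂ :=
  (ξ.toMatrix.map Complex.ofReal * Z.toMatrix).trace

/-- `det X`. -/
def det (X : SymMat n ℝ) : ℝ := X.toMatrix.det

end SymMat

/-! ### The cone, the Siegel domain and their measures -/

/-- The cone `Ω_n` of positive definite real symmetric matrices. -/
def posCone (n : ℕ) : Set (SymMat n ℝ) := {X | X.toMatrix.PosDef}

/-- The Siegel domain `𝒮_n = {Z ∈ Symm(n, ℂ) : Im Z > 0}`. -/
def siegelDomain (n : ℕ) : Set (SymMat n ℂ) := {Z | Z.im ∈ posCone n}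

/-- Lebesgue measure on `Ω_n`. -/
def coneVolume (n : ℕ) : Measure (SymMat n ℝ) := volume.restrict (posCone n)

/-- Lebesgue measure `dZ = dX dY` (`Z = X + i Y`) on `𝒮_n`. -/
def siegelVolume (n : ℕ) : Measure (SymMat n ℂ) :=
  (((volume : Measure (SymMat n ℝ)).prod (volume : Measure (SymMat n ℝ))).map
    fun p => SymMat.ofReIm p.1 p.2).restrict (siegelDomain n)

/-- The multi-gamma function
`Γ_Ω(λ) = (2π)^(n(n-1)/4) ∏_{j=1}^n Γ(λ - (j-1)/2)` of the cone `Ω_n`. -/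
def coneGamma (n : ℕ) (lam : ℝ) : ℝ :=
  (2 * Real.pi) ^ ((n : ℝ) * ((n : ℝ) - 1) / 4) *
    ∏ j ∈ Finset.range n, Real.Gamma (lam - (j : ℝ) / 2)

/-- `C_{λ,n} = Γ_Ω(λ) / (π^(n(n+1)/2) Γ_Ω(λ - (n+1)/2))`. -/
def weightConst (n : ℕ) (lam : ℝ) : ℝ :=
  coneGamma n lam /
    (Real.pi ^ ((n : ℝ) * ((n : ℝ) + 1) / 2) * coneGamma n (lam - ((n : ℝ) + 1) / 2))

/-- `det(2Y)^(λ-n-1)`. -/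
def detWeight (n : ℕ) (lam : ℝ) (Y : SymMat n ℝ) : ℝ :=
  ((2 : ℝ) • Y).det ^ (lam - (n : ℝ) - 1)

/-- The measure `C_{λ,n} det(2Y)^(λ-n-1) dY` on `Ω_n`. -/
def coneWeighted (n : ℕ) (lam : ℝ) : Measure (SymMat n ℝ) :=
  (coneVolume n).withDensity fun Y => ENNReal.ofReal (weightConst n lam * detWeight n lam Y)

/-- The weighted measure `C_{λ,n} det(-i(Z - Z̄))^(λ-n-1) dZ` on `𝒮_n`;
note that `-i(Z - Z̄) = 2 Im Z`. -/
def siegelWeighted (n : ℕ) (lam : ℝ) : Measure (SymMat n ℂ) :=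
  (siegelVolume n).withDensity
    fun Z => ENNReal.ofReal (weightConst n lam * detWeight n lam Z.im)

/-! ### Hilbert spaces -/

/-- `L²(Ω_n)`. -/
abbrev L2Cone (n : ℕ) : Type := Lp ℂ 2 (coneVolume n)

/-- `L²(𝒮_n)` for the weighted measure. -/
abbrev L2Siegel (n : ℕ) (lam : ℝ) : Type := Lp ℂ 2 (siegelWeighted n lam)

/-- `L²(Symm(n,ℝ), dX) ⊗ L²(Ω_n, C_{λ,n} det(2Y)^(λ-n-1) dY)`,
realized as the `L²` space of the product measure. -/
abbrev L2Tensor (n : ℕ) (lam : ℝ) : Type :=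
  Lp ℂ 2 ((volume : Measure (SymMat n ℝ)).prod (coneWeighted n lam))

/-- The weighted Bergman space `𝒜²_λ(𝒮_n)`: the classes in `L²` with a representative that is
holomorphic on `𝒮_n`. -/
def bergmanSpace (n : ℕ) (lam : ℝ) : Submodule ℂ (L2Siegel n lam) where
  carrier := {f | ∃ g : SymMat n ℂ → ℂ,
    DifferentiableOn ℂ g (siegelDomain n) ∧ f =ᵐ[siegelWeighted n lam] g}
  add_mem' := by
    rintro f₁ f₂ ⟨g₁, hg₁, h₁⟩ ⟨g₂, hg₂, h₂⟩
    exact ⟨g₁ + g₂, hg₁.add hg₂, (Lp.coeFn_add f₁ f₂).trans (h₁.add h₂)⟩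
  zero_mem' := ⟨0, differentiableOn_const 0, Lp.coeFn_zero _ _ _⟩
  smul_mem' := by
    rintro c f ⟨g, hg, h⟩
    exact ⟨c • g, hg.const_smul c, (Lp.coeFn_smul c f).trans (h.const_smul c)⟩

/-- The multiplication operator `M_g` on `L²(μ)` with `g ∈ L^∞(μ)`. -/
def mulOp {E : Type} [MeasurableSpace E] {μ : Measure E} (g : E → ℂ) (hg : MemLp g ∞ μ) :
    Lp ℂ 2 μ →L[ℂ] Lp ℂ 2 μ :=
  (ContinuousLinearMap.mul ℂ ℂ).holderL μ ∞ 2 2 (hg.toLp g)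

theorem mulOp_coeFn {E : Type} [MeasurableSpace E] {μ : Measure E} (g : E → ℂ)
    (hg : MemLp g ∞ μ) (f : Lp ℂ 2 μ) : mulOp g hg f =ᵐ[μ] fun x => g x * f x := by
  have h := (ContinuousLinearMap.mul ℂ ℂ).coeFn_holder (r := 2) (hg.toLp g) f
  filter_upwards [h, hg.coeFn_toLp] with x hx hy
  have e : mulOp g hg f = (ContinuousLinearMap.mul ℂ ℂ).holder 2 (hg.toLp g) f := rfl
  rw [e, hx, hy]
  rfl

/-- `L^∞` for Lebesgue measure on `𝒮_n` is contained in `L^∞` for the weighted measure. -/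
theorem memLp_siegelWeighted {n : ℕ} (lam : ℝ) {a : SymMat n ℂ → ℂ}
    (ha : MemLp a ∞ (siegelVolume n)) : MemLp a ∞ (siegelWeighted n lam) := by
  have hac : siegelWeighted n lam ≪ siegelVolume n := withDensity_absolutelyContinuous _ _
  refine ⟨ha.1.mono_ac hac, ?_⟩
  have h2 := ha.2
  rw [eLpNorm_exponent_top] at h2 ⊢
  exact (eLpNormEssSup_mono_measure a hac).trans_lt h2

/-- The Toeplitz operator `T_a = B ∘ M_a` on the Bergman space, where `B` is the orthogonal
projection of `L²` onto the Bergman space (which exists when that space is complete). -/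
def toeplitz (n : ℕ) (lam : ℝ) [CompleteSpace (bergmanSpace n lam)]
    (a : SymMat n ℂ → ℂ) (ha : MemLp a ∞ (siegelVolume n)) :
    bergmanSpace n lam →L[ℂ] bergmanSpace n lam :=
  (bergmanSpace n lam).orthogonalProjectionOnto ∘L
    mulOp a (memLp_siegelWeighted lam ha) ∘L (bergmanSpace n lam).subtypeL

/-! ### Invariant symbols and moment map symbols -/

/-- `a` is `Symm(n,ℝ)`-invariant: for every real symmetric `S`, `a (Z + S) = a Z` for almost
every `Z ∈ 𝒮_n`. -/
def IsSymInvariant {n : ℕ} (a : SymMat n ℂ → ℂ) : Prop :=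
  ∀ S : SymMat n ℝ, ∀ᵐ Z ∂(siegelVolume n), a (Z + SymMat.ofReIm S 0) = a Z

/-- The moment map `Z ↦ -2 Im(Z)⁻¹` of the action `S · Z = Z + S` of `Symm(n,ℝ)` on `𝒮_n`. -/
def parabolicMoment {n : ℕ} (Z : SymMat n ℂ) : SymMat n ℝ := (-2 : ℝ) • Z.im.inv

/-- `a` is a moment map symbol: it agrees almost everywhere with a measurable function of the
moment map. -/
def IsMomentSymbol {n : ℕ} (a : SymMat n ℂ → ℂ) : Prop :=
  ∃ f : SymMat n ℝ → ℂ, Measurable f ∧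
    a =ᵐ[siegelVolume n] fun Z => f (parabolicMoment Z)

/-! ### The Fourier--Laplace transform `R_λ = S_λ^* U` -/

/-- The Fourier transform
`(ℱ φ)(X) = (2π)^(-n(n+1)/4) ∫ e^(-i tr(Xξ)) φ(ξ) dξ` on `Symm(n,ℝ)`. -/
def symFourier {n : ℕ} (φ : SymMat n ℝ → ℂ) (X : SymMat n ℝ) : ℂ :=
  ((1 / (2 * Real.pi) ^ ((n : ℝ) * ((n : ℝ) + 1) / 4) : ℝ) : ℂ) *
    ∫ ξ, Complex.exp (-Complex.I * (X.trMul ξ : ℂ)) * φ ξ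

/-- `U = ℱ ⊗ I` in the coordinates `Z = X + i Y`: it sends `φ ⊗ ψ` to `(ℱ φ) ⊗ ψ` whenever
`φ ∈ L¹ ∩ L²` and `ψ ∈ L²`.  As such tensors span a dense subspace, at most one unitary
operator has this property. -/
def IsPartialFourier {n : ℕ} {lam : ℝ} (U : L2Siegel n lam ≃ₗᵢ[ℂ] L2Tensor n lam) : Prop :=
  ∀ φ ψ : SymMat n ℝ → ℂ, Integrable φ → MemLp φ 2 → MemLp ψ 2 (coneWeighted n lam) →
    ∀ f : L2Siegel n lam, f =ᵐ[siegelWeighted n lam] (fun Z => φ Z.re * ψ Z.im) →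
      U f =ᵐ[(volume : Measure (SymMat n ℝ)).prod (coneWeighted n lam)]
        fun p => symFourier φ p.1 * ψ p.2

/-- The function `(X, Y) ↦ (2π)^(n(n+1)/4) Γ_Ω(λ)^(-1/2) χ_Ω(X) h(X)
det(X)^(λ/2-(n+1)/4) e^(-tr(XY))`. -/
def sFun (n : ℕ) (lam : ℝ) (h : SymMat n ℝ → ℂ) (p : SymMat n ℝ × SymMat n ℝ) : ℂ :=
  (((2 * Real.pi) ^ ((n : ℝ) * ((n : ℝ) + 1) / 4) / (coneGamma n lam) ^ (1 / 2 : ℝ) : ℝ) : ℂ) *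
    (posCone n).indicator
      (fun X => h X * ((X.det ^ (lam / 2 - ((n : ℝ) + 1) / 4) : ℝ) : ℂ)) p.1 *
    ((Real.exp (-(p.1.trMul p.2)) : ℝ) : ℂ)

/-- `S` is the operator `S_λ`, i.e. it sends `h` to the class of `sFun n lam h`. -/
def IsSOperator {n : ℕ} {lam : ℝ} (S : L2Cone n →ₗᵢ[ℂ] L2Tensor n lam) : Prop :=
  ∀ h : L2Cone n,
    S h =ᵐ[(volume : Measure (SymMat n ℝ)).prod (coneWeighted n lam)] sFun n lam h

/-- `R = S^* U`. -/
def rOperator {n : ℕ} {lam : ℝ} (U : L2Siegel n lam ≃ₗᵢ[ℂ] L2Tensor n lam)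
    (S : L2Cone n →ₗᵢ[ℂ] L2Tensor n lam) : L2Siegel n lam →L[ℂ] L2Cone n :=
  ContinuousLinearMap.adjoint S.toContinuousLinearMap ∘L
    (U.toContinuousLinearEquiv : L2Siegel n lam →L[ℂ] L2Tensor n lam)

/-- `Z ↦ Γ_Ω(λ)^(-1/2) ∫_Ω h(ξ) det(ξ)^(λ/2-(n+1)/4) e^(i tr(ξZ)) dξ`. -/
def fourierLaplace (n : ℕ) (lam : ℝ) (h : SymMat n ℝ → ℂ) (Z : SymMat n ℂ) : ℂ :=
  ((1 / (coneGamma n lam) ^ (1 / 2 : ℝ) : ℝ) : ℂ) *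
    ∫ ξ in posCone n, h ξ * ((ξ.det ^ (lam / 2 - ((n : ℝ) + 1) / 4) : ℝ) : ℂ) *
      Complex.exp (Complex.I * ξ.trMulC Z)

/-- The integrand `α(Y) e^(-2 tr(XY)) det(2Y)^(λ-n-1)`. -/
def gammaIntegrand (n : ℕ) (lam : ℝ) (α : SymMat n ℝ → ℂ) (X Y : SymMat n ℝ) : ℂ :=
  α Y * ((Real.exp (-2 * X.trMul Y) : ℝ) : ℂ) * ((detWeight n lam Y : ℝ) : ℂ)

/-- The spectral function
`γ(X) = 2^(n(n+1)/2) det(X)^(λ-(n+1)/2) / Γ_Ω(λ-(n+1)/2) ∫_Ω α(Y) e^(-2tr(XY)) det(2Y)^(λ-n-1) dY`.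
-/
def gammaFun (n : ℕ) (lam : ℝ) (α : SymMat n ℝ → ℂ) (X : SymMat n ℝ) : ℂ :=
  (((2 : ℝ) ^ ((n : ℝ) * ((n : ℝ) + 1) / 2) * X.det ^ (lam - ((n : ℝ) + 1) / 2) /
      coneGamma n (lam - ((n : ℝ) + 1) / 2) : ℝ) : ℂ) *
    ∫ Y in posCone n, gammaIntegrand n lam α X Y

end SiegelToeplitz

end

open SiegelToeplitz

noncomputable section

namespace SiegelToeplitz

open Filter Topology Set


/-! Write `W = U⁻¹ S`. The theorem reduces to two facts: `W` is an isometry of `L²(Ω)` onto the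
Bergman space, and `U` carries multiplication by `α(Im Z)` to multiplication by `α(Y)`. Then `R = S*
U = W*`, so `W W*` is the Bergman projection and `W* W` is the identity. Moreover `W* T_a W = W* M_a
W = S* M_α S`. Since `S h` is an explicit function of `(X, Y)`, integrating out `Y` leaves
multiplication by `γ` in `X`.

Normalisation. The Siegel gamma integral (`lintegral_posCone_exp`) evaluates the Laplace transform
of the weight at `X ∈ Ω`; the constants in `S` are its reciprocal, which makes `S` isometric. It is
proved by induction on the matrix size, splitting off a Schur complement, and then by diagonalising
`X`.

Range of `W` inside the Bergman space. `U⁻¹ S h` is the Fourier–Laplace integral of `h`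
(`uOperator_symm_sOperator_coeFn`), holomorphic by differentiation under the integral
(`differentiableOn_fourierLaplace`).

Bergman space inside the range of `W`, a Paley–Wiener theorem (`exists_uOperator_eq_sOperator`). Let
`G = U f` with `f` holomorphic. Pairing slices of `f` with an entire band-limited function and
shifting the contour by `i v` gives `G(ξ, Y) = e^⟨ξ,v⟩ G(ξ, v + Y)` almost everywhere, for each `v`.
Hence `e^⟨ξ,Y⟩ G(ξ, Y)` depends on `ξ` alone and `G = k(ξ) e^(-⟨ξ,Y⟩)`. The Laplace transform of the
weight diverges off the closed cone, whose boundary is null, so square integrability forces `k` to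
vanish outside `Ω`. Inside `Ω` the normalisation turns `k` into an `L²` function `h`. Closedness of
the Bergman space follows, as the range of an isometry of a complete space is complete.

Invariant symbols. The null set in the definition of invariance depends on the translation; Fubini
(`exists_ae_eq_of_forall_translation`) still gives `a(Z) = α(Im Z)`. As `Y ↦ -2 Y⁻¹` is injective on
`Ω` with measurable inverse, this is the same as being a moment map symbol. -/

section

/-! ### Functions on a product determined by integrals over rectangles. -/

section Rectangles

variable {α β : Type*} [MeasurableSpace α] [MeasurableSpace β]

/-- An integrable function on a product of finite measure spaces whose integrals over measurable
rectangles vanish is zero. -/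
theorem ae_eq_zero_of_setIntegral_prod_eq_zero {μ : Measure α} {ν : Measure β}
    [IsFiniteMeasure μ] [IsFiniteMeasure ν] {H : α × β → ℂ} (hH : Integrable H (μ.prod ν))
    (h : ∀ A B, MeasurableSet A → MeasurableSet B → ∫ p in A ×ˢ B, H p ∂(μ.prod ν) = 0) :
    H =ᵐ[μ.prod ν] 0 := by
  have key : ∀ s, MeasurableSet s → ∫ p in s, H p ∂(μ.prod ν) = 0 := by
    have huniv : ∫ p, H p ∂(μ.prod ν) = 0 := by
      simpa using h univ univ .univ .univ
    -- Rectangles form a generating π-system; the complement step uses that the total integral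
    -- vanishes.
    refine MeasurableSpace.induction_on_inter generateFrom_prod.symm isPiSystem_prod ?_ ?_ ?_ ?_
    · simp
    · rintro _ ⟨A, hA, B, hB, rfl⟩
      exact h A B hA hB
    · intro t ht h0
      have := integral_add_compl ht hH
      rw [h0, huniv, zero_add] at this
      exact this
    · intro f hd hf h0
      rw [integral_iUnion hf hd hH.integrableOn]
      simp [h0]
  exact hH.ae_eq_zero_of_forall_setIntegral_eq_zero fun s hs _ => key s hs

/-- Local version of `ae_eq_zero_of_setIntegral_prod_eq_zero`: the rectangles `A m ×ˢ B m` cover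
almost everything. -/
theorem ae_eq_zero_of_setIntegral_prod_eq_zero_of_cover {μ : Measure α} {ν : Measure β}
    [SFinite μ] [SFinite ν] {H : α × β → ℂ} (A : ℕ → Set α) (B : ℕ → Set β)
    (hA : ∀ m, MeasurableSet (A m)) (hB : ∀ m, MeasurableSet (B m))
    (hμA : ∀ m, μ (A m) < ∞) (hνB : ∀ m, ν (B m) < ∞)
    (hcov : ∀ᵐ p ∂(μ.prod ν), ∃ m, p.1 ∈ A m ∧ p.2 ∈ B m)
    (hH : ∀ m, IntegrableOn H (A m ×ˢ B m) (μ.prod ν))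
    (h : ∀ m A' B', MeasurableSet A' → MeasurableSet B' → A' ⊆ A m → B' ⊆ B m →
      ∫ p in A' ×ˢ B', H p ∂(μ.prod ν) = 0) :
    H =ᵐ[μ.prod ν] 0 := by
  have h1 : ∀ m, ∀ᵐ p ∂(μ.prod ν), p ∈ A m ×ˢ B m → H p = 0 := by
    intro m
    have : IsFiniteMeasure (μ.restrict (A m)) := ⟨by simpa using hμA m⟩
    have : IsFiniteMeasure (ν.restrict (B m)) := ⟨by simpa using hνB m⟩
    rw [← ae_restrict_iff' ((hA m).prod (hB m))]
    have hr : (μ.restrict (A m)).prod (ν.restrict (B m)) = (μ.prod ν).restrict (A m ×ˢ B m) :=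
      Measure.prod_restrict _ _
    have hi := hH m
    rw [IntegrableOn, ← hr] at hi
    rw [← hr]
    refine ae_eq_zero_of_setIntegral_prod_eq_zero hi fun A' B' hA' hB' => ?_
    rw [hr, Measure.restrict_restrict (hA'.prod hB'), prod_inter_prod]
    exact h m _ _ (hA'.inter (hA m)) (hB'.inter (hB m)) inter_subset_right inter_subset_right
  filter_upwards [ae_all_iff.2 h1, hcov] with p hp ⟨m, hm⟩
  exact hp m hm

end Rectangles

/-! ### Elementary tensors in `L²(μ × ν)`. -/

section Tensor

variable {α β : Type*} [MeasurableSpace α] [MeasurableSpace β] {μ : Measure α} {ν : Measure β}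
  [SFinite μ] [SFinite ν]

theorem lintegral_enorm_sq_eq {α : Type*} [MeasurableSpace α] {μ : Measure α} {f : α → ℂ} :
    eLpNorm f 2 μ ^ 2 = ∫⁻ x, ‖f x‖ₑ ^ 2 ∂μ := by
  have := eLpNorm_nnreal_pow_eq_lintegral (μ := μ) (f := f) (p := 2) two_ne_zero
  simpa using this

theorem memLp_two_iff_lintegral {α : Type*} [MeasurableSpace α] {μ : Measure α} {f : α → ℂ}
    (hf : AEStronglyMeasurable f μ) : MemLp f 2 μ ↔ ∫⁻ x, ‖f x‖ₑ ^ 2 ∂μ < ∞ := by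
  rw [← lintegral_enorm_sq_eq]
  constructor
  · intro h
    exact ENNReal.pow_lt_top h.2
  · intro h
    exact ⟨hf, by simpa using (ENNReal.pow_lt_top_iff.1 h)⟩

theorem eLpNorm_two_tensor {f : α → ℂ} {g : β → ℂ} (hf : AEStronglyMeasurable f μ)
    (hg : AEStronglyMeasurable g ν) :
    eLpNorm (fun p : α × β => f p.1 * g p.2) 2 (μ.prod ν) = eLpNorm f 2 μ * eLpNorm g 2 ν := by
  have h : eLpNorm (fun p : α × β => f p.1 * g p.2) 2 (μ.prod ν) ^ 2 =
      (eLpNorm f 2 μ * eLpNorm g 2 ν) ^ 2 := by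
    rw [mul_pow, lintegral_enorm_sq_eq, lintegral_enorm_sq_eq, lintegral_enorm_sq_eq]
    simp only [enorm_mul, mul_pow]
    exact lintegral_prod_mul (hf.enorm.pow_const 2) (hg.enorm.pow_const 2)
  exact (ENNReal.pow_right_strictMono two_ne_zero).injective h

theorem memLp_two_tensor {f : α → ℂ} {g : β → ℂ} (hf : MemLp f 2 μ) (hg : MemLp g 2 ν) :
    MemLp (fun p : α × β => f p.1 * g p.2) 2 (μ.prod ν) := by
  refine ⟨hf.1.comp_fst.mul hg.1.comp_snd, ?_⟩
  rw [eLpNorm_two_tensor hf.1 hg.1]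
  exact ENNReal.mul_lt_top hf.2 hg.2

/-- The bilinear map `(φ, ψ) ↦ φ ⊗ ψ` from `L²(μ) × L²(ν)` to `L²(μ × ν)`. -/
def tensorL2 (μ : Measure α) (ν : Measure β) [SFinite μ] [SFinite ν] :
    Lp ℂ 2 μ →L[ℂ] Lp ℂ 2 ν →L[ℂ] Lp ℂ 2 (μ.prod ν) :=
  LinearMap.mkContinuous₂
    (LinearMap.mk₂ ℂ (fun φ ψ => (memLp_two_tensor (Lp.memLp φ) (Lp.memLp ψ)).toLp _)
      (by
        intro φ φ' ψ
        rw [← MemLp.toLp_add, MemLp.toLp_eq_toLp_iff]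
        filter_upwards [Measure.quasiMeasurePreserving_fst.ae_eq_comp (Lp.coeFn_add φ φ')] with p hp
        simp only [Function.comp_apply, Pi.add_apply] at hp ⊢
        rw [hp, add_mul])
      (by
        intro c φ ψ
        rw [← MemLp.toLp_const_smul, MemLp.toLp_eq_toLp_iff]
        filter_upwards [Measure.quasiMeasurePreserving_fst.ae_eq_comp (Lp.coeFn_smul c φ)] with p hp
        simp only [Function.comp_apply, Pi.smul_apply, smul_eq_mul] at hp ⊢
        rw [hp, mul_assoc])
      (by
        intro φ ψ ψ'
        rw [← MemLp.toLp_add, MemLp.toLp_eq_toLp_iff]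
        filter_upwards [Measure.quasiMeasurePreserving_snd.ae_eq_comp (Lp.coeFn_add ψ ψ')] with p hp
        simp only [Function.comp_apply, Pi.add_apply] at hp ⊢
        rw [hp, mul_add])
      (by
        intro c φ ψ
        rw [← MemLp.toLp_const_smul, MemLp.toLp_eq_toLp_iff]
        filter_upwards [Measure.quasiMeasurePreserving_snd.ae_eq_comp (Lp.coeFn_smul c ψ)] with p hp
        simp only [Function.comp_apply, Pi.smul_apply, smul_eq_mul] at hp ⊢
        rw [hp, mul_left_comm])) 1 (by
      intro φ ψ
      rw [LinearMap.mk₂_apply, Lp.norm_toLp, eLpNorm_two_tensor (Lp.aestronglyMeasurable φ)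
        (Lp.aestronglyMeasurable ψ), ENNReal.toReal_mul, one_mul]
      rfl)

theorem tensorL2_coeFn (φ : Lp ℂ 2 μ) (ψ : Lp ℂ 2 ν) :
    tensorL2 μ ν φ ψ =ᵐ[μ.prod ν] fun p => φ p.1 * ψ p.2 :=
  MemLp.coeFn_toLp (memLp_two_tensor (Lp.memLp φ) (Lp.memLp ψ))

theorem norm_tensorL2 (φ : Lp ℂ 2 μ) (ψ : Lp ℂ 2 ν) : ‖tensorL2 μ ν φ ψ‖ = ‖φ‖ * ‖ψ‖ := by
  have h : tensorL2 μ ν φ ψ = (memLp_two_tensor (Lp.memLp φ) (Lp.memLp ψ)).toLp _ := rfl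
  rw [h, Lp.norm_toLp, eLpNorm_two_tensor (Lp.aestronglyMeasurable φ)
        (Lp.aestronglyMeasurable ψ), ENNReal.toReal_mul]
  rfl

theorem inner_tensorL2_tensorL2 (φ φ' : Lp ℂ 2 μ) (ψ ψ' : Lp ℂ 2 ν) :
    inner ℂ (tensorL2 μ ν φ ψ) (tensorL2 μ ν φ' ψ') = inner ℂ φ φ' * inner ℂ ψ ψ' := by
  simp only [L2.inner_def]
  rw [← integral_prod_mul]
  refine integral_congr_ae ?_
  filter_upwards [tensorL2_coeFn φ ψ, tensorL2_coeFn φ' ψ'] with p h1 h2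
  rw [h1, h2]
  simp only [RCLike.inner_apply, map_mul]
  ring

/-- Pairing with a tensor as an iterated integral. -/
theorem inner_tensorL2 (φ : Lp ℂ 2 μ) (ψ : Lp ℂ 2 ν) (f : Lp ℂ 2 (μ.prod ν)) :
    inner ℂ (tensorL2 μ ν φ ψ) f =
      ∫ y, (starRingEnd ℂ (ψ y)) * ∫ x, (starRingEnd ℂ (φ x)) * f (x, y) ∂μ ∂ν := by
  have hi := L2.integrable_inner (𝕜 := ℂ) (tensorL2 μ ν φ ψ) f
  have hae : (fun p => inner ℂ (tensorL2 μ ν φ ψ p) (f p)) =ᵐ[μ.prod ν]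
      fun p => (starRingEnd ℂ (ψ p.2)) * ((starRingEnd ℂ (φ p.1)) * f p) := by
    filter_upwards [tensorL2_coeFn φ ψ] with p h1
    rw [h1]
    simp only [RCLike.inner_apply, map_mul]
    ring
  rw [L2.inner_def, integral_congr_ae hae, integral_prod_symm _ (hi.congr hae)]
  simp only [integral_const_mul]

/-- The indicator of a rectangle is a tensor of indicators, so the rectangle criterion becomes
totality of tensors. -/
theorem setIntegral_prod_eq_inner_tensorL2 {A : Set α} {B : Set β} (hA : MeasurableSet A)
    (hB : MeasurableSet B) (hμA : μ A ≠ ∞) (hνB : ν B ≠ ∞) (f : Lp ℂ 2 (μ.prod ν)) :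
    ∫ p in A ×ˢ B, f p ∂(μ.prod ν) =
      inner ℂ (tensorL2 μ ν (indicatorConstLp 2 hA hμA 1) (indicatorConstLp 2 hB hνB 1)) f := by
  rw [L2.inner_def, ← integral_indicator (hA.prod hB)]
  refine integral_congr_ae ?_
  filter_upwards [tensorL2_coeFn (indicatorConstLp 2 hA hμA (1 : ℂ))
    (indicatorConstLp 2 hB hνB (1 : ℂ)),
    Measure.quasiMeasurePreserving_fst.ae_eq_comp
      (indicatorConstLp_coeFn (p := 2) (hs := hA) (hμs := hμA) (c := (1 : ℂ))),
    Measure.quasiMeasurePreserving_snd.ae_eq_comp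
      (indicatorConstLp_coeFn (p := 2) (hs := hB) (hμs := hνB) (c := (1 : ℂ)))] with p h1 h2 h3
  simp only [Function.comp_apply] at h2 h3
  rw [h1, h2, h3]
  by_cases hp1 : p.1 ∈ A <;> by_cases hp2 : p.2 ∈ B <;> simp [hp1, hp2, indicator, mem_prod]

/-- Tensors are total in `L²(μ × ν)`. -/
theorem eq_zero_of_inner_tensorL2 {μ : Measure α} {ν : Measure β} [SigmaFinite μ] [SigmaFinite ν]
    {f : Lp ℂ 2 (μ.prod ν)}
    (h : ∀ φ ψ, inner ℂ (tensorL2 μ ν φ ψ) f = 0) : f = 0 := by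
  rw [Lp.eq_zero_iff_ae_eq_zero]
  refine ae_eq_zero_of_setIntegral_prod_eq_zero_of_cover (spanningSets μ) (spanningSets ν)
    (measurableSet_spanningSets μ) (measurableSet_spanningSets ν)
    (measure_spanningSets_lt_top μ) (measure_spanningSets_lt_top ν) ?_ ?_ ?_
  · refine ae_of_all _ fun p => ?_
    obtain ⟨i, hi⟩ := mem_iUnion.1 (iUnion_spanningSets μ ▸ mem_univ p.1)
    obtain ⟨j, hj⟩ := mem_iUnion.1 (iUnion_spanningSets ν ▸ mem_univ p.2)
    exact ⟨max i j, monotone_spanningSets μ (le_max_left i j) hi,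
      monotone_spanningSets ν (le_max_right i j) hj⟩
  · intro m
    have : IsFiniteMeasure ((μ.prod ν).restrict (spanningSets μ m ×ˢ spanningSets ν m)) := by
      refine ⟨?_⟩
      rw [Measure.restrict_apply_univ, Measure.prod_prod]
      exact ENNReal.mul_lt_top (measure_spanningSets_lt_top μ m) (measure_spanningSets_lt_top ν m)
    exact ((Lp.memLp f).restrict _).integrable one_le_two
  · intro m A' B' hA' hB' hAs hBs
    rw [setIntegral_prod_eq_inner_tensorL2 hA' hB'
      ((measure_mono hAs).trans_lt (measure_spanningSets_lt_top μ m)).ne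
      ((measure_mono hBs).trans_lt (measure_spanningSets_lt_top ν m)).ne]
    exact h _ _

end Tensor

end

section

/-! ### The unitary `A ⊗ I` and its action on slices. -/

section TensorUnitary

variable {α β : Type*} [MeasurableSpace α] [MeasurableSpace β] {μ : Measure α} {ν : Measure β}
  [SigmaFinite μ] [SigmaFinite ν]

/-- The isometry `φ ↦ A φ ⊗ ψ` for a unit vector `ψ`. -/
def tensorIsometry (A : Lp ℂ 2 μ ≃ₗᵢ[ℂ] Lp ℂ 2 μ) (ψ : Lp ℂ 2 ν) (hψ : ‖ψ‖ = 1) :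
    Lp ℂ 2 μ →ₗᵢ[ℂ] Lp ℂ 2 (μ.prod ν) where
  toLinearMap := ((tensorL2 μ ν).flip ψ).toLinearMap ∘ₗ A.toLinearEquiv.toLinearMap
  norm_map' φ := by
    have : ‖tensorL2 μ ν (A φ) ψ‖ = ‖φ‖ := by rw [norm_tensorL2, hψ, mul_one, A.norm_map]
    exact this

theorem tensorIsometry_apply (A : Lp ℂ 2 μ ≃ₗᵢ[ℂ] Lp ℂ 2 μ) (ψ : Lp ℂ 2 ν) (hψ : ‖ψ‖ = 1)
    (φ : Lp ℂ 2 μ) : tensorIsometry A ψ hψ φ = tensorL2 μ ν (A φ) ψ := rfl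

/-- Orthogonality comes from that of the basis vectors `b i`. For density, a vector orthogonal to
all `φ ⊗ b i` is orthogonal to all `φ ⊗ ψ`, because the pairing is continuous in `ψ` and the `b i`
have dense span. -/
theorem isHilbertSum_tensorIsometry (A : Lp ℂ 2 μ ≃ₗᵢ[ℂ] Lp ℂ 2 μ) {ι : Type*}
    (b : HilbertBasis ι ℂ (Lp ℂ 2 ν)) :
    IsHilbertSum ℂ (fun _ : ι => Lp ℂ 2 μ)
      (fun i => tensorIsometry A (b i) (b.orthonormal.1 i)) := by
  refine IsHilbertSum.mk ?_ ?_
  · intro i j hij φ φ'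
    simp only [tensorIsometry_apply]
    rw [inner_tensorL2_tensorL2, b.orthonormal.2 hij, mul_zero]
  · refine le_of_eq (Eq.symm ?_)
    rw [Submodule.topologicalClosure_eq_top_iff, Submodule.eq_bot_iff]
    intro f hf
    refine eq_zero_of_inner_tensorL2 fun φ ψ => ?_
    have hb : ∀ i, inner ℂ f (tensorL2 μ ν φ (b i)) = 0 := by
      intro i
      have hmem : tensorL2 μ ν φ (b i) ∈
          ⨆ i, LinearMap.range (tensorIsometry A (b i) (b.orthonormal.1 i)).toLinearMap := by
        refine Submodule.mem_iSup_of_mem i ⟨A.symm φ, ?_⟩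
        change tensorL2 μ ν (A (A.symm φ)) (b i) = _
        rw [A.apply_symm_apply]
      exact (Submodule.mem_orthogonal' _ _).1 hf _ hmem
    have h0 : (innerSL ℂ f) ∘L (tensorL2 μ ν φ) = 0 := by
      refine ContinuousLinearMap.ext_on (s := range b)
        ((Submodule.dense_iff_topologicalClosure_eq_top).2 b.dense_span) ?_
      rintro _ ⟨i, rfl⟩
      simpa using hb i
    have h1 : inner ℂ f (tensorL2 μ ν φ ψ) = 0 := by
      simpa using DFunLike.congr_fun h0 ψ
    rw [← inner_conj_symm, h1, map_zero]

/-- The unitary operator `A ⊗ I`. -/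
theorem exists_tensor_unitary (ν : Measure β) [SigmaFinite ν] (A : Lp ℂ 2 μ ≃ₗᵢ[ℂ] Lp ℂ 2 μ) :
    ∃ U : Lp ℂ 2 (μ.prod ν) ≃ₗᵢ[ℂ] Lp ℂ 2 (μ.prod ν),
      ∀ φ ψ, U (tensorL2 μ ν φ ψ) = tensorL2 μ ν (A φ) ψ := by
  classical
  obtain ⟨w, b, -⟩ := exists_hilbertBasis ℂ (Lp ℂ 2 ν)
  -- The decompositions belonging to the identity and to `A` share one coordinate space; passing
  -- through it sends `φ ⊗ b i` to `A φ ⊗ b i`.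
  have h1 := isHilbertSum_tensorIsometry (LinearIsometryEquiv.refl ℂ (Lp ℂ 2 μ)) b
  have h2 := isHilbertSum_tensorIsometry A b
  refine ⟨h1.linearIsometryEquiv.trans h2.linearIsometryEquiv.symm, fun φ ψ => ?_⟩
  set U := h1.linearIsometryEquiv.trans h2.linearIsometryEquiv.symm with hU
  have hb : ∀ i, U (tensorL2 μ ν φ (b i)) = tensorL2 μ ν (A φ) (b i) := by
    intro i
    have e1 : h1.linearIsometryEquiv (tensorL2 μ ν φ (b i)) = lp.single 2 i φ := by
      rw [← LinearIsometryEquiv.eq_symm_apply, h1.linearIsometryEquiv_symm_apply_single]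
      rfl
    rw [hU, LinearIsometryEquiv.trans_apply, e1, h2.linearIsometryEquiv_symm_apply_single]
    rfl
  have h0 : (U.toContinuousLinearEquiv : Lp ℂ 2 (μ.prod ν) →L[ℂ] Lp ℂ 2 (μ.prod ν)) ∘L
      (tensorL2 μ ν φ) = tensorL2 μ ν (A φ) := by
    refine ContinuousLinearMap.ext_on (s := range b)
      ((Submodule.dense_iff_topologicalClosure_eq_top).2 b.dense_span) ?_
    rintro _ ⟨i, rfl⟩
    exact hb i
  exact DFunLike.congr_fun h0 ψ

/-- Fubini for the pairing of `f` with `p ⊗ χ_B`. It allows slicewise pairings to be compared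
through their integrals over sets of finite measure. -/
theorem integrableOn_integral_conj_mul (p : Lp ℂ 2 μ) (f : Lp ℂ 2 (μ.prod ν)) {B : Set β}
    (hB : MeasurableSet B) (hνB : ν B < ∞) :
    IntegrableOn (fun y => ∫ x, (starRingEnd ℂ (p x)) * f (x, y) ∂μ) B ν := by
  set χ := indicatorConstLp 2 hB hνB.ne (1 : ℂ)
  have hi := L2.integrable_inner (𝕜 := ℂ) (tensorL2 μ ν p χ) f
  rw [← integrable_indicator_iff hB]
  have hae : (fun q => inner ℂ (tensorL2 μ ν p χ q) (f q)) =ᵐ[μ.prod ν]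
      fun q => B.indicator 1 q.2 * ((starRingEnd ℂ (p q.1)) * f q) := by
    filter_upwards [tensorL2_coeFn p χ, Measure.quasiMeasurePreserving_snd.ae_eq_comp
      (indicatorConstLp_coeFn (p := 2) (hs := hB) (hμs := hνB.ne) (c := (1 : ℂ)))] with q h1 h2
    simp only [Function.comp_apply] at h2
    rw [h1, h2]
    by_cases hq : q.2 ∈ B <;> simp [hq, RCLike.inner_apply, mul_comm]
  refine ((hi.congr hae).integral_prod_right).congr (ae_of_all _ fun y => ?_)
  by_cases hy : y ∈ B <;> simp [hy]

theorem setIntegral_integral_conj_mul (p : Lp ℂ 2 μ) (f : Lp ℂ 2 (μ.prod ν)) {B : Set β}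
    (hB : MeasurableSet B) (hνB : ν B < ∞) :
    ∫ y in B, ∫ x, (starRingEnd ℂ (p x)) * f (x, y) ∂μ ∂ν =
      inner ℂ (tensorL2 μ ν p (indicatorConstLp 2 hB hνB.ne (1 : ℂ))) f := by
  rw [inner_tensorL2, ← integral_indicator hB]
  refine integral_congr_ae ?_
  filter_upwards [indicatorConstLp_coeFn (p := 2) (hs := hB) (hμs := hνB.ne) (c := (1 : ℂ))]
    with y hy
  rw [hy]
  by_cases hy : y ∈ B <;> simp [hy]

/-- Slicewise, `A ⊗ I` acts as `A`, in the weak sense. -/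
theorem ae_integral_conj_mul_eq {A : Lp ℂ 2 μ ≃ₗᵢ[ℂ] Lp ℂ 2 μ}
    {U : Lp ℂ 2 (μ.prod ν) ≃ₗᵢ[ℂ] Lp ℂ 2 (μ.prod ν)}
    (hU : ∀ φ ψ, U (tensorL2 μ ν φ ψ) = tensorL2 μ ν (A φ) ψ)
    (p : Lp ℂ 2 μ) (f : Lp ℂ 2 (μ.prod ν)) :
    ∀ᵐ y ∂ν, ∫ x, (starRingEnd ℂ (p x)) * f (x, y) ∂μ =
      ∫ x, (starRingEnd ℂ (A p x)) * (U f) (x, y) ∂μ := by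
  refine ae_eq_of_forall_setIntegral_eq_of_sigmaFinite
    (fun B hB hνB => integrableOn_integral_conj_mul p f hB hνB)
    (fun B hB hνB => integrableOn_integral_conj_mul (A p) (U f) hB hνB) fun B hB hνB => ?_
  rw [setIntegral_integral_conj_mul _ _ hB hνB, setIntegral_integral_conj_mul _ _ hB hνB, ← hU,
    U.inner_map_map]

end TensorUnitary

/-- A strongly measurable function on `α × V` which is invariant under all translations of `V`,
within the open set `O`, is independent of the second variable. -/
theorem exists_ae_eq_of_forall_translation {α V : Type*} [MeasurableSpace α] {κ : Measure α}
    [SFinite κ] [NormedAddCommGroup V] [MeasurableSpace V] [BorelSpace V]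
    [SecondCountableTopology V] {m : Measure V} [SFinite m]
    [m.IsAddLeftInvariant] {O : Set V} (hO : MeasurableSet O) (hm : m O ≠ 0) {H : α × V → ℂ}
    (hH : StronglyMeasurable H)
    (h : ∀ v : V, ∀ᵐ q ∂(κ.prod m), q.2 ∈ O → v + q.2 ∈ O → H (q.1, v + q.2) = H q) :
    ∃ y₀ ∈ O, ∀ᵐ q ∂(κ.prod m), q.2 ∈ O → H q = H (q.1, y₀) := by
  let P : V → V → α → Prop := fun v y x => y ∈ O → v + y ∈ O → H (x, v + y) = H (x, y)
  have hPm : MeasurableSet {t : V × (V × α) | P t.1 t.2.1 t.2.2} := by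
    have e : {t : V × (V × α) | P t.1 t.2.1 t.2.2} =
        {t | t.2.1 ∈ O}ᶜ ∪ ({t | t.1 + t.2.1 ∈ O}ᶜ ∪
          {t | H (t.2.2, t.1 + t.2.1) = H (t.2.2, t.2.1)}) := by
      ext t; simp only [P, mem_ofPred_eq, mem_union, mem_compl_iff]; tauto
    rw [e]
    refine (measurableSet_preimage (by fun_prop) hO).compl.union
      ((measurableSet_preimage (by fun_prop) hO).compl.union ?_)
    exact (hH.comp_measurable (by fun_prop)).measurableSet_eq_fun
      (hH.comp_measurable (by fun_prop))
  -- The exceptional null set of the hypothesis depends on `v`. Measurability of the condition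
  -- allows the order of quantifiers to be exchanged: for almost every `(y, x)`, almost every `v` is
  -- good.
  have h1 : ∀ᵐ t ∂(m.prod (m.prod κ)), P t.1 t.2.1 t.2.2 := by
    rw [Measure.ae_prod_iff_ae_ae hPm]
    refine ae_of_all _ fun v => ?_
    have := (Measure.measurePreserving_swap (μ := m) (ν := κ)).quasiMeasurePreserving.ae (h v)
    exact this
  have h2 : ∀ᵐ t ∂((m.prod κ).prod m), P t.2 t.1.1 t.1.2 := by
    have := (Measure.measurePreserving_swap
      (μ := m.prod κ) (ν := m)).quasiMeasurePreserving.ae h1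
    exact this
  have h3 : ∀ᵐ s ∂(m.prod κ), ∀ᵐ v ∂m, P v s.1 s.2 := Measure.ae_ae_of_ae_prod h2
  have hQm : MeasurableSet {t : (V × α) × V |
      t.1.1 ∈ O → t.2 ∈ O → H (t.1.2, t.2) = H (t.1.2, t.1.1)} := by
    have e : {t : (V × α) × V | t.1.1 ∈ O → t.2 ∈ O → H (t.1.2, t.2) = H (t.1.2, t.1.1)} =
        {t | t.1.1 ∈ O}ᶜ ∪ ({t | t.2 ∈ O}ᶜ ∪ {t | H (t.1.2, t.2) = H (t.1.2, t.1.1)}) := by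
      ext t; simp only [mem_ofPred_eq, mem_union, mem_compl_iff]; tauto
    rw [e]
    refine (measurableSet_preimage (by fun_prop) hO).compl.union
      ((measurableSet_preimage (by fun_prop) hO).compl.union ?_)
    exact (hH.comp_measurable (by fun_prop)).measurableSet_eq_fun
      (hH.comp_measurable (by fun_prop))
  have h4 : ∀ᵐ t ∂((m.prod κ).prod m),
      t.1.1 ∈ O → t.2 ∈ O → H (t.1.2, t.2) = H (t.1.2, t.1.1) := by
    rw [Measure.ae_prod_iff_ae_ae hQm]
    filter_upwards [h3] with s hs
    -- Substituting `v = y' - y` turns almost every translation into almost every endpoint `y'`.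
    filter_upwards [(measurePreserving_add_right m (-s.1)).quasiMeasurePreserving.ae hs]
      with y' hy' h1 h2
    have := hy' h1
    rw [neg_add_cancel_right] at this
    exact this h2
  have h5 : ∀ᵐ t ∂(m.prod (κ.prod m)),
      t.1 ∈ O → t.2.2 ∈ O → H (t.2.1, t.2.2) = H (t.2.1, t.1) := by
    have := (measurePreserving_prodAssoc m κ m).symm.quasiMeasurePreserving.ae h4
    exact this
  have h6 := Measure.ae_ae_of_ae_prod h5
  -- Positive measure of `O` leaves room for a base point `y₀` outside the last null set.
  have hfreq : ∃ᵐ y ∂m, y ∈ O := by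
    rw [Filter.Frequently, ae_iff]
    simpa using hm
  obtain ⟨y₀, hy₀, hq⟩ := (hfreq.and_eventually h6).exists
  refine ⟨y₀, hy₀, ?_⟩
  filter_upwards [hq] with q hq' hqO
  exact hq' hy₀ hqO

end

section

/-! ### The `L²` Fourier transform with kernel `e^(-i⟨X, ξ⟩)`. -/

section Fourier

open scoped FourierTransform SchwartzMap ContDiff

variable {E : Type*} [NormedAddCommGroup E] [InnerProductSpace ℝ E] [FiniteDimensional ℝ E]
  [MeasurableSpace E] [BorelSpace E]

theorem continuous_fourier_of_integrable {φ : E → ℂ} (h1 : Integrable φ) : Continuous (𝓕 φ) :=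
  VectorFourier.fourierIntegral_continuous Real.continuous_fourierChar
    (L := innerₗ E) continuous_inner h1

theorem continuous_fourierInv_of_integrable {φ : E → ℂ} (h1 : Integrable φ) :
    Continuous (𝓕⁻ φ) := by
  have : 𝓕⁻ φ = fun w => 𝓕 φ (-w) := funext fun w => Real.fourierInv_eq_fourier_neg φ w
  rw [this]
  exact (continuous_fourier_of_integrable h1).comp continuous_neg

/-- The `L²` Fourier transform agrees with the Fourier integral on `L¹ ∩ L²`. -/
theorem coeFn_fourier_toLp {φ : E → ℂ} (h1 : Integrable φ) (h2 : MemLp φ 2) :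
    (𝓕 (h2.toLp φ) : Lp ℂ 2 (volume : Measure E)) =ᵐ[volume] 𝓕 φ := by
  -- Testing against smooth compactly supported functions suffices. There the `L²` transform is the
  -- distributional one, and the Fourier integral has the same transposition rule by Fubini.
  refine ae_eq_of_integral_contDiff_smul_eq ((Lp.memLp _).locallyIntegrable one_le_two)
    (continuous_fourier_of_integrable h1).locallyIntegrable fun g hg hgs => ?_
  have hgs' : HasCompactSupport (fun x => (g x : ℂ)) := hgs.comp_left Complex.ofReal_zero
  let G : 𝓢(E, ℂ) := hgs'.toSchwartzMap (Complex.ofRealCLM.contDiff.comp hg)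
  have hG : ∀ x, G x = (g x : ℂ) := fun x => rfl
  have key := DFunLike.congr_fun (Lp.fourier_toTemperedDistribution_eq (h2.toLp φ)) G
  rw [TemperedDistribution.fourier_apply, Lp.toTemperedDistribution_apply,
    Lp.toTemperedDistribution_apply] at key
  have e1 : ∫ x, g x • (𝓕 (h2.toLp φ) : Lp ℂ 2 (volume : Measure E)) x =
      ∫ x, G x • (𝓕 (h2.toLp φ) : Lp ℂ 2 (volume : Measure E)) x := by
    simp [hG]
  have e2 : ∫ x, g x • 𝓕 φ x = ∫ x, G x • 𝓕 φ x := by simp [hG]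
  rw [e1, e2, ← key]
  have e3 : ∫ x, 𝓕 G x • (h2.toLp φ) x = ∫ x, 𝓕 G x • φ x := by
    refine integral_congr_ae ?_
    filter_upwards [h2.coeFn_toLp] with x hx
    rw [hx]
  rw [e3, SchwartzMap.fourier_coe]
  have := VectorFourier.integral_fourierIntegral_smul_eq_flip (L := innerₗ E)
    (μ := volume) (ν := volume) Real.continuous_fourierChar continuous_inner G.integrable h1
  rw [flip_innerₗ] at this
  exact this

/-- The argument of `coeFn_fourier_toLp`, with the inverse transform seen as the Fourier integral of
the form `-innerₗ E`. -/
theorem coeFn_fourierInv_toLp {φ : E → ℂ} (h1 : Integrable φ) (h2 : MemLp φ 2) :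
    (𝓕⁻ (h2.toLp φ) : Lp ℂ 2 (volume : Measure E)) =ᵐ[volume] 𝓕⁻ φ := by
  refine ae_eq_of_integral_contDiff_smul_eq ((Lp.memLp _).locallyIntegrable one_le_two)
    (continuous_fourierInv_of_integrable h1).locallyIntegrable fun g hg hgs => ?_
  have hgs' : HasCompactSupport (fun x => (g x : ℂ)) := hgs.comp_left Complex.ofReal_zero
  let G : 𝓢(E, ℂ) := hgs'.toSchwartzMap (Complex.ofRealCLM.contDiff.comp hg)
  have hG : ∀ x, G x = (g x : ℂ) := fun x => rfl
  have key := DFunLike.congr_fun (Lp.fourierInv_toTemperedDistribution_eq (h2.toLp φ)) G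
  rw [TemperedDistribution.fourierInv_apply, Lp.toTemperedDistribution_apply,
    Lp.toTemperedDistribution_apply] at key
  have e1 : ∫ x, g x • (𝓕⁻ (h2.toLp φ) : Lp ℂ 2 (volume : Measure E)) x =
      ∫ x, G x • (𝓕⁻ (h2.toLp φ) : Lp ℂ 2 (volume : Measure E)) x := by
    simp [hG]
  have e2 : ∫ x, g x • 𝓕⁻ φ x = ∫ x, G x • 𝓕⁻ φ x := by simp [hG]
  rw [e1, e2, ← key]
  have e3 : ∫ x, 𝓕⁻ G x • (h2.toLp φ) x = ∫ x, 𝓕⁻ G x • φ x := by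
    refine integral_congr_ae ?_
    filter_upwards [h2.coeFn_toLp] with x hx
    rw [hx]
  rw [e3, SchwartzMap.fourierInv_coe]
  have := VectorFourier.integral_fourierIntegral_smul_eq_flip (L := -innerₗ E)
    (μ := volume) (ν := volume) Real.continuous_fourierChar
    (by simpa using! continuous_inner.neg) G.integrable h1
  have hf : (-innerₗ E).flip = -innerₗ E := by
    ext x y; simp [real_inner_comm]
  rw [hf] at this
  exact this

theorem lintegral_comp_smul (f : E → ℝ≥0∞) {a : ℝ} (ha : a ≠ 0) :
    ∫⁻ x, f (a • x) = ENNReal.ofReal |(a ^ Module.finrank ℝ E)⁻¹| * ∫⁻ x, f x := by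
  have := lintegral_map_equiv (μ := (volume : Measure E)) f
    (Homeomorph.smulOfNeZero a ha).toMeasurableEquiv
  have hm : Measure.map (Homeomorph.smulOfNeZero a ha).toMeasurableEquiv (volume : Measure E) =
      ENNReal.ofReal |(a ^ Module.finrank ℝ E)⁻¹| • volume :=
    Measure.map_addHaar_smul volume ha
  rw [hm, lintegral_smul_measure] at this
  exact this.symm

variable (E) in
/-- The `L²`-normalized dilation constant. -/
def dilConst (a : ℝ) : ℝ := a ^ ((Module.finrank ℝ E : ℝ) / 2)

theorem quasiMeasurePreserving_smul {a : ℝ} (ha : a ≠ 0) :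
    Measure.QuasiMeasurePreserving (fun x : E => a • x) volume volume := by
  refine ⟨measurable_const_smul a, ?_⟩
  rw [Measure.map_addHaar_smul volume ha]
  exact Measure.smul_absolutelyContinuous

/-- The square of `dilConst E a` is `a ^ dim E`, which cancels the Jacobian of the dilation. -/
theorem eLpNorm_dil {a : ℝ} (ha : 0 < a) (f : E → ℂ) :
    eLpNorm (fun x => (dilConst E a : ℂ) * f (a • x)) 2 volume = eLpNorm f 2 volume := by
  have h : eLpNorm (fun x => (dilConst E a : ℂ) * f (a • x)) 2 volume ^ 2 =
      eLpNorm f 2 volume ^ 2 := by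
    rw [lintegral_enorm_sq_eq, lintegral_enorm_sq_eq]
    simp only [enorm_mul, mul_pow]
    rw [lintegral_const_mul' _ _ (by simp), lintegral_comp_smul (fun x => ‖f x‖ₑ ^ 2) ha.ne',
      ← mul_assoc]
    have : ‖(dilConst E a : ℂ)‖ₑ ^ 2 * ENNReal.ofReal |(a ^ Module.finrank ℝ E)⁻¹| = 1 := by
      have hd : dilConst E a ^ 2 = a ^ Module.finrank ℝ E := by
        rw [dilConst, ← Real.rpow_natCast, ← Real.rpow_mul ha.le]
        rw [← Real.rpow_natCast]; congr 1; push_cast; ring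
      rw [← ofReal_norm, ← ENNReal.ofReal_pow (norm_nonneg _), ← ENNReal.ofReal_mul (by positivity)]
      rw [Complex.norm_real, Real.norm_eq_abs, sq_abs, hd, abs_of_pos (by positivity),
        mul_inv_cancel₀ (by positivity), ENNReal.ofReal_one]
    rw [this, one_mul]
  exact (ENNReal.pow_right_strictMono two_ne_zero).injective h

theorem memLp_dil {a : ℝ} (ha : 0 < a) {f : E → ℂ} (hf : MemLp f 2) :
    MemLp (fun x => (dilConst E a : ℂ) * f (a • x)) 2 := by
  refine ⟨(hf.1.comp_quasiMeasurePreserving (quasiMeasurePreserving_smul ha.ne')).const_mul _, ?_⟩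
  rw [eLpNorm_dil ha]
  exact hf.2

/-- Dilation as an isometry of `L²`. -/
def dilIsometry {a : ℝ} (ha : 0 < a) :
    Lp ℂ 2 (volume : Measure E) →ₗᵢ[ℂ] Lp ℂ 2 (volume : Measure E) where
  toFun f := (memLp_dil ha (Lp.memLp f)).toLp _
  map_add' f g := by
    rw [← MemLp.toLp_add, MemLp.toLp_eq_toLp_iff]
    filter_upwards [(quasiMeasurePreserving_smul ha.ne').ae_eq_comp (Lp.coeFn_add f g)] with x hx
    simp only [Function.comp_apply, Pi.add_apply] at hx ⊢
    rw [hx, mul_add]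
  map_smul' c f := by
    rw [RingHom.id_apply, ← MemLp.toLp_const_smul, MemLp.toLp_eq_toLp_iff]
    filter_upwards [(quasiMeasurePreserving_smul ha.ne').ae_eq_comp (Lp.coeFn_smul c f)] with x hx
    simp only [Function.comp_apply, Pi.smul_apply, smul_eq_mul] at hx ⊢
    rw [hx, mul_left_comm]
  norm_map' f := by
    change ‖(memLp_dil ha (Lp.memLp f)).toLp _‖ = _
    rw [Lp.norm_toLp, eLpNorm_dil ha]
    rfl

theorem dilIsometry_coeFn {a : ℝ} (ha : 0 < a) (f : Lp ℂ 2 (volume : Measure E)) :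
    dilIsometry ha f =ᵐ[volume] fun x => (dilConst E a : ℂ) * f (a • x) :=
  MemLp.coeFn_toLp (memLp_dil ha (Lp.memLp f))

theorem dilConst_inv_mul {a : ℝ} (ha : 0 < a) : dilConst E a⁻¹ * dilConst E a = 1 := by
  rw [dilConst, dilConst, ← Real.mul_rpow (by positivity) ha.le, inv_mul_cancel₀ ha.ne',
    Real.one_rpow]

theorem dilIsometry_comp {a b : ℝ} (ha : 0 < a) (hb : 0 < b) (hab : a * b = 1)
    (f : Lp ℂ 2 (volume : Measure E)) : dilIsometry ha (dilIsometry hb f) = f := by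
  refine Lp.ext ?_
  filter_upwards [dilIsometry_coeFn ha (dilIsometry hb f),
    (quasiMeasurePreserving_smul ha.ne').ae_eq_comp (dilIsometry_coeFn hb f)] with x h1 h2
  simp only [Function.comp_apply] at h2
  have hb' : b = a⁻¹ := by field_simp; linarith
  have := dilConst_inv_mul (E := E) ha
  rw [← hb'] at this
  rw [h1, h2, smul_smul, mul_comm b a, hab, one_smul, ← mul_assoc]
  rw [← Complex.ofReal_mul, mul_comm (dilConst E a), this, Complex.ofReal_one, one_mul]

/-- Dilation as a unitary operator of `L²`. -/
def dilEquiv {a : ℝ} (ha : 0 < a) :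
    Lp ℂ 2 (volume : Measure E) ≃ₗᵢ[ℂ] Lp ℂ 2 (volume : Measure E) where
  toLinearEquiv := LinearEquiv.ofLinearMap (dilIsometry ha).toLinearMap
    (dilIsometry (inv_pos.2 ha)).toLinearMap
    (LinearMap.ext fun f => dilIsometry_comp ha (inv_pos.2 ha) (mul_inv_cancel₀ ha.ne') f)
    (LinearMap.ext fun f => dilIsometry_comp (inv_pos.2 ha) ha (inv_mul_cancel₀ ha.ne') f)
  norm_map' f := (dilIsometry ha).norm_map f

variable (E) in
/-- The unitary Fourier transform with kernel `e^(-i⟨X, ξ⟩)`. -/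
def unitaryFourier : Lp ℂ 2 (volume : Measure E) ≃ₗᵢ[ℂ] Lp ℂ 2 (volume : Measure E) :=
  (Lp.fourierTransformₗᵢ E ℂ).trans (dilEquiv (inv_pos.2 Real.two_pi_pos))

/-- The dilation by `(2π)⁻¹` removes `2π` from the exponent `-2πi⟨X, ξ⟩`, and its normalising factor
is the constant in front. -/
theorem unitaryFourier_coeFn {φ : E → ℂ} (h1 : Integrable φ) (h2 : MemLp φ 2) :
    unitaryFourier E (h2.toLp φ) =ᵐ[volume] fun X =>
      ((1 / (2 * Real.pi) ^ ((Module.finrank ℝ E : ℝ) / 2) : ℝ) : ℂ) *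
        ∫ ξ, Complex.exp (-Complex.I * (inner ℝ X ξ : ℝ)) * φ ξ := by
  have hpi := Real.two_pi_pos
  filter_upwards [dilIsometry_coeFn (inv_pos.2 hpi) (𝓕 (h2.toLp φ) : Lp ℂ 2 (volume : Measure E)),
    (quasiMeasurePreserving_smul (inv_pos.2 hpi).ne').ae_eq_comp (coeFn_fourier_toLp h1 h2)]
    with X hX1 hX2
  simp only [Function.comp_apply] at hX2
  have e : unitaryFourier E (h2.toLp φ) = dilIsometry (inv_pos.2 hpi)
    (𝓕 (h2.toLp φ) : Lp ℂ 2 (volume : Measure E)) := rfl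
  rw [e, hX1, hX2, dilConst, Real.inv_rpow hpi.le, one_div, Real.fourier_eq']
  congr 1
  refine integral_congr_ae (ae_of_all _ fun ξ => ?_)
  simp only [smul_eq_mul]
  congr 2
  rw [inner_smul_right, real_inner_comm]
  have : (Real.pi : ℂ) ≠ 0 := by exact_mod_cast Real.pi_ne_zero
  push_cast
  field_simp

theorem unitaryFourier_symm_coeFn {φ : E → ℂ} (h1 : Integrable φ) (h2 : MemLp φ 2) :
    (unitaryFourier E).symm (h2.toLp φ) =ᵐ[volume] fun X =>
      ((1 / (2 * Real.pi) ^ ((Module.finrank ℝ E : ℝ) / 2) : ℝ) : ℂ) *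
        ∫ ξ, Complex.exp (Complex.I * (inner ℝ X ξ : ℝ)) * φ ξ := by
  have hpi := Real.two_pi_pos
  have hpi' := inv_pos.2 (inv_pos.2 hpi)
  have h2' := memLp_dil hpi' h2
  have h1' : Integrable fun x : E => (dilConst E (2 * Real.pi)⁻¹⁻¹ : ℂ) *
      φ ((2 * Real.pi)⁻¹⁻¹ • x) := (h1.comp_smul hpi'.ne').const_mul _
  have e : (unitaryFourier E).symm (h2.toLp φ) =
      (𝓕⁻ (h2'.toLp _) : Lp ℂ 2 (volume : Measure E)) := by
    have e1 : (unitaryFourier E).symm (h2.toLp φ) =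
      (𝓕⁻ (dilIsometry hpi' (h2.toLp φ)) : Lp ℂ 2 (volume : Measure E)) := rfl
    rw [e1]
    congr 1
    refine Lp.ext ((dilIsometry_coeFn hpi' _).trans (EventuallyEq.trans ?_ h2'.coeFn_toLp.symm))
    filter_upwards [(quasiMeasurePreserving_smul hpi'.ne').ae_eq_comp h2.coeFn_toLp] with x hx
    simp only [Function.comp_apply] at hx
    rw [hx]
  rw [e]
  filter_upwards [coeFn_fourierInv_toLp h1' h2'] with X hX
  rw [hX, Real.fourierInv_eq']
  simp only [inv_inv]
  -- The substitution `ξ = 2πv` contributes `(2π)^(-dim)`; with the dilation constant `(2π)^(dim/2)`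
  -- this leaves `(2π)^(-dim/2)`.
  have hs := Measure.integral_comp_smul (volume : Measure E)
    (fun ξ => Complex.exp (Complex.I * (inner ℝ X ξ : ℝ)) * φ ξ) (2 * Real.pi)
  have hr : ∀ v : E, Complex.exp (((2 * Real.pi * inner ℝ v X : ℝ) : ℂ) * Complex.I) •
      ((dilConst E (2 * Real.pi) : ℂ) * φ ((2 * Real.pi) • v)) =
      (dilConst E (2 * Real.pi) : ℂ) * (Complex.exp (Complex.I *
        (inner ℝ X ((2 * Real.pi) • v) : ℝ)) * φ ((2 * Real.pi) • v)) := by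
    intro v
    rw [inner_smul_right, real_inner_comm, smul_eq_mul, mul_comm Complex.I]
    ring
  simp only [hr]
  rw [integral_const_mul, hs, Complex.real_smul, ← mul_assoc]
  congr 1
  rw [← Complex.ofReal_mul, dilConst, abs_of_pos (by positivity)]
  congr 1
  have hsq : (2 * Real.pi) ^ Module.finrank ℝ E =
      (2 * Real.pi) ^ ((Module.finrank ℝ E : ℝ) / 2) *
      (2 * Real.pi) ^ ((Module.finrank ℝ E : ℝ) / 2) := by
    rw [← Real.rpow_add hpi, add_halves, Real.rpow_natCast]
  rw [hsq]
  have : (2 * Real.pi) ^ ((Module.finrank ℝ E : ℝ) / 2) ≠ 0 := by positivity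
  field_simp

end Fourier

end

section

/-! ### Coordinates on symmetric matrices, the cone, and the product form of the measures. -/

namespace SymMat

variable {n : ℕ} {𝕜 : Type} [RCLike 𝕜]

@[ext] theorem ext_toMatrix {X Y : SymMat n 𝕜} (h : X.toMatrix = Y.toMatrix) : X = Y :=
  Subtype.ext (PiLp.ext fun p => congrFun (congrFun h p.1) p.2)

@[simp] theorem toMatrix_ofMatrix (A : Matrix (Fin n) (Fin n) 𝕜) (hA : A.IsSymm) :
    (ofMatrix A hA).toMatrix = A := rfl

@[simp] theorem toMatrix_add (X Y : SymMat n 𝕜) :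
    (X + Y).toMatrix = X.toMatrix + Y.toMatrix := rfl

@[simp] theorem toMatrix_zero : (0 : SymMat n 𝕜).toMatrix = 0 := rfl

@[simp] theorem toMatrix_smul (c : 𝕜) (X : SymMat n 𝕜) : (c • X).toMatrix = c • X.toMatrix := rfl

@[fun_prop] theorem continuous_toMatrix : Continuous (toMatrix : SymMat n 𝕜 → _) := by
  refine continuous_pi fun i => continuous_pi fun j => ?_
  exact (PiLp.continuous_apply 2 _ (i, j)).comp continuous_subtype_val

theorem continuous_of_toMatrix {α : Type*} [TopologicalSpace α] {f : α → SymMat n 𝕜}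
    (h : Continuous fun a => (f a).toMatrix) : Continuous f := by
  refine continuous_induced_rng.2 ?_
  refine (PiLp.continuous_toLp 2 fun _ : Fin n × Fin n => 𝕜).comp (continuous_pi fun p => ?_)
  exact (continuous_apply p.2).comp ((continuous_apply p.1).comp h)

theorem trMul_eq_inner (X Y : SymMat n ℝ) : X.trMul Y = inner ℝ X Y := (inner_eq_trace X Y).symm

@[fun_prop] theorem continuous_det : Continuous (det : SymMat n ℝ → ℝ) :=
  continuous_toMatrix.matrix_det

@[fun_prop] theorem continuous_re : Continuous (re : SymMat n ℂ → _) :=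
  continuous_of_toMatrix (continuous_toMatrix.matrix_map Complex.continuous_re)

@[fun_prop] theorem continuous_im : Continuous (im : SymMat n ℂ → _) :=
  continuous_of_toMatrix (continuous_toMatrix.matrix_map Complex.continuous_im)

theorem toMatrix_ofReIm (X Y : SymMat n ℝ) (i j : Fin n) : (ofReIm X Y).toMatrix i j =
    (X.toMatrix i j : ℂ) + Complex.I * (Y.toMatrix i j : ℂ) := rfl

@[simp] theorem re_ofReIm (X Y : SymMat n ℝ) : (ofReIm X Y).re = X := by
  ext i j; simp [re, toMatrix_ofReIm]

@[simp] theorem im_ofReIm (X Y : SymMat n ℝ) : (ofReIm X Y).im = Y := by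
  ext i j; simp [im, toMatrix_ofReIm]

@[simp] theorem ofReIm_re_im (Z : SymMat n ℂ) : ofReIm Z.re Z.im = Z := by
  ext i j
  rw [toMatrix_ofReIm, mul_comm]
  exact Complex.re_add_im _

theorem ofReIm_add (X X' Y Y' : SymMat n ℝ) :
    ofReIm X Y + ofReIm X' Y' = ofReIm (X + X') (Y + Y') := by
  ext i j
  simp only [toMatrix_ofReIm, toMatrix_add, Matrix.add_apply, Complex.ofReal_add]
  ring

theorem continuous_ofReIm : Continuous fun p : SymMat n ℝ × SymMat n ℝ => ofReIm p.1 p.2 := by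
  refine continuous_of_toMatrix (continuous_pi fun i => continuous_pi fun j => ?_)
  simp only [toMatrix_ofReIm]
  have h1 : Continuous fun p : SymMat n ℝ × SymMat n ℝ => p.1.toMatrix i j :=
    (continuous_toMatrix.comp continuous_fst).matrix_elem i j
  have h2 : Continuous fun p : SymMat n ℝ × SymMat n ℝ => p.2.toMatrix i j :=
    (continuous_toMatrix.comp continuous_snd).matrix_elem i j
  fun_prop

variable (n) in
/-- The coordinates `Z = X + i Y`. -/
def reImHomeomorph : SymMat n ℝ × SymMat n ℝ ≃ₜ SymMat n ℂ where
  toFun p := ofReIm p.1 p.2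
  invFun Z := (Z.re, Z.im)
  left_inv p := by simp
  right_inv Z := by simp
  continuous_toFun := continuous_ofReIm
  continuous_invFun := continuous_re.prodMk continuous_im

theorem measurable_im : Measurable (im : SymMat n ℂ → SymMat n ℝ) := continuous_im.measurable

theorem im_add_ofReIm_zero (Z : SymMat n ℂ) (S : SymMat n ℝ) : (Z + ofReIm S 0).im = Z.im := by
  conv_lhs => rw [← ofReIm_re_im Z, ofReIm_add, im_ofReIm, add_zero]

end SymMat

open SymMat

variable {n : ℕ}

theorem mem_posCone_iff {X : SymMat n ℝ} :
    X ∈ posCone n ↔ ∀ x : Fin n → ℝ, x ≠ 0 → 0 < x ⬝ᵥ (X.toMatrix.mulVec x) := by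
  have hH : X.toMatrix.IsHermitian := by
    rw [Matrix.IsHermitian, Matrix.conjTranspose_eq_transpose_of_trivial]
    exact X.isSymm_toMatrix
  constructor
  · intro h x hx
    simpa using Matrix.PosDef.dotProduct_mulVec_pos (show X.toMatrix.PosDef from h) hx
  · intro h
    exact Matrix.PosDef.of_dotProduct_mulVec_pos hH fun x hx => by simpa using h x hx

theorem det_pos_of_mem {X : SymMat n ℝ} (hX : X ∈ posCone n) : 0 < X.det :=
  Matrix.PosDef.det_pos hX

theorem add_mem_posCone {X Y : SymMat n ℝ} (hX : X ∈ posCone n) (hY : Y ∈ posCone n) :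
    X + Y ∈ posCone n :=
  Matrix.PosDef.add hX hY

theorem smul_mem_posCone {X : SymMat n ℝ} {c : ℝ} (hc : 0 < c) (hX : X ∈ posCone n) :
    c • X ∈ posCone n :=
  Matrix.PosDef.smul hX hc

theorem convex_posCone : Convex ℝ (posCone n) := by
  rw [convex_iff_forall_pos]
  intro X hX Y hY a b ha hb _
  exact add_mem_posCone (smul_mem_posCone ha hX) (smul_mem_posCone hb hY)

/-- The identity matrix. -/
def symOne (n : ℕ) : SymMat n ℝ := ofMatrix 1 Matrix.isSymm_one

theorem symOne_mem : symOne n ∈ posCone n := Matrix.PosDef.one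

/-- Positivity of a quadratic form need only be tested on a unit sphere; compactness makes it stable
under small perturbations. -/
theorem isOpen_posCone : IsOpen (posCone n) := by
  rw [isOpen_iff_eventually]
  intro X hX
  have hc : Continuous fun p : SymMat n ℝ × (Fin n → ℝ) => p.2 ⬝ᵥ (p.1.toMatrix.mulVec p.2) :=
    continuous_snd.dotProduct ((continuous_toMatrix.comp continuous_fst).matrix_mulVec
      continuous_snd)
  have key : ∀ᶠ Y in 𝓝 X, ∀ x ∈ Metric.sphere (0 : Fin n → ℝ) 1,
      0 < x ⬝ᵥ (Y.toMatrix.mulVec x) := by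
    refine (isCompact_sphere _ _).eventually_forall_of_forall_eventually fun x hx => ?_
    refine (isOpen_lt continuous_const hc).mem_nhds ?_
    refine mem_posCone_iff.1 hX x ?_
    rintro rfl
    simp at hx
  filter_upwards [key] with Y hY
  refine mem_posCone_iff.2 fun x hx => ?_
  have hn : 0 < ‖x‖ := norm_pos_iff.2 hx
  have := hY (‖x‖⁻¹ • x) (by simp [norm_smul, hn.ne'])
  rw [Matrix.mulVec_smul, dotProduct_smul, smul_dotProduct] at this
  simp only [smul_eq_mul] at this
  have h2 : 0 < ‖x‖⁻¹ := inv_pos.2 hn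
  exact pos_of_mul_pos_right (pos_of_mul_pos_right this h2.le) h2.le

theorem measurableSet_posCone : MeasurableSet (posCone n) := isOpen_posCone.measurableSet

/-- With `X` a sum of rank one matrices `v vᵀ`, the trace is a sum of values `vᵀ Y v`. -/
theorem inner_nonneg_of_posSemidef {X Y : SymMat n ℝ} (hX : X.toMatrix.PosSemidef)
    (hY : Y.toMatrix.PosSemidef) : 0 ≤ inner ℝ X Y := by
  rw [inner_eq_trace]
  obtain ⟨m, v, hv⟩ := Matrix.posSemidef_iff_eq_sum_vecMulVec.1 hX
  rw [hv, Finset.sum_mul, Matrix.trace_sum]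
  refine Finset.sum_nonneg fun i _ => ?_
  rw [Matrix.vecMulVec_mul, Matrix.trace_vecMulVec, dotProduct_comm, ← Matrix.dotProduct_mulVec]
  exact hY.dotProduct_mulVec_nonneg (v i)

theorem isOpen_siegelDomain : IsOpen (siegelDomain n) := isOpen_posCone.preimage continuous_im

theorem siegelVolume_eq_map : siegelVolume n =
    ((volume : Measure (SymMat n ℝ)).prod (coneVolume n)).map (reImHomeomorph n) := by
  have h1 : (volume : Measure (SymMat n ℝ)).prod (coneVolume n) =
      ((volume : Measure (SymMat n ℝ)).prod volume).restrict
        ((reImHomeomorph n) ⁻¹' (siegelDomain n)) := by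
    have : (reImHomeomorph n) ⁻¹' (siegelDomain n) = univ ×ˢ posCone n := by
      ext p
      simp [reImHomeomorph, siegelDomain]
    rw [this, ← Measure.prod_restrict, Measure.restrict_univ]
    rfl
  rw [h1, ← Measure.restrict_map (reImHomeomorph n).measurable isOpen_siegelDomain.measurableSet]
  rfl

theorem measurable_detWeight (lam : ℝ) : Measurable (detWeight n lam) :=
  (continuous_det.comp (continuous_const_smul (2 : ℝ))).measurable.pow_const _

instance : SFinite (coneVolume n) := inferInstanceAs (SFinite (volume.restrict _))
instance : SigmaFinite (coneVolume n) := inferInstanceAs (SigmaFinite (volume.restrict _))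

instance (lam : ℝ) : SigmaFinite (coneWeighted n lam) :=
  SigmaFinite.withDensity_ofReal _

/-- The density depends on `Im Z` only, so it can be moved onto the second factor of the product. -/
theorem measurePreserving_reImHomeomorph (lam : ℝ) : MeasurePreserving (reImHomeomorph n)
    ((volume : Measure (SymMat n ℝ)).prod (coneWeighted n lam)) (siegelWeighted n lam) := by
  refine ⟨(reImHomeomorph n).measurable, ?_⟩
  have hm : Measurable fun Y : SymMat n ℝ =>
      ENNReal.ofReal (weightConst n lam * detWeight n lam Y) :=
    ((measurable_detWeight lam).const_mul _).ennreal_ofReal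
  rw [coneWeighted, prod_withDensity_right hm, siegelWeighted, siegelVolume_eq_map]
  ext s hs
  rw [Measure.map_apply (reImHomeomorph n).measurable hs,
    withDensity_apply _ ((reImHomeomorph n).measurable hs), withDensity_apply _ hs,
    setLIntegral_map (f := fun Z : SymMat n ℂ => ENNReal.ofReal (weightConst n lam *
      detWeight n lam Z.im)) hs (hm.comp measurable_im) (reImHomeomorph n).measurable]
  refine lintegral_congr fun p => ?_
  simp [reImHomeomorph]

end

section

/-! ### The Siegel gamma integral for diagonal matrices, by splitting off the first row. -/

open SymMat

variable {n : ℕ}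

/-- The symmetric matrix with first row `(a, b / √2)` and lower right block `D`. -/
def bordered (a : ℝ) (b : Fin n → ℝ) (D : SymMat n ℝ) : SymMat (n + 1) ℝ :=
  ofMatrix (fun i j => Fin.cases (Fin.cases a (fun j => b j / √2) j)
    (fun i => Fin.cases (b i / √2) (fun j => D.toMatrix i j) j) i)
    (Matrix.IsSymm.ext fun i j => by
      refine Fin.cases ?_ (fun i => ?_) i <;> refine Fin.cases ?_ (fun j => ?_) j <;> simp
      exact D.isSymm_toMatrix.apply _ _)

section bordered
variable (a : ℝ) (b : Fin n → ℝ) (D : SymMat n ℝ)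

@[simp] theorem bordered_zero_zero : (bordered a b D).toMatrix 0 0 = a := rfl
@[simp] theorem bordered_zero_succ (j : Fin n) :
    (bordered a b D).toMatrix 0 j.succ = b j / √2 := rfl
@[simp] theorem bordered_succ_zero (j : Fin n) :
    (bordered a b D).toMatrix j.succ 0 = b j / √2 := rfl
@[simp] theorem bordered_succ_succ (i j : Fin n) :
    (bordered a b D).toMatrix i.succ j.succ = D.toMatrix i j := rfl

theorem norm_sq_eq_sum (X : SymMat n ℝ) : ‖X‖ ^ 2 = ∑ i, ∑ j, X.toMatrix i j ^ 2 := by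
  rw [← real_inner_self_eq_norm_sq, inner_eq_trace, Matrix.trace]
  simp only [Matrix.diag, Matrix.mul_apply]
  refine Finset.sum_congr rfl fun i _ => Finset.sum_congr rfl fun j _ => ?_
  rw [X.isSymm_toMatrix.apply i j, sq]

/-- Off-diagonal entries count twice in the trace norm, and the factor `1/√2` compensates. The
coordinates `(a, b, D)` are therefore isometric and preserve Lebesgue measure without a Jacobian
factor. -/
theorem norm_sq_bordered : ‖bordered a b D‖ ^ 2 = a ^ 2 + (∑ i, b i ^ 2 + ‖D‖ ^ 2) := by
  rw [norm_sq_eq_sum, norm_sq_eq_sum, Fin.sum_univ_succ]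
  simp only [Fin.sum_univ_succ, bordered_zero_zero, bordered_zero_succ, bordered_succ_zero,
    bordered_succ_succ, Finset.sum_add_distrib, div_pow, Real.sq_sqrt zero_le_two]
  rw [← Finset.sum_div]
  ring

end bordered

variable (n) in
/-- `bordered` as a linear isometry equivalence. -/
def borderedEquiv : WithLp 2 (ℝ × WithLp 2 (EuclideanSpace ℝ (Fin n) × SymMat n ℝ)) ≃ₗᵢ[ℝ]
    SymMat (n + 1) ℝ where
  toFun q := bordered q.fst q.snd.fst q.snd.snd
  map_add' q q' := by
    ext i j
    refine Fin.cases ?_ (fun i => ?_) i <;> refine Fin.cases ?_ (fun j => ?_) j <;>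
      simp [add_div]
  map_smul' c q := by
    ext i j
    refine Fin.cases ?_ (fun i => ?_) i <;> refine Fin.cases ?_ (fun j => ?_) j <;>
      simp [mul_div_assoc]
  invFun X := WithLp.toLp 2 (X.toMatrix 0 0, WithLp.toLp 2
    (WithLp.toLp 2 fun i => √2 * X.toMatrix 0 i.succ,
      ofMatrix (fun i j => X.toMatrix i.succ j.succ)
        (Matrix.IsSymm.ext fun i j => X.isSymm_toMatrix.apply _ _)))
  left_inv q := by
    have h2 : √(2 : ℝ) ≠ 0 := by positivity
    refine (WithLp.ofLp_injective 2) (Prod.ext rfl ((WithLp.ofLp_injective 2) (Prod.ext ?_ rfl)))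
    ext i
    simp [mul_div_cancel₀]
    try field_simp
  right_inv X := by
    have h2 : √(2 : ℝ) ≠ 0 := by positivity
    ext i j
    refine Fin.cases ?_ (fun i => ?_) i <;> refine Fin.cases ?_ (fun j => ?_) j
    · rfl
    · simp
    · simp; exact X.isSymm_toMatrix.apply _ _
    · rfl
  norm_map' q := by
    have h1 : ‖bordered q.fst q.snd.fst q.snd.snd‖ ^ 2 = ‖q‖ ^ 2 := by
      rw [norm_sq_bordered, WithLp.prod_norm_sq_eq_of_L2, WithLp.prod_norm_sq_eq_of_L2,
        EuclideanSpace.norm_sq_eq]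
      simp
    exact (pow_left_inj₀ (norm_nonneg _) (norm_nonneg _) two_ne_zero).1 h1

theorem measurePreserving_bordered :
    MeasurePreserving (fun q : ℝ × ((Fin n → ℝ) × SymMat n ℝ) => bordered q.1 q.2.1 q.2.2)
      (volume.prod (volume.prod volume)) volume := by
  have h1 : MeasurePreserving (fun q : (Fin n → ℝ) × SymMat n ℝ =>
      (WithLp.toLp 2 (WithLp.toLp 2 q.1, q.2) : WithLp 2 (EuclideanSpace ℝ (Fin n) × SymMat n ℝ)))
      (volume.prod volume) volume :=
    (WithLp.volume_preserving_toLp _ _).comp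
      ((PiLp.volume_preserving_toLp (Fin n)).prod (MeasurePreserving.id volume))
  exact (borderedEquiv n).measurePreserving.comp ((WithLp.volume_preserving_toLp _ _).comp
      ((MeasurePreserving.id volume).prod h1))

instance : Subsingleton (SymMat 0 ℝ) :=
  ⟨fun _ _ => ext_toMatrix (Subsingleton.elim _ _)⟩

theorem finrank_symMat (n : ℕ) : (Module.finrank ℝ (SymMat n ℝ) : ℝ) = n * (n + 1) / 2 := by
  induction n with
  | zero => simp [Module.finrank_zero_of_subsingleton]
  | succ n ih =>
    have h := (borderedEquiv n).toLinearEquiv.finrank_eq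
    have h1 := (WithLp.linearEquiv 2 ℝ (ℝ × WithLp 2
      (EuclideanSpace ℝ (Fin n) × SymMat n ℝ))).finrank_eq
    have h2 := (WithLp.linearEquiv 2 ℝ (EuclideanSpace ℝ (Fin n) × SymMat n ℝ)).finrank_eq
    rw [Module.finrank_prod] at h1 h2
    rw [← h, h1, h2, finrank_euclideanSpace]
    push_cast
    rw [ih]
    simp
    ring

/-- The rank one matrix `b bᵀ`. -/
def rankOne (b : Fin n → ℝ) : SymMat n ℝ :=
  ofMatrix (Matrix.vecMulVec b b) (Matrix.IsSymm.ext fun i j => by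
    simp [Matrix.vecMulVec_apply, mul_comm])

@[simp] theorem rankOne_toMatrix_apply (b : Fin n → ℝ) (i j : Fin n) :
    (rankOne b).toMatrix i j = b i * b j := rfl

theorem dotProduct_rankOne (b x : Fin n → ℝ) :
    x ⬝ᵥ ((rankOne b).toMatrix.mulVec x) = (b ⬝ᵥ x) ^ 2 := by
  have : (rankOne b).toMatrix = Matrix.vecMulVec b b := rfl
  rw [this, Matrix.vecMulVec_mulVec]
  simp [dotProduct_comm x b, sq]

theorem quadForm_bordered (a : ℝ) (b : Fin n → ℝ) (D : SymMat n ℝ) (t : ℝ) (y : Fin n → ℝ) :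
    (Fin.cons t y : Fin (n + 1) → ℝ) ⬝ᵥ ((bordered a b D).toMatrix.mulVec (Fin.cons t y)) =
      a * t ^ 2 + 2 * t * (b ⬝ᵥ y) / √2 + y ⬝ᵥ (D.toMatrix.mulVec y) := by
  simp only [dotProduct, Matrix.mulVec, Fin.sum_univ_succ, Fin.cons_zero, Fin.cons_succ,
    bordered_zero_zero, bordered_zero_succ, bordered_succ_zero, bordered_succ_succ, mul_add,
    Finset.sum_add_distrib]
  have h1 : ∑ x, y x * (b x / √2 * t) = t * (∑ i, b i * y i) / √2 := by
    rw [Finset.mul_sum, Finset.sum_div]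
    exact Finset.sum_congr rfl fun i _ => by ring
  have h2 : t * ∑ x, b x / √2 * y x = t * (∑ i, b i * y i) / √2 := by
    rw [Finset.mul_sum, Finset.mul_sum, Finset.sum_div]
    exact Finset.sum_congr rfl fun i _ => by ring
  rw [h1, h2]
  ring

/-- Completing the square in the first variable: `D` is the Schur complement of the corner `a`. The
2 in `(2 * a)⁻¹` is the square of the `√2` in `bordered`. -/
theorem bordered_mem_posCone_iff {a : ℝ} {b : Fin n → ℝ} {D : SymMat n ℝ} :
    bordered a b ((2 * a)⁻¹ • rankOne b + D) ∈ posCone (n + 1) ↔ 0 < a ∧ D ∈ posCone n := by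
  have hq : ∀ t y, a ≠ 0 → (Fin.cons t y : Fin (n + 1) → ℝ) ⬝ᵥ
      ((bordered a b ((2 * a)⁻¹ • rankOne b + D)).toMatrix.mulVec (Fin.cons t y)) =
      a * (t + (b ⬝ᵥ y) / (√2 * a)) ^ 2 + y ⬝ᵥ (D.toMatrix.mulVec y) := by
    intro t y ha
    rw [quadForm_bordered, toMatrix_add, toMatrix_smul, Matrix.add_mulVec, dotProduct_add,
      Matrix.smul_mulVec, dotProduct_smul, dotProduct_rankOne]
    have h2 : √(2 : ℝ) ^ 2 = 2 := Real.sq_sqrt zero_le_two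
    have h2' : √(2 : ℝ) ≠ 0 := by positivity
    rw [smul_eq_mul]
    have : (b ⬝ᵥ y / (√2 * a)) ^ 2 = (b ⬝ᵥ y) ^ 2 / (2 * a ^ 2) := by
      rw [div_pow, mul_pow, h2]
    rw [add_sq, this]
    field_simp
    ring
  constructor
  · intro h
    have ha : 0 < a := by
      have := mem_posCone_iff.1 h (Fin.cons 1 0) (fun h0 => by simpa using congrFun h0 0)
      rw [quadForm_bordered] at this
      simpa using this
    refine ⟨ha, mem_posCone_iff.2 fun y hy => ?_⟩
    -- This first coordinate annihilates the completed square and leaves the form of `D` at `y`.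
    have := mem_posCone_iff.1 h (Fin.cons (-((b ⬝ᵥ y) / (√2 * a))) y) (fun h0 => hy (by
      ext i; simpa using congrFun h0 i.succ))
    rw [hq _ _ ha.ne'] at this
    simpa using this
  · rintro ⟨ha, hD⟩
    refine mem_posCone_iff.2 fun x hx => ?_
    rw [← Fin.cons_self_tail x, hq _ _ ha.ne']
    by_cases hy : Fin.tail x = 0
    · have h0 : x 0 ≠ 0 := fun h0 => hx (by
        rw [← Fin.cons_self_tail x, hy, h0]; ext i; refine Fin.cases ?_ (fun i => ?_) i <;> simp)
      rw [hy]
      simp only [dotProduct_zero, zero_div, add_zero, zero_dotProduct]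
      positivity
    · have := mem_posCone_iff.1 hD _ hy
      positivity

/-- Row operations: subtracting `b i / (√2 a)` times the first row from the row with index `i.succ`
clears the first column and leaves `D` in the lower block. -/
theorem det_bordered {a : ℝ} (ha : a ≠ 0) (b : Fin n → ℝ) (D : SymMat n ℝ) :
    (bordered a b ((2 * a)⁻¹ • rankOne b + D)).det = a * D.det := by
  let B : Matrix (Fin (n + 1)) (Fin (n + 1)) ℝ := fun i j =>
    Fin.cases ((bordered a b D).toMatrix 0 j)
      (fun i => Fin.cases 0 (fun j => D.toMatrix i j) j) i
  have hdet := Matrix.det_eq_of_forall_row_eq_smul_add_const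
    (A := (bordered a b ((2 * a)⁻¹ • rankOne b + D)).toMatrix) (B := B)
    (Fin.cases 0 fun i => b i / (√2 * a)) 0 rfl (by
      have h2 : √(2 : ℝ) ^ 2 = 2 := Real.sq_sqrt zero_le_two
      have h2' : √(2 : ℝ) ≠ 0 := by positivity
      intro i j
      refine Fin.cases ?_ (fun i => ?_) i <;> refine Fin.cases ?_ (fun j => ?_) j
      · simp [B]
      · simp [B]
      · simp [B]
        field_simp
      · simp [B]
        field_simp
        rw [h2]
        ring)
  rw [SymMat.det, hdet, Matrix.det_succ_column_zero, Fin.sum_univ_succ]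
  have h0 : ∀ i : Fin n, B i.succ 0 = 0 := fun i => rfl
  have h1 : B.submatrix (Fin.succAbove 0) Fin.succ = D.toMatrix := by
    ext i j
    rfl
  simp only [h0, h1, SymMat.det]
  simp [B]

/-- The Siegel integral over the cone with a diagonal matrix in the exponent. -/
theorem lintegral_posCone_diagonal (n : ℕ) (d : Fin n → ℝ) (hd : ∀ i, 0 < d i) (s : ℝ)
    (hs : ((n : ℝ) - 1) / 2 < s) :
    ∫⁻ X in posCone n, ENNReal.ofReal (Real.exp (-∑ i, d i * X.toMatrix i i) *
      X.det ^ (s - ((n : ℝ) + 1) / 2)) =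
    ENNReal.ofReal (coneGamma n s * ∏ i, d i ^ (-s)) := by
  induction n generalizing s with
  | zero =>
    have hu : posCone 0 = univ := by
      ext X; simp only [mem_univ, iff_true]
      exact mem_posCone_iff.2 fun x hx => absurd (Subsingleton.elim x 0) hx
    have hv : (volume : Measure (SymMat 0 ℝ)) univ = 1 := by
      let e : EuclideanSpace ℝ (Fin 0) ≃ₗᵢ[ℝ] SymMat 0 ℝ :=
        { toLinearEquiv := LinearEquiv.ofSubsingleton _ _, norm_map' := fun x => by
            rw [Subsingleton.elim x 0]; simp }
      rw [← e.measurePreserving.measure_preimage MeasurableSet.univ.nullMeasurableSet,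
        volume_euclideanSpace_eq_dirac]
      simp
    simp [hu, hv, coneGamma, SymMat.det]
  | succ n ih =>
    have hs0 : 0 < s := by
      have : (0 : ℝ) ≤ ((n + 1 : ℕ) - 1) / 2 := by push_cast; simp; positivity
      linarith
    set F : SymMat (n + 1) ℝ → ℝ≥0∞ := fun X => ENNReal.ofReal
      (Real.exp (-∑ i, d i * X.toMatrix i i) * X.det ^ (s - (((n + 1 : ℕ) : ℝ) + 1) / 2)) with hF
    have hFm : Measurable ((posCone (n + 1)).indicator F) := by
      refine Measurable.indicator ?_ measurableSet_posCone
      refine ((Continuous.measurable ?_).mul (continuous_det.measurable.pow_const _)).ennreal_ofReal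
      refine Real.continuous_exp.comp (continuous_finsetSum _ fun i _ => ?_).neg
      exact continuous_const.mul (continuous_toMatrix.matrix_elem i i)
    -- In Schur coordinates the integrand factors: the integral over `D` is the case `n` at `s -
    -- 1/2`, the one over `b` is Gaussian, and the one over `a` is a gamma integral. The shift is
    -- forced by `s - (n+2)/2 = (s - 1/2) - (n+1)/2` in the power of the determinant.
    have hinner : ∀ a b, ∫⁻ D, (posCone (n + 1)).indicator F (bordered a b D) =
        (Ioi (0 : ℝ)).indicator (fun a => ENNReal.ofReal (Real.exp (-(d 0 * a)) *
          a ^ (s - ((n : ℝ) + 2) / 2)) * ENNReal.ofReal (∏ i : Fin n, Real.exp (-(d i.succ / (2 * a)) * b i ^ 2)) *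
          ENNReal.ofReal (coneGamma n (s - 1 / 2) * ∏ i : Fin n, d i.succ ^ (-(s - 1 / 2)))) a := by
      intro a b
      rw [← ih (fun i => d i.succ) (fun i => hd _) (s - 1 / 2) (by push_cast at hs; linarith)]
      -- Translation invariance in `D` puts the lower block in Schur form.
      rw [← lintegral_add_left_eq_self _ ((2 * a)⁻¹ • rankOne b)]
      by_cases ha : 0 < a
      · rw [indicator_of_mem (mem_Ioi.2 ha), ← ENNReal.ofReal_mul (by positivity),
          ← lintegral_const_mul' _ _ ENNReal.ofReal_ne_top,
          ← lintegral_indicator measurableSet_posCone]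
        refine lintegral_congr fun D => ?_
        by_cases hD : D ∈ posCone n
        · rw [indicator_of_mem hD, indicator_of_mem (bordered_mem_posCone_iff.2 ⟨ha, hD⟩), hF]
          simp only
          rw [← ENNReal.ofReal_mul (by positivity), det_bordered ha.ne',
            Real.mul_rpow ha.le (det_pos_of_mem hD).le, ← Real.exp_sum]
          congr 1
          rw [Fin.sum_univ_succ]
          simp only [bordered_zero_zero, bordered_succ_succ, toMatrix_add, toMatrix_smul,
            Matrix.add_apply, Matrix.smul_apply, rankOne_toMatrix_apply, smul_eq_mul, mul_add,
            Finset.sum_add_distrib, neg_add, Real.exp_add]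
          have e1 : -∑ i : Fin n, d i.succ * ((2 * a)⁻¹ * (b i * b i)) =
              ∑ i, -(d i.succ / (2 * a)) * b i ^ 2 := by
            rw [← Finset.sum_neg_distrib]
            exact Finset.sum_congr rfl fun i _ => by field_simp
          have e2 : s - (((n + 1 : ℕ) : ℝ) + 1) / 2 = s - ((n : ℝ) + 2) / 2 := by
            push_cast; ring
          have e3 : s - 1 / 2 - ((n : ℝ) + 1) / 2 = s - ((n : ℝ) + 2) / 2 := by ring
          rw [e1, e2, e3]
          ring
        · rw [indicator_of_notMem hD, indicator_of_notMem
            (fun h => hD (bordered_mem_posCone_iff.1 h).2)]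
      · rw [indicator_of_notMem (by simpa using ha)]
        refine (lintegral_congr fun D => ?_).trans lintegral_zero
        exact indicator_of_notMem (fun h => ha (bordered_mem_posCone_iff.1 h).1) _
    have hgauss : ∀ a > 0, ∫⁻ b : Fin n → ℝ, ENNReal.ofReal
        (∏ i : Fin n, Real.exp (-(d i.succ / (2 * a)) * b i ^ 2)) =
        ENNReal.ofReal ((2 * Real.pi * a) ^ ((n : ℝ) / 2) * ∏ i : Fin n, d i.succ ^ (-(1 / 2 : ℝ))) := by
      intro a ha
      have hi : Integrable fun b : Fin n → ℝ =>
          ∏ i : Fin n, Real.exp (-(d i.succ / (2 * a)) * b i ^ 2) :=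
        Integrable.fintype_prod fun i =>
          integrable_exp_neg_mul_sq (div_pos (hd _) (by positivity))
      rw [← ofReal_integral_eq_lintegral_ofReal hi (ae_of_all _ fun b => by positivity),
        integral_fintype_prod_volume_eq_prod
          (f := fun i (x : ℝ) => Real.exp (-(d (Fin.succ i) / (2 * a)) * x ^ 2))]
      congr 1
      simp only [integral_gaussian]
      have : ∀ i : Fin n, √(Real.pi / (d i.succ / (2 * a))) =
          (2 * Real.pi * a) ^ (1 / 2 : ℝ) * d i.succ ^ (-(1 / 2 : ℝ)) := by
        intro i
        rw [Real.sqrt_eq_rpow, Real.rpow_neg (hd _).le, ← div_eq_mul_inv,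
          ← Real.div_rpow (by positivity) (hd _).le]
        congr 1
        have := (hd i.succ).ne'
        field_simp
      simp only [this, Finset.prod_mul_distrib, Finset.prod_const, Finset.card_univ,
        Fintype.card_fin]
      rw [← Real.rpow_natCast, ← Real.rpow_mul (by positivity)]
      congr 2
      ring
    have hgamma : ∫⁻ a in Ioi (0 : ℝ), ENNReal.ofReal (Real.exp (-(d 0 * a)) * a ^ (s - 1)) =
        ENNReal.ofReal (Real.Gamma s * d 0 ^ (-s)) := by
      have hi : IntegrableOn (fun a : ℝ => Real.exp (-(d 0 * a)) * a ^ (s - 1)) (Ioi 0) := by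
        have := integrableOn_rpow_mul_exp_neg_mul_rpow (p := 1) (s := s - 1) (b := d 0)
          (by linarith) one_pos (hd 0)
        refine this.congr_fun (fun a _ => ?_) measurableSet_Ioi
        simp only [Real.rpow_one]
        rw [mul_comm, neg_mul]
      rw [← ofReal_integral_eq_lintegral_ofReal hi]
      · congr 1
        have := Real.integral_rpow_mul_exp_neg_mul_Ioi hs0 (hd 0)
        rw [one_div, Real.inv_rpow (hd 0).le, ← Real.rpow_neg (hd 0).le] at this
        rw [mul_comm, ← this]
        exact integral_congr_ae (ae_of_all _ fun a => mul_comm _ _)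
      · filter_upwards [ae_restrict_mem measurableSet_Ioi] with a ha
        have := mem_Ioi.1 ha
        positivity
    have hFm' : Measurable fun q : ℝ × ((Fin n → ℝ) × SymMat n ℝ) =>
        (posCone (n + 1)).indicator F (bordered q.1 q.2.1 q.2.2) :=
      hFm.comp measurePreserving_bordered.measurable
    rw [← lintegral_indicator measurableSet_posCone, ← measurePreserving_bordered.lintegral_comp hFm,
      lintegral_prod _ hFm'.aemeasurable]
    have hmid : ∀ a, ∫⁻ q : (Fin n → ℝ) × SymMat n ℝ,
        (posCone (n + 1)).indicator F (bordered a q.1 q.2) ∂(volume.prod volume) =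
        (Ioi (0 : ℝ)).indicator (fun a => ENNReal.ofReal (Real.exp (-(d 0 * a)) * a ^ (s - 1)) *
          ENNReal.ofReal ((2 * Real.pi) ^ ((n : ℝ) / 2) * (∏ i : Fin n, d i.succ ^ (-(1 / 2 : ℝ))) *
          (coneGamma n (s - 1 / 2) * ∏ i : Fin n, d i.succ ^ (-(s - 1 / 2))))) a := by
      intro a
      rw [lintegral_prod (fun q : (Fin n → ℝ) × SymMat n ℝ =>
        (posCone (n + 1)).indicator F (bordered a q.1 q.2))
        (hFm'.comp measurable_prodMk_left).aemeasurable]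
      simp only [hinner]
      by_cases ha : 0 < a
      · have hpos : 0 ≤ ∏ i : Fin n, d i.succ ^ (-(1 / 2 : ℝ)) :=
          Finset.prod_nonneg fun i _ => Real.rpow_nonneg (hd _).le _
        simp only [indicator_of_mem (mem_Ioi.2 ha)]
        rw [lintegral_mul_const' _ _ ENNReal.ofReal_ne_top,
          lintegral_const_mul' _ _ ENNReal.ofReal_ne_top, hgauss a ha,
          ENNReal.ofReal_mul (p := (2 * Real.pi) ^ ((n : ℝ) / 2) * _) (by positivity), ← mul_assoc]
        congr 1
        rw [← ENNReal.ofReal_mul (by positivity), ← ENNReal.ofReal_mul (by positivity)]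
        congr 1
        rw [Real.mul_rpow (by positivity) ha.le]
        -- The first power comes from the determinant, the second from the Gaussian integrals over
        -- `b`.
        have : a ^ (s - 1) = a ^ (s - ((n : ℝ) + 2) / 2) * a ^ ((n : ℝ) / 2) := by
          rw [← Real.rpow_add ha]; congr 1; ring
        rw [this]
        ring
      · simp [ha]
    simp only [hmid]
    rw [lintegral_indicator measurableSet_Ioi, lintegral_mul_const' _ _ ENNReal.ofReal_ne_top,
      hgamma, ← ENNReal.ofReal_mul]
    · congr 1
      have e1 : coneGamma (n + 1) s = (2 * Real.pi) ^ ((n : ℝ) / 2) * Real.Gamma s *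
          coneGamma n (s - 1 / 2) := by
        rw [coneGamma, coneGamma, Finset.prod_range_succ']
        have : (2 * Real.pi) ^ ((((n + 1 : ℕ) : ℝ)) * (((n + 1 : ℕ) : ℝ) - 1) / 4) =
            (2 * Real.pi) ^ ((n : ℝ) / 2) * (2 * Real.pi) ^ ((n : ℝ) * ((n : ℝ) - 1) / 4) := by
          rw [← Real.rpow_add Real.two_pi_pos]; congr 1; push_cast; ring
        rw [this]
        have h2 : ∀ j : ℕ, s - 1 / 2 - (j : ℝ) / 2 = s - ((j + 1 : ℕ) : ℝ) / 2 := by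
          intro j; push_cast; ring
        simp only [h2]
        simp
        ring
      have e2 : ∀ i : Fin n, d i.succ ^ (-s) = d i.succ ^ (-(1 / 2 : ℝ)) *
          d i.succ ^ (-(s - 1 / 2)) := by
        intro i
        rw [← Real.rpow_add (hd _)]; congr 1; ring
      rw [e1, Fin.prod_univ_succ]
      simp only [e2, Finset.prod_mul_distrib]
      ring
    · have := Real.Gamma_pos_of_pos hs0
      have := Real.rpow_nonneg (hd 0).le (-s)
      positivity

end

section

/-! ### The Siegel integral on the whole cone and the Laplace transform of the weight. -/

open SymMat

variable {n : ℕ}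

/-- The congruence `Y ↦ P Y Pᵀ`. -/
def congruence (P : Matrix (Fin n) (Fin n) ℝ) (Y : SymMat n ℝ) : SymMat n ℝ :=
  ofMatrix (P * Y.toMatrix * P.transpose) (by
    rw [Matrix.IsSymm, Matrix.transpose_mul, Matrix.transpose_mul, Matrix.transpose_transpose,
      Y.isSymm_toMatrix.eq, mul_assoc])

@[simp] theorem toMatrix_congruence (P : Matrix (Fin n) (Fin n) ℝ) (Y : SymMat n ℝ) :
    (congruence P Y).toMatrix = P * Y.toMatrix * P.transpose := rfl

theorem congruence_congruence (P Q : Matrix (Fin n) (Fin n) ℝ) (h : P * Q = 1) (Y : SymMat n ℝ) :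
    congruence P (congruence Q Y) = Y := by
  ext1
  have h' : Q.transpose * P.transpose = 1 := by
    rw [← Matrix.transpose_mul, h, Matrix.transpose_one]
  rw [toMatrix_congruence, toMatrix_congruence, ← mul_assoc, ← mul_assoc, h, one_mul, mul_assoc,
    h', mul_one]

/-- Conjugation by an orthogonal matrix. -/
def orthConj (P : Matrix (Fin n) (Fin n) ℝ) (hP : P * P.transpose = 1) :
    SymMat n ℝ ≃ₗᵢ[ℝ] SymMat n ℝ where
  toFun := congruence P
  map_add' Y Y' := by ext1; simp [mul_add, add_mul]
  map_smul' c Y := by ext1; simp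
  invFun := congruence P.transpose
  left_inv Y := congruence_congruence _ _ (mul_eq_one_comm.1 hP) Y
  right_inv Y := congruence_congruence _ _ hP Y
  norm_map' Y := by
    have hP' : P.transpose * P = 1 := mul_eq_one_comm.1 hP
    refine (pow_left_inj₀ (norm_nonneg _) (norm_nonneg _) two_ne_zero).1 ?_
    rw [← real_inner_self_eq_norm_sq, ← real_inner_self_eq_norm_sq, inner_eq_trace,
      inner_eq_trace]
    change (P * Y.toMatrix * P.transpose * (P * Y.toMatrix * P.transpose)).trace = _
    have : P * Y.toMatrix * P.transpose * (P * Y.toMatrix * P.transpose) =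
        P * (Y.toMatrix * Y.toMatrix * P.transpose) := by
      simp only [mul_assoc]
      rw [← mul_assoc P.transpose P, hP', one_mul]
    rw [this, Matrix.trace_mul_comm, mul_assoc, hP', mul_one]

theorem toMatrix_orthConj (P : Matrix (Fin n) (Fin n) ℝ) (hP : P * P.transpose = 1)
    (Y : SymMat n ℝ) : (orthConj P hP Y).toMatrix = P * Y.toMatrix * P.transpose := rfl

/-- The Siegel integral over the cone. -/
theorem lintegral_posCone_exp {X : SymMat n ℝ} (hX : X ∈ posCone n) {s : ℝ}
    (hs : ((n : ℝ) - 1) / 2 < s) :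
    ∫⁻ Y in posCone n, ENNReal.ofReal (Real.exp (-inner ℝ X Y) *
      Y.det ^ (s - ((n : ℝ) + 1) / 2)) = ENNReal.ofReal (coneGamma n s * X.det ^ (-s)) := by
  have hpd : X.toMatrix.PosDef := hX
  have hH := hpd.isHermitian
  -- Conjugation by the eigenvector matrix of `X` preserves the trace norm, the cone and the
  -- determinant, so only the eigenvalues of `X` matter.
  set P : Matrix (Fin n) (Fin n) ℝ := (hH.eigenvectorUnitary).1 with hPdef
  have hP : P * P.transpose = 1 := by
    have := (Matrix.mem_unitaryGroup_iff (A := P)).1 hH.eigenvectorUnitary.2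
    rwa [Matrix.star_eq_conjTranspose, Matrix.conjTranspose_eq_transpose_of_trivial] at this
  have hP' : P.transpose * P = 1 := mul_eq_one_comm.1 hP
  set d := hH.eigenvalues with hd
  have hspec : X.toMatrix = P * Matrix.diagonal d * P.transpose := by
    have := hH.spectral_theorem
    rw [Unitary.conjStarAlgAut_apply, Matrix.star_eq_conjTranspose,
      Matrix.conjTranspose_eq_transpose_of_trivial] at this
    exact this
  have hdpos : ∀ i, 0 < d i := hpd.eigenvalues_pos
  have hmem : ∀ Y, orthConj P hP Y ∈ posCone n ↔ Y ∈ posCone n := by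
    intro Y
    have hu : IsUnit P := IsUnit.of_mul_eq_one _ hP
    have := Matrix.IsUnit.posDef_star_right_conjugate_iff (x := Y.toMatrix) hu
    rw [Matrix.star_eq_conjTranspose, Matrix.conjTranspose_eq_transpose_of_trivial] at this
    exact this
  have hdet : ∀ Y, (orthConj P hP Y).det = Y.det := by
    intro Y
    rw [SymMat.det, toMatrix_orthConj, Matrix.det_mul, Matrix.det_mul, mul_right_comm,
      ← Matrix.det_mul, hP, Matrix.det_one, one_mul]
    rfl
  have hin : ∀ Y, inner ℝ X (orthConj P hP Y) = ∑ i, d i * Y.toMatrix i i := by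
    intro Y
    rw [inner_eq_trace, toMatrix_orthConj, hspec]
    have : P * Matrix.diagonal d * P.transpose * (P * Y.toMatrix * P.transpose) =
        P * (Matrix.diagonal d * Y.toMatrix * P.transpose) := by
      simp only [mul_assoc]
      rw [← mul_assoc P.transpose P, hP', one_mul]
    rw [this, Matrix.trace_mul_comm, mul_assoc, hP', mul_one, Matrix.trace]
    simp [Matrix.diagonal_mul]
  have hXdet : X.det = ∏ i, d i := by
    rw [SymMat.det, hspec, Matrix.det_mul, Matrix.det_mul, mul_right_comm, ← Matrix.det_mul, hP,
      Matrix.det_one, one_mul, Matrix.det_diagonal]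
  have hmeas : Measurable ((posCone n).indicator fun Y : SymMat n ℝ => ENNReal.ofReal
      (Real.exp (-inner ℝ X Y) * Y.det ^ (s - ((n : ℝ) + 1) / 2))) := by
    refine Measurable.indicator ?_ measurableSet_posCone
    refine ((Continuous.measurable ?_).mul (continuous_det.measurable.pow_const _)).ennreal_ofReal
    fun_prop
  rw [← lintegral_indicator measurableSet_posCone,
    ← (orthConj P hP).measurePreserving.lintegral_comp hmeas, hXdet,
    ← Real.finsetProd_rpow _ _ fun i _ => (hdpos i).le, ← lintegral_posCone_diagonal n d hdpos s hs,
    ← lintegral_indicator measurableSet_posCone]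
  refine lintegral_congr fun Y => ?_
  by_cases hY : Y ∈ posCone n
  · rw [indicator_of_mem hY, indicator_of_mem ((hmem Y).2 hY), hdet, hin]
  · rw [indicator_of_notMem hY, indicator_of_notMem fun h => hY ((hmem Y).1 h)]

theorem coneGamma_pos {s : ℝ} (hs : ((n : ℝ) - 1) / 2 < s) : 0 < coneGamma n s := by
  refine mul_pos (by positivity) (Finset.prod_pos fun j hj => Real.Gamma_pos_of_pos ?_)
  have : (j : ℝ) + 1 ≤ n := by exact_mod_cast Finset.mem_range.1 hj
  linarith

section weight

variable {lam : ℝ}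

theorem coneGamma_pos_of_lt (hlam : (n : ℝ) < lam) : 0 < coneGamma n lam :=
  coneGamma_pos (by have : (0 : ℝ) ≤ n := n.cast_nonneg; linarith)

/-- The convergence condition `(n - 1)/2 < λ - (n + 1)/2` is exactly `n < λ`. -/
theorem coneGamma_sub_pos (hlam : (n : ℝ) < lam) :
    0 < coneGamma n (lam - ((n : ℝ) + 1) / 2) :=
  coneGamma_pos (by linarith)

theorem weightConst_pos (hlam : (n : ℝ) < lam) : 0 < weightConst n lam :=
  div_pos (coneGamma_pos_of_lt hlam) (mul_pos (by positivity) (coneGamma_sub_pos hlam))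

theorem detWeight_pos {Y : SymMat n ℝ} (hY : Y ∈ posCone n) : 0 < detWeight n lam Y :=
  Real.rpow_pos_of_pos (det_pos_of_mem (smul_mem_posCone two_pos hY)) _

theorem det_two_smul (Y : SymMat n ℝ) (c : ℝ) : (c • Y).det = c ^ n * Y.det := by
  simp [SymMat.det]

theorem detWeight_eq {Y : SymMat n ℝ} (hY : Y ∈ posCone n) :
    detWeight n lam Y = 2 ^ ((n : ℝ) * (lam - n - 1)) * Y.det ^ (lam - n - 1) := by
  rw [detWeight, det_two_smul, Real.mul_rpow (by positivity) (det_pos_of_mem hY).le,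
    ← Real.rpow_natCast, ← Real.rpow_mul zero_le_two]

/-- The Siegel integral at `2X` with `s = λ - (n+1)/2`; the powers of 2 from `det(2Y)` and `det(2X)`
combine to `2^(-n(n+1)/2)`. -/
theorem lintegral_exp_detWeight (hlam : (n : ℝ) < lam) {X : SymMat n ℝ} (hX : X ∈ posCone n) :
    ∫⁻ Y in posCone n, ENNReal.ofReal (Real.exp (-2 * inner ℝ X Y) * detWeight n lam Y) =
      ENNReal.ofReal (coneGamma n (lam - ((n : ℝ) + 1) / 2) /
        (2 ^ ((n : ℝ) * ((n : ℝ) + 1) / 2) * X.det ^ (lam - ((n : ℝ) + 1) / 2))) := by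
  have h := lintegral_posCone_exp (smul_mem_posCone two_pos hX)
    (s := lam - ((n : ℝ) + 1) / 2) (by linarith)
  have e : ∀ Y ∈ posCone n,
      ENNReal.ofReal (Real.exp (-2 * inner ℝ X Y) * detWeight n lam Y) =
      ENNReal.ofReal (2 ^ ((n : ℝ) * (lam - n - 1))) *
      ENNReal.ofReal (Real.exp (-inner ℝ ((2 : ℝ) • X) Y) *
      Y.det ^ (lam - ((n : ℝ) + 1) / 2 - ((n : ℝ) + 1) / 2)) := by
    intro Y hY
    rw [← ENNReal.ofReal_mul (by positivity), detWeight_eq hY, inner_smul_left]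
    congr 1
    have : lam - ((n : ℝ) + 1) / 2 - ((n : ℝ) + 1) / 2 = lam - n - 1 := by ring
    rw [this]
    simp only [conj_trivial, neg_mul]
    ring
  rw [setLIntegral_congr_fun measurableSet_posCone e,
    lintegral_const_mul' _ _ ENNReal.ofReal_ne_top, h, ← ENNReal.ofReal_mul (by positivity)]
  congr 1
  rw [det_two_smul, Real.mul_rpow (by positivity) (det_pos_of_mem hX).le, ← Real.rpow_natCast,
    ← Real.rpow_mul zero_le_two, Real.rpow_neg (det_pos_of_mem hX).le]
  have e2 : (2 : ℝ) ^ ((n : ℝ) * (lam - n - 1)) *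
      2 ^ ((n : ℝ) * -(lam - ((n : ℝ) + 1) / 2)) = (2 ^ ((n : ℝ) * ((n : ℝ) + 1) / 2))⁻¹ := by
    rw [← Real.rpow_add two_pos, ← Real.rpow_neg zero_le_two]
    congr 1
    ring
  have h0 : 0 < X.det ^ (lam - ((n : ℝ) + 1) / 2) := Real.rpow_pos_of_pos (det_pos_of_mem hX) _
  calc _ = ((2 : ℝ) ^ ((n : ℝ) * (lam - n - 1)) *
      2 ^ ((n : ℝ) * -(lam - ((n : ℝ) + 1) / 2))) *
      (coneGamma n (lam - ((n : ℝ) + 1) / 2) * (X.det ^ (lam - ((n : ℝ) + 1) / 2))⁻¹) := by ring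
    _ = _ := by rw [e2]; field_simp

theorem lintegral_coneWeighted (hlam : (n : ℝ) < lam) {f : SymMat n ℝ → ℝ≥0∞}
    (hf : AEMeasurable f (coneVolume n)) :
    ∫⁻ Y, f Y ∂(coneWeighted n lam) = ENNReal.ofReal (weightConst n lam) *
      ∫⁻ Y in posCone n, f Y * ENNReal.ofReal (detWeight n lam Y) := by
  rw [coneWeighted, lintegral_withDensity_eq_lintegral_mul₀
    (((measurable_detWeight lam).const_mul _).ennreal_ofReal.aemeasurable) hf,
    ← lintegral_const_mul' _ _ ENNReal.ofReal_ne_top]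
  refine lintegral_congr fun Y => ?_
  simp only [Pi.mul_apply]
  rw [ENNReal.ofReal_mul (weightConst_pos hlam).le]
  ring

/-- The factor `weightConst` replaces `Γ_Ω(λ - (n+1)/2)` by `Γ_Ω(λ)` and supplies the power of `π`;
this is the value that the constants of `S` invert. -/
theorem lintegral_exp_coneWeighted (hlam : (n : ℝ) < lam) {X : SymMat n ℝ} (hX : X ∈ posCone n) :
    ∫⁻ Y, ENNReal.ofReal (Real.exp (-2 * inner ℝ X Y)) ∂(coneWeighted n lam) =
      ENNReal.ofReal (coneGamma n lam /
        ((2 * Real.pi) ^ ((n : ℝ) * ((n : ℝ) + 1) / 2) * X.det ^ (lam - ((n : ℝ) + 1) / 2))) := by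
  have hm : Measurable fun Y : SymMat n ℝ => ENNReal.ofReal (Real.exp (-2 * inner ℝ X Y)) := by
    refine (Continuous.measurable ?_).ennreal_ofReal
    fun_prop
  rw [lintegral_coneWeighted hlam hm.aemeasurable]
  simp only [← ENNReal.ofReal_mul (Real.exp_pos _).le]
  rw [lintegral_exp_detWeight hlam hX, ← ENNReal.ofReal_mul (weightConst_pos hlam).le]
  congr 1
  have h1 := (coneGamma_sub_pos hlam).ne'
  have h0 : X.det ^ (lam - ((n : ℝ) + 1) / 2) ≠ 0 :=
    (Real.rpow_pos_of_pos (det_pos_of_mem hX) _).ne'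
  rw [weightConst, Real.mul_rpow zero_le_two Real.pi_pos.le]
  have h2 : (Real.pi : ℝ) ^ ((n : ℝ) * ((n : ℝ) + 1) / 2) ≠ 0 := by positivity
  have h3 : (2 : ℝ) ^ ((n : ℝ) * ((n : ℝ) + 1) / 2) ≠ 0 := by positivity
  generalize X.det ^ (lam - ((n : ℝ) + 1) / 2) = u at h0 ⊢
  generalize coneGamma n (lam - ((n : ℝ) + 1) / 2) = v at h1 ⊢
  field_simp

theorem lintegral_det_exp_lt_top (hlam : (n : ℝ) < lam) {Y : SymMat n ℝ} (hY : Y ∈ posCone n) :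
    ∫⁻ ξ in posCone n, ENNReal.ofReal (ξ.det ^ (lam - ((n : ℝ) + 1) / 2) *
      Real.exp (-inner ℝ ξ Y)) < ∞ := by
  have h := lintegral_posCone_exp hY (s := lam) (by have : (0 : ℝ) ≤ n := n.cast_nonneg; linarith)
  simp only [mul_comm _ (Real.exp _), real_inner_comm Y]
  rw [h]
  exact ENNReal.ofReal_lt_top

end weight

end

section

open SymMat

variable {n : ℕ} {lam : ℝ}

/-! ### The isometry `S`. -/

section SOperator

variable (n lam) in
/-- The constant in the definition of `S`. -/
def sConst : ℝ := (2 * Real.pi) ^ ((n : ℝ) * ((n : ℝ) + 1) / 4) / (coneGamma n lam) ^ (1 / 2 : ℝ)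

theorem sConst_pos (hlam : (n : ℝ) < lam) : 0 < sConst n lam :=
  div_pos (by positivity) (Real.rpow_pos_of_pos (coneGamma_pos_of_lt hlam) _)

theorem sConst_sq (hlam : (n : ℝ) < lam) :
    sConst n lam ^ 2 = (2 * Real.pi) ^ ((n : ℝ) * ((n : ℝ) + 1) / 2) / coneGamma n lam := by
  rw [sConst, div_pow, ← Real.rpow_natCast, ← Real.rpow_natCast (coneGamma n lam ^ _),
    ← Real.rpow_mul (by positivity), ← Real.rpow_mul (coneGamma_pos_of_lt hlam).le]
  congr 1
  · congr 1; push_cast; ring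
  · simp

/-- The power of the determinant in the definition of `S`. -/
def detPow (lam : ℝ) (X : SymMat n ℝ) : ℝ := X.det ^ (lam / 2 - ((n : ℝ) + 1) / 4)

theorem measurable_detPow : Measurable (detPow lam : SymMat n ℝ → ℝ) :=
  continuous_det.measurable.pow_const _

theorem detPow_pos {X : SymMat n ℝ} (hX : X ∈ posCone n) : 0 < detPow lam X :=
  Real.rpow_pos_of_pos (det_pos_of_mem hX) _

theorem detPow_sq {X : SymMat n ℝ} (hX : X ∈ posCone n) :
    detPow lam X ^ 2 = X.det ^ (lam - ((n : ℝ) + 1) / 2) := by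
  rw [detPow, ← Real.rpow_natCast, ← Real.rpow_mul (det_pos_of_mem hX).le]
  congr 1; push_cast; ring

theorem sFun_of_mem {h : SymMat n ℝ → ℂ} {X Y : SymMat n ℝ} (hX : X ∈ posCone n) :
    sFun n lam h (X, Y) = (sConst n lam : ℂ) * (h X * (detPow lam X : ℂ)) *
      (Real.exp (-inner ℝ X Y) : ℂ) := by
  rw [sFun]
  simp only [indicator_of_mem hX, trMul_eq_inner]
  rfl

theorem sFun_of_notMem {h : SymMat n ℝ → ℂ} {X Y : SymMat n ℝ} (hX : X ∉ posCone n) :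
    sFun n lam h (X, Y) = 0 := by
  rw [sFun]
  simp only [indicator_of_notMem hX, mul_zero, zero_mul]

theorem measurable_sFun {h : SymMat n ℝ → ℂ} (hh : Measurable h) :
    Measurable (sFun n lam h) := by
  unfold sFun
  refine (Measurable.const_mul ?_ _).mul ?_
  · refine Measurable.comp (g := (posCone n).indicator _) ?_ measurable_fst
    exact (hh.mul (Complex.measurable_ofReal.comp measurable_detPow)).indicator
      measurableSet_posCone
  · refine Continuous.measurable ?_
    simp only [trMul_eq_inner]
    fun_prop

/-- On the cone `sConst ^ 2 * detPow ^ 2` is the reciprocal of the Laplace transform of the weight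
at `X`. This is why `S` is isometric. -/
theorem lintegral_sFun_slice (hlam : (n : ℝ) < lam) (h : SymMat n ℝ → ℂ) (X : SymMat n ℝ) :
    ∫⁻ Y, ‖sFun n lam h (X, Y)‖ₑ ^ 2 ∂(coneWeighted n lam) =
      (posCone n).indicator (fun X => ‖h X‖ₑ ^ 2) X := by
  by_cases hX : X ∈ posCone n
  · have e : ∀ Y, ‖sFun n lam h (X, Y)‖ₑ ^ 2 = ENNReal.ofReal (sConst n lam ^ 2) * ‖h X‖ₑ ^ 2 *
        ENNReal.ofReal (detPow lam X ^ 2) * ENNReal.ofReal (Real.exp (-2 * inner ℝ X Y)) := by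
      intro Y
      rw [sFun_of_mem hX]
      simp only [enorm_mul, mul_pow]
      have e1 : ∀ r : ℝ, ‖(r : ℂ)‖ₑ ^ 2 = ENNReal.ofReal (r ^ 2) := by
        intro r
        rw [← ofReal_norm, ← ENNReal.ofReal_pow (norm_nonneg _), Complex.norm_real,
          Real.norm_eq_abs, sq_abs]
      have e2 : Real.exp (-inner ℝ X Y) ^ 2 = Real.exp (-2 * inner ℝ X Y) := by
        rw [← Real.exp_nat_mul]; congr 1; push_cast; ring
      rw [e1, e1, e1, e2, ← mul_assoc]
    simp only [e]
    rw [lintegral_const_mul' _ _ (by finiteness), lintegral_exp_coneWeighted hlam hX,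
      indicator_of_mem hX, mul_comm (ENNReal.ofReal (sConst n lam ^ 2)), mul_assoc, mul_assoc,
      ← ENNReal.ofReal_mul (sq_nonneg _), ← ENNReal.ofReal_mul (sq_nonneg _)]
    have h1 := (Real.rpow_pos_of_pos (det_pos_of_mem hX) (lam - ((n : ℝ) + 1) / 2)).ne'
    have h2 := (coneGamma_pos_of_lt hlam).ne'
    have h3 : (2 * Real.pi) ^ ((n : ℝ) * ((n : ℝ) + 1) / 2) ≠ 0 := by positivity
    rw [sConst_sq hlam, detPow_sq hX]
    generalize X.det ^ (lam - ((n : ℝ) + 1) / 2) = u at h1 ⊢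
    generalize (2 * Real.pi) ^ ((n : ℝ) * ((n : ℝ) + 1) / 2) = v at h3 ⊢
    have : v / coneGamma n lam * (u * (coneGamma n lam / (v * u))) = 1 := by field_simp
    rw [this, ENNReal.ofReal_one, mul_one]
  · simp [sFun_of_notMem hX, hX]

theorem lintegral_sFun (hlam : (n : ℝ) < lam) {h : SymMat n ℝ → ℂ} (hh : Measurable h) :
    ∫⁻ p, ‖sFun n lam h p‖ₑ ^ 2 ∂((volume : Measure (SymMat n ℝ)).prod (coneWeighted n lam)) =
      ∫⁻ X, ‖h X‖ₑ ^ 2 ∂(coneVolume n) := by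
  rw [lintegral_prod _ ((measurable_sFun hh).enorm.pow_const 2).aemeasurable]
  simp only [lintegral_sFun_slice hlam]
  rw [lintegral_indicator measurableSet_posCone]
  rfl

/-- One direction defines `S`; the other recovers `h ∈ L²(Ω)` in the Paley–Wiener argument. -/
theorem memLp_sFun_iff (hlam : (n : ℝ) < lam) {h : SymMat n ℝ → ℂ} (hh : Measurable h) :
    MemLp (sFun n lam h) 2 ((volume : Measure (SymMat n ℝ)).prod (coneWeighted n lam)) ↔
      MemLp h 2 (coneVolume n) := by
  rw [memLp_two_iff_lintegral (measurable_sFun hh).aestronglyMeasurable,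
    memLp_two_iff_lintegral hh.aestronglyMeasurable, lintegral_sFun hlam hh]

theorem sFun_ae_congr {h h' : SymMat n ℝ → ℂ} (hh : h =ᵐ[coneVolume n] h') :
    sFun n lam h =ᵐ[(volume : Measure (SymMat n ℝ)).prod (coneWeighted n lam)] sFun n lam h' := by
  have h1 : ∀ᵐ X ∂(volume : Measure (SymMat n ℝ)), X ∈ posCone n → h X = h' X :=
    (ae_restrict_iff' measurableSet_posCone).1 hh
  have h2 := (Measure.quasiMeasurePreserving_fst (μ := (volume : Measure (SymMat n ℝ)))
    (ν := coneWeighted n lam)).ae h1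
  filter_upwards [h2] with p hp
  obtain ⟨X, Y⟩ := p
  by_cases hX : X ∈ posCone n
  · rw [sFun_of_mem hX, sFun_of_mem hX, hp hX]
  · rw [sFun_of_notMem hX, sFun_of_notMem hX]

theorem memLp_sFun (hlam : (n : ℝ) < lam) (h : L2Cone n) :
    MemLp (sFun n lam h) 2 ((volume : Measure (SymMat n ℝ)).prod (coneWeighted n lam)) :=
  (memLp_sFun_iff hlam (Lp.stronglyMeasurable h).measurable).2 (Lp.memLp h)

theorem sFun_add (h h' : SymMat n ℝ → ℂ) : sFun n lam (h + h') = sFun n lam h + sFun n lam h' := by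
  ext ⟨X, Y⟩
  by_cases hX : X ∈ posCone n
  · simp only [Pi.add_apply, sFun_of_mem hX]; ring
  · simp only [Pi.add_apply, sFun_of_notMem hX, add_zero]

theorem sFun_smul (c : ℂ) (h : SymMat n ℝ → ℂ) : sFun n lam (c • h) = c • sFun n lam h := by
  ext ⟨X, Y⟩
  by_cases hX : X ∈ posCone n
  · simp only [Pi.smul_apply, sFun_of_mem hX, smul_eq_mul]; ring
  · simp only [Pi.smul_apply, sFun_of_notMem hX, smul_zero]

/-- The isometry `S`. -/
def sOperator (hlam : (n : ℝ) < lam) : L2Cone n →ₗᵢ[ℂ] L2Tensor n lam where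
  toFun h := (memLp_sFun hlam h).toLp _
  map_add' h h' := by
    rw [← MemLp.toLp_add, MemLp.toLp_eq_toLp_iff, ← sFun_add]
    exact sFun_ae_congr (Lp.coeFn_add h h')
  map_smul' c h := by
    rw [RingHom.id_apply, ← MemLp.toLp_const_smul, MemLp.toLp_eq_toLp_iff, ← sFun_smul]
    exact sFun_ae_congr (Lp.coeFn_smul c h)
  norm_map' h := by
    have : ‖(memLp_sFun hlam h).toLp _‖ = ‖h‖ := by
      rw [Lp.norm_toLp, Lp.norm_def]
      congr 1
      refine (ENNReal.pow_right_strictMono two_ne_zero).injective ?_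
      change eLpNorm _ 2 _ ^ 2 = eLpNorm _ 2 _ ^ 2
      rw [lintegral_enorm_sq_eq, lintegral_enorm_sq_eq,
        lintegral_sFun hlam (Lp.stronglyMeasurable h).measurable]
    exact this

theorem isSOperator_sOperator (hlam : (n : ℝ) < lam) : IsSOperator (sOperator (n := n) hlam) :=
  fun h => (memLp_sFun hlam h).coeFn_toLp

end SOperator

/-! ### The unitary `U`. -/

section UOperator

/-- Composition with an invertible measure preserving map as a unitary operator. -/
def compEquiv {α β : Type*} [MeasurableSpace α] [MeasurableSpace β] {μ : Measure α}
    {ν : Measure β} (e : α ≃ᵐ β) (he : MeasurePreserving e μ ν) : Lp ℂ 2 ν ≃ₗᵢ[ℂ] Lp ℂ 2 μ where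
  toLinearEquiv := LinearEquiv.ofLinearMap
    (Lp.compMeasurePreservingₗᵢ ℂ e he).toLinearMap
    (Lp.compMeasurePreservingₗᵢ ℂ e.symm he.symm).toLinearMap
    (LinearMap.ext fun f => by
      change Lp.compMeasurePreserving e he (Lp.compMeasurePreserving e.symm he.symm f) = f
      rw [← Lp.compMeasurePreserving_comp_apply]
      simp)
    (LinearMap.ext fun f => by
      change Lp.compMeasurePreserving e.symm he.symm (Lp.compMeasurePreserving e he f) = f
      rw [← Lp.compMeasurePreserving_comp_apply]
      simp)
  norm_map' f := (Lp.compMeasurePreservingₗᵢ ℂ e he).norm_map f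

theorem compEquiv_coeFn {α β : Type*} [MeasurableSpace α] [MeasurableSpace β] {μ : Measure α}
    {ν : Measure β} (e : α ≃ᵐ β) (he : MeasurePreserving e μ ν) (f : Lp ℂ 2 ν) :
    compEquiv e he f =ᵐ[μ] fun x => f (e x) :=
  Lp.coeFn_compMeasurePreserving f he

variable (n lam) in
/-- The coordinates `Z = X + i Y` on the level of `L²`. -/
def coordEquiv : L2Siegel n lam ≃ₗᵢ[ℂ] L2Tensor n lam :=
  compEquiv (reImHomeomorph n).toMeasurableEquiv (measurePreserving_reImHomeomorph lam)

theorem coordEquiv_coeFn (f : L2Siegel n lam) : coordEquiv n lam f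
    =ᵐ[(volume : Measure (SymMat n ℝ)).prod (coneWeighted n lam)] fun p => f (ofReIm p.1 p.2) :=
  compEquiv_coeFn _ _ f

variable (n lam) in
/-- `ℱ ⊗ I` on `L²(Symm(n,ℝ)) ⊗ L²(Ω)`. -/
def fourierTensor : L2Tensor n lam ≃ₗᵢ[ℂ] L2Tensor n lam :=
  (exists_tensor_unitary (coneWeighted n lam) (unitaryFourier (SymMat n ℝ))).choose

theorem fourierTensor_tensorL2 (φ : Lp ℂ 2 (volume : Measure (SymMat n ℝ)))
    (ψ : Lp ℂ 2 (coneWeighted n lam)) :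
    fourierTensor n lam (tensorL2 _ _ φ ψ) = tensorL2 _ _ (unitaryFourier _ φ) ψ :=
  (exists_tensor_unitary (coneWeighted n lam) (unitaryFourier (SymMat n ℝ))).choose_spec φ ψ

variable (n lam) in
/-- The operator `U`. -/
def uOperator : L2Siegel n lam ≃ₗᵢ[ℂ] L2Tensor n lam :=
  (coordEquiv n lam).trans (fourierTensor n lam)

theorem fourierConst_eq : 1 / (2 * Real.pi) ^ ((Module.finrank ℝ (SymMat n ℝ) : ℝ) / 2) =
    1 / (2 * Real.pi) ^ ((n : ℝ) * ((n : ℝ) + 1) / 4) := by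
  rw [finrank_symMat]; congr 2; ring

theorem unitaryFourier_toLp_eq_symFourier {φ : SymMat n ℝ → ℂ} (h1 : Integrable φ)
    (h2 : MemLp φ 2) : unitaryFourier (SymMat n ℝ) (h2.toLp φ) =ᵐ[volume] symFourier φ := by
  refine (unitaryFourier_coeFn h1 h2).trans (ae_of_all _ fun X => ?_)
  simp only [symFourier, trMul_eq_inner, fourierConst_eq]

theorem isPartialFourier_uOperator : IsPartialFourier (uOperator n lam) := by
  intro φ ψ h1 h2 hψ f hf
  have hc : coordEquiv n lam f = tensorL2 _ _ (h2.toLp φ) (hψ.toLp ψ) := by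
    refine Lp.ext ((coordEquiv_coeFn f).trans (EventuallyEq.trans ?_
      (tensorL2_coeFn _ _).symm))
    have h3 := (measurePreserving_reImHomeomorph (n := n) lam).quasiMeasurePreserving.ae_eq_comp hf
    filter_upwards [h3, Measure.quasiMeasurePreserving_fst.ae_eq_comp h2.coeFn_toLp,
      Measure.quasiMeasurePreserving_snd.ae_eq_comp hψ.coeFn_toLp] with p e1 e2 e3
    simp only [Function.comp_apply] at e1 e2 e3
    rw [e2, e3]
    refine e1.trans ?_
    simp [reImHomeomorph]
  have e : uOperator n lam f = tensorL2 _ _ (unitaryFourier _ (h2.toLp φ)) (hψ.toLp ψ) := by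
    rw [← fourierTensor_tensorL2, ← hc]
    rfl
  rw [e]
  filter_upwards [tensorL2_coeFn (unitaryFourier _ (h2.toLp φ)) (hψ.toLp ψ),
    Measure.quasiMeasurePreserving_fst.ae_eq_comp (unitaryFourier_toLp_eq_symFourier h1 h2),
    Measure.quasiMeasurePreserving_snd.ae_eq_comp hψ.coeFn_toLp] with p e1 e2 e3
  simp only [Function.comp_apply] at e2 e3
  rw [e1, e2, e3]

end UOperator

end

section

/-! ### Pointwise formula for the inverse of `ℱ ⊗ I`. -/

section InverseSlices

variable {E β : Type*} [NormedAddCommGroup E] [InnerProductSpace ℝ E] [FiniteDimensional ℝ E]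
  [MeasurableSpace E] [BorelSpace E] [MeasurableSpace β] {ν : Measure β} [SigmaFinite ν]

theorem norm_exp_I_mul_ofReal (r : ℝ) : ‖Complex.exp (Complex.I * r)‖ = 1 := by
  rw [mul_comm]; exact Complex.norm_exp_ofReal_mul_I r

theorem stronglyMeasurable_exp_mul {G : E × β → ℂ} (hG : StronglyMeasurable G) :
    StronglyMeasurable fun q : (E × β) × E =>
      Complex.exp (Complex.I * (inner ℝ q.1.1 q.2 : ℝ)) * G (q.2, q.1.2) := by
  refine StronglyMeasurable.mul ?_ (hG.comp_measurable (by fun_prop))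
  have : Continuous fun q : E × E => Complex.exp (Complex.I * (inner ℝ q.1 q.2 : ℝ)) := by
    fun_prop
  exact this.stronglyMeasurable.comp_measurable (g := fun q : (E × β) × E => (q.1.1, q.2))
    (by fun_prop)

/-- The inverse of `ℱ ⊗ I` is given by the Fourier integral on each slice, provided that the slices
are integrable. -/
theorem symm_coeFn_of_integrable_slices
    {T : Lp ℂ 2 ((volume : Measure E).prod ν) ≃ₗᵢ[ℂ] Lp ℂ 2 ((volume : Measure E).prod ν)}
    (hT : ∀ φ ψ, T (tensorL2 _ _ φ ψ) = tensorL2 _ _ (unitaryFourier E φ) ψ)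
    (g : Lp ℂ 2 ((volume : Measure E).prod ν)) {G : E × β → ℂ} (hG : StronglyMeasurable G)
    (hgG : g =ᵐ[(volume : Measure E).prod ν] G)
    (hint : ∀ᵐ y ∂ν, Integrable fun ξ => G (ξ, y)) :
    T.symm g =ᵐ[(volume : Measure E).prod ν] fun p =>
      ((1 / (2 * Real.pi) ^ ((Module.finrank ℝ E : ℝ) / 2) : ℝ) : ℂ) *
        ∫ ξ, Complex.exp (Complex.I * (inner ℝ p.1 ξ : ℝ)) * G (ξ, p.2) := by
  set c : ℝ := 1 / (2 * Real.pi) ^ ((Module.finrank ℝ E : ℝ) / 2) with hc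
  set K : E × β → ℂ := fun p =>
    (c : ℂ) * ∫ ξ, Complex.exp (Complex.I * (inner ℝ p.1 ξ : ℝ)) * G (ξ, p.2) with hK
  have hc0 : 0 ≤ c := by positivity
  have hKm : StronglyMeasurable K :=
    ((stronglyMeasurable_exp_mul hG).integral_prod_right').const_mul _
  set f := T.symm g with hf
  have hTf : T f = g := T.apply_symm_apply g
  let N : β → ℝ≥0∞ := fun y => ∫⁻ ξ, ‖G (ξ, y)‖ₑ
  have hN : Measurable N := hG.measurable.enorm.lintegral_prod_left'
  let A : ℕ → Set E := fun m => Metric.closedBall 0 m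
  -- Over `B m` the slices have `L¹` norm at most `m`, so the candidate `K` is bounded there and
  -- integrals over rectangles make sense.
  let B : ℕ → Set β := fun m => N ⁻¹' (Iic (m : ℝ≥0∞)) ∩ spanningSets ν m
  have hA : ∀ m, MeasurableSet (A m) := fun m => Metric.isClosed_closedBall.measurableSet
  have hB : ∀ m, MeasurableSet (B m) := fun m =>
    (hN measurableSet_Iic).inter (measurableSet_spanningSets ν m)
  have hμA : ∀ m, (volume : Measure E) (A m) < ∞ := fun m => measure_closedBall_lt_top
  have hνB : ∀ m, ν (B m) < ∞ := fun m =>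
    (measure_mono inter_subset_right).trans_lt (measure_spanningSets_lt_top ν m)
  have hKb : ∀ m, ∀ p ∈ A m ×ˢ B m, ‖K p‖ ≤ c * m := by
    intro m p hp
    rw [hK]
    simp only
    rw [norm_mul, Complex.norm_real, Real.norm_of_nonneg hc0]
    refine mul_le_mul_of_nonneg_left ?_ hc0
    refine (norm_integral_le_lintegral_norm _).trans ?_
    refine ENNReal.toReal_le_of_le_ofReal (by positivity) ?_
    have h1 : N p.2 ≤ m := hp.2.1
    rw [ENNReal.ofReal_natCast]
    refine le_trans (le_of_eq (lintegral_congr fun ξ => ?_)) h1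
    rw [norm_mul, norm_exp_I_mul_ofReal, one_mul, ofReal_norm]
  have hint' : ∀ m, IntegrableOn (fun p => f p - K p) (A m ×ˢ B m)
      ((volume : Measure E).prod ν) := by
    intro m
    have hfin : ((volume : Measure E).prod ν) (A m ×ˢ B m) < ∞ := by
      rw [Measure.prod_prod]; exact ENNReal.mul_lt_top (hμA m) (hνB m)
    have : IsFiniteMeasure (((volume : Measure E).prod ν).restrict (A m ×ˢ B m)) :=
      ⟨by rwa [Measure.restrict_apply_univ]⟩
    refine Integrable.sub (((Lp.memLp f).restrict _).integrable one_le_two) ?_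
    exact Measure.integrableOn_of_bounded hfin.ne hKm.aestronglyMeasurable
      ((ae_restrict_iff' ((hA m).prod (hB m))).2 (ae_of_all _ (hKb m)))
  have hzero : (fun p => f p - K p) =ᵐ[(volume : Measure E).prod ν] 0 := by
    refine ae_eq_zero_of_setIntegral_prod_eq_zero_of_cover A B hA hB hμA hνB ?_ hint' ?_
    · have := (Measure.quasiMeasurePreserving_snd (μ := (volume : Measure E)) (ν := ν)).ae hint
      filter_upwards [this] with p hp
      have hNp : N p.2 < ∞ := hp.2
      obtain ⟨m1, hm1⟩ := exists_nat_ge ‖p.1‖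
      obtain ⟨m2, hm2⟩ := ENNReal.exists_nat_gt hNp.ne
      obtain ⟨m3, hm3⟩ := mem_iUnion.1 (iUnion_spanningSets ν ▸ mem_univ p.2)
      refine ⟨max m1 (max m2 m3), ?_, ?_, monotone_spanningSets ν (by simp) hm3⟩
      · rw [Metric.mem_closedBall, dist_zero_right]
        exact hm1.trans (by exact_mod_cast le_max_left _ _)
      · refine mem_preimage.2 (mem_Iic.2 (hm2.le.trans ?_))
        exact_mod_cast (le_max_left m2 m3).trans (le_max_right _ _)
    · intro m A' B' hA' hB' hAs hBs
      have hμA' : (volume : Measure E) A' < ∞ := (measure_mono hAs).trans_lt (hμA m)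
      have hi := (hint' m).mono_set (prod_mono hAs hBs)
      have hi2 : IntegrableOn (fun p => f p - K p) (A' ×ˢ B') ((volume : Measure E).prod ν) := hi
      rw [← Measure.prod_restrict]
      rw [IntegrableOn, ← Measure.prod_restrict] at hi2
      rw [integral_prod_symm _ hi2]
      refine integral_eq_zero_of_ae ?_
      -- Slicewise unitarity against `χ_{A'}` rewrites the integral of `f` over `A'` as a pairing of
      -- `G` with the explicit Fourier transform of `χ_{A'}`. Fubini then turns it into the integral
      -- of `K`.
      have hp1 : Integrable (A'.indicator fun _ => (1 : ℂ)) :=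
        (integrable_indicator_iff hA').2 (integrableOn_const hμA'.ne)
      have hp2 : MemLp (A'.indicator fun _ => (1 : ℂ)) 2 (volume : Measure E) :=
        memLp_indicator_const 2 hA' 1 (Or.inr hμA'.ne)
      have hW := ae_integral_conj_mul_eq hT (hp2.toLp _) f
      rw [hTf] at hW
      have hsl : ∀ᵐ y ∂ν, ∀ᵐ ξ ∂(volume : Measure E), g (ξ, y) = G (ξ, y) := by
        have := (Measure.measurePreserving_swap (μ := ν)
          (ν := (volume : Measure E))).quasiMeasurePreserving.ae hgG
        exact Measure.ae_ae_of_ae_prod this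
      have hslf : ∀ᵐ y ∂(ν.restrict B'), Integrable (fun x => f (x, y) - K (x, y))
          (volume.restrict A') := hi2.prod_left_ae
      have hslf2 : ∀ᵐ y ∂(ν.restrict B'), y ∈ B' := ae_restrict_mem hB'
      filter_upwards [ae_restrict_of_ae hW, ae_restrict_of_ae hsl, ae_restrict_of_ae hint, hslf,
        hslf2] with y h1 h2 h3 h4 h5
      have hKi : Integrable (fun x => K (x, y)) (volume.restrict A') := by
        refine Measure.integrableOn_of_bounded (M := c * m) hμA'.ne
          (hKm.comp_measurable (by fun_prop)).aestronglyMeasurable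
          ((ae_restrict_iff' hA').2 (ae_of_all _ fun x hx => hKb m (x, y) ⟨hAs hx, hBs h5⟩))
      have hfi : Integrable (fun x => f (x, y)) (volume.restrict A') := by
        exact (h4.add hKi).congr (ae_of_all _ fun x => by simp)
      rw [Pi.zero_apply, integral_sub hfi hKi, sub_eq_zero]
      have e1 : ∫ x, f (x, y) ∂(volume.restrict A') =
          ∫ x, (starRingEnd ℂ ((hp2.toLp _ : Lp ℂ 2 (volume : Measure E)) x)) * f (x, y) := by
        rw [← integral_indicator hA']
        refine integral_congr_ae ?_
        filter_upwards [hp2.coeFn_toLp] with x hx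
        rw [hx]
        by_cases hxA : x ∈ A' <;> simp [hxA]
      have e2 : ∫ x, (starRingEnd ℂ (unitaryFourier E (hp2.toLp _) x)) * g (x, y) =
          ∫ ξ, (c : ℂ) * ∫ x in A', Complex.exp (Complex.I * (inner ℝ x ξ : ℝ)) * G (ξ, y) := by
        refine integral_congr_ae ?_
        filter_upwards [unitaryFourier_coeFn hp1 hp2, h2] with ξ hξ hg
        rw [hξ, hg, map_mul, Complex.conj_ofReal, ← integral_conj, mul_assoc,
          integral_mul_const, ← integral_indicator hA']
        congr 3
        ext x
        by_cases hxA : x ∈ A'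
        · simp [hxA, ← Complex.exp_conj, real_inner_comm]
        · simp [hxA]
      rw [e1, h1, e2, integral_const_mul, hK]
      simp only
      rw [integral_const_mul]
      congr 1
      refine integral_integral_swap ?_
      have h6 : Integrable (fun q : E × E => G (q.1, y)) (volume.prod (volume.restrict A')) := by
        have : IsFiniteMeasure ((volume : Measure E).restrict A') :=
          ⟨by rwa [Measure.restrict_apply_univ]⟩
        exact h3.comp_fst _
      refine h6.bdd_mul (c := 1) (f := fun q : E × E =>
        Complex.exp (Complex.I * (inner ℝ q.2 q.1 : ℝ))) ?_ ?_
      · exact Continuous.aestronglyMeasurable (by fun_prop)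
      · exact ae_of_all _ fun q => (norm_exp_I_mul_ofReal _).le
  filter_upwards [hzero] with p hp
  exact sub_eq_zero.1 hp

end InverseSlices

end

section

open SymMat

variable {n : ℕ} {lam : ℝ}

/-! ### Holomorphy of the Fourier–Laplace transform and its identification with `U⁻¹ S`. -/

section ExpIntegral

variable {E V : Type*} [NormedAddCommGroup E] [NormedSpace ℝ E] [MeasurableSpace E]
  [BorelSpace E] [SecondCountableTopology E] [NormedAddCommGroup V] [NormedSpace ℂ V]

/-- Holomorphy of a superposition of exponentials. -/
theorem differentiableAt_integral_exp {μ : Measure E} {k : E → ℂ}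
    (hk : AEStronglyMeasurable k μ) (L : E →L[ℝ] V →L[ℂ] ℂ) {Z₀ : V} {s : Set V} (hs : s ∈ 𝓝 Z₀)
    {bound : E → ℝ} (hb : Integrable bound μ)
    (hint : Integrable (fun ξ => k ξ * Complex.exp (L ξ Z₀)) μ)
    (h : ∀ᵐ ξ ∂μ, ∀ Z ∈ s, ‖k ξ‖ * ‖Complex.exp (L ξ Z)‖ * ‖ξ‖ ≤ bound ξ) :
    DifferentiableAt ℂ (fun Z => ∫ ξ, k ξ * Complex.exp (L ξ Z) ∂μ) Z₀ := by
  have hm : ∀ Z, AEStronglyMeasurable (fun ξ => k ξ * Complex.exp (L ξ Z)) μ := by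
    intro Z
    refine hk.mul (Continuous.aestronglyMeasurable ?_)
    fun_prop
  have hd := hasFDerivAt_integral_of_dominated_of_fderiv_le (𝕜 := ℂ) (μ := μ)
    (F := fun Z ξ => k ξ * Complex.exp (L ξ Z))
    (F' := fun Z ξ => (k ξ * Complex.exp (L ξ Z)) • L ξ) (x₀ := Z₀)
    (bound := fun ξ => bound ξ * ‖L‖) hs (Eventually.of_forall hm) hint
    ((hm Z₀).smul L.continuous.aestronglyMeasurable) ?_ (hb.mul_const _) ?_
  · exact hd.differentiableAt
  · filter_upwards [h] with ξ hξ Z hZ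
    rw [norm_smul, norm_mul]
    calc ‖k ξ‖ * ‖Complex.exp (L ξ Z)‖ * ‖L ξ‖
        ≤ ‖k ξ‖ * ‖Complex.exp (L ξ Z)‖ * (‖L‖ * ‖ξ‖) := by
          gcongr; exact L.le_opNorm ξ
      _ = ‖k ξ‖ * ‖Complex.exp (L ξ Z)‖ * ‖ξ‖ * ‖L‖ := by ring
      _ ≤ bound ξ * ‖L‖ := by gcongr; exact hξ Z hZ
  · refine ae_of_all _ fun ξ Z _ => ?_
    have := ((L ξ).hasFDerivAt (x := Z)).cexp.const_mul (k ξ)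
    rwa [smul_smul] at this

end ExpIntegral

namespace SymMat

theorem trMulC_eq_sum (ξ : SymMat n ℝ) (Z : SymMat n ℂ) :
    ξ.trMulC Z = ∑ i, ∑ j, (ξ.toMatrix i j : ℂ) * Z.toMatrix j i := by
  simp [trMulC, Matrix.trace, Matrix.mul_apply]

theorem trMulC_ofReIm (ξ X Y : SymMat n ℝ) :
    ξ.trMulC (ofReIm X Y) = (inner ℝ ξ X : ℝ) + Complex.I * (inner ℝ ξ Y : ℝ) := by
  rw [trMulC_eq_sum, inner_eq_trace, inner_eq_trace]
  simp only [Matrix.trace, Matrix.diag, Matrix.mul_apply, toMatrix_ofReIm, mul_add,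
    Finset.sum_add_distrib, Complex.ofReal_sum, Complex.ofReal_mul, Finset.mul_sum]
  congr 1
  exact Finset.sum_congr rfl fun i _ => Finset.sum_congr rfl fun j _ => by ring

theorem trMulC_eq (ξ : SymMat n ℝ) (Z : SymMat n ℂ) :
    ξ.trMulC Z = (inner ℝ ξ Z.re : ℝ) + Complex.I * (inner ℝ ξ Z.im : ℝ) := by
  conv_lhs => rw [← ofReIm_re_im Z, trMulC_ofReIm]

variable (n) in
/-- The pairing `tr (ξ Z)` as a bilinear map. -/
def trPairing : SymMat n ℝ →L[ℝ] SymMat n ℂ →L[ℂ] ℂ :=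
  LinearMap.toContinuousLinearMap
    { toFun := fun ξ => LinearMap.toContinuousLinearMap
        { toFun := fun Z => ξ.trMulC Z
          map_add' := fun Z Z' => by
            simp [trMulC_eq_sum, mul_add, Finset.sum_add_distrib]
          map_smul' := fun c Z => by
            simp [trMulC_eq_sum, Finset.mul_sum, mul_left_comm] }
      map_add' := fun ξ ξ' => by
        ext Z
        simp [trMulC_eq_sum, add_mul, Finset.sum_add_distrib]
      map_smul' := fun c ξ => by
        ext Z
        simp [trMulC_eq_sum, Finset.mul_sum, mul_assoc] }

end SymMat

theorem ae_siegelWeighted_iff {P : SymMat n ℂ → Prop} : (∀ᵐ Z ∂(siegelWeighted n lam), P Z) ↔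
    ∀ᵐ p ∂((volume : Measure (SymMat n ℝ)).prod (coneWeighted n lam)),
      P (reImHomeomorph n p) := by
  rw [← (measurePreserving_reImHomeomorph (n := n) lam).map_eq]
  exact (reImHomeomorph n).measurableEmbedding.ae_map_iff

theorem ae_siegelVolume_iff {P : SymMat n ℂ → Prop} : (∀ᵐ Z ∂(siegelVolume n), P Z) ↔
    ∀ᵐ p ∂((volume : Measure (SymMat n ℝ)).prod (coneVolume n)), P (reImHomeomorph n p) := by
  rw [siegelVolume_eq_map]
  exact (reImHomeomorph n).measurableEmbedding.ae_map_iff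

section FourierLaplace

theorem norm_exp_I_mul_trMulC (ξ : SymMat n ℝ) (Z : SymMat n ℂ) :
    ‖Complex.exp (Complex.I * ξ.trMulC Z)‖ = Real.exp (-inner ℝ ξ Z.im) := by
  rw [Complex.norm_exp, trMulC_eq]
  congr 1
  simp [mul_add, ← mul_assoc]

theorem exp_I_mul_trMulC_ofReIm (ξ X Y : SymMat n ℝ) :
    Complex.exp (Complex.I * ξ.trMulC (ofReIm X Y)) =
      Complex.exp (Complex.I * (inner ℝ X ξ : ℝ)) * (Real.exp (-inner ℝ ξ Y) : ℝ) := by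
  rw [trMulC_ofReIm, Complex.ofReal_exp, ← Complex.exp_add, real_inner_comm]
  congr 1
  push_cast
  rw [mul_add, ← mul_assoc, Complex.I_mul_I]
  ring

/-- Its square is the integrand of the Siegel integral at `2Y` with `s = λ`. By Cauchy–Schwarz the
Laplace integral of any `h ∈ L²(Ω)` then converges absolutely. -/
theorem memLp_detPow_exp (hlam : (n : ℝ) < lam) {Y : SymMat n ℝ} (hY : Y ∈ posCone n) :
    MemLp (fun ξ => ((detPow lam ξ * Real.exp (-inner ℝ ξ Y) : ℝ) : ℂ)) 2 (coneVolume n) := by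
  have hm : Measurable fun ξ : SymMat n ℝ => detPow lam ξ * Real.exp (-inner ℝ ξ Y) :=
    measurable_detPow.mul (Continuous.measurable (by fun_prop))
  have hm' : Measurable fun ξ : SymMat n ℝ =>
      ((detPow lam ξ * Real.exp (-inner ℝ ξ Y) : ℝ) : ℂ) := Complex.measurable_ofReal.comp hm
  rw [memLp_two_iff_lintegral hm'.aestronglyMeasurable]
  refine lt_of_le_of_lt (le_of_eq ?_) (lintegral_det_exp_lt_top hlam
    (smul_mem_posCone two_pos hY))
  refine setLIntegral_congr_fun measurableSet_posCone fun ξ hξ => ?_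
  rw [← ofReal_norm, ← ENNReal.ofReal_pow (norm_nonneg _), Complex.norm_real,
          Real.norm_eq_abs, sq_abs, mul_pow, detPow_sq hξ, ← Real.exp_nat_mul, inner_smul_right]
  congr 3
  push_cast; ring

theorem integrable_laplace (hlam : (n : ℝ) < lam) {h : SymMat n ℝ → ℂ}
    (hh : MemLp h 2 (coneVolume n)) {Y : SymMat n ℝ} (hY : Y ∈ posCone n) :
    Integrable (fun ξ => h ξ * ((detPow lam ξ * Real.exp (-inner ℝ ξ Y) : ℝ) : ℂ))
      (coneVolume n) :=
  hh.integrable_mul (memLp_detPow_exp hlam hY)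

/-- The matrix `Y - δ ξ/‖ξ‖` is still in the cone and so pairs nonnegatively with `ξ`. This gives
`e^(-⟨ξ,Y⟩)` exponential decay in `‖ξ‖`. -/
theorem le_inner_of_ball_subset {Y ξ : SymMat n ℝ} {δ : ℝ} (hδ : 0 < δ)
    (hb : Metric.closedBall Y δ ⊆ posCone n) (hξ : ξ ∈ posCone n) : δ * ‖ξ‖ ≤ inner ℝ ξ Y := by
  by_cases h0 : ξ = 0
  · simp [h0]
  have hn : 0 < ‖ξ‖ := norm_pos_iff.2 h0
  have hm : Y - (δ * ‖ξ‖⁻¹) • ξ ∈ posCone n := hb (by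
    rw [Metric.mem_closedBall, dist_eq_norm, sub_sub_cancel_left, norm_neg, norm_smul,
      Real.norm_of_nonneg (by positivity), mul_assoc, inv_mul_cancel₀ hn.ne', mul_one])
  have := inner_nonneg_of_posSemidef (Matrix.PosDef.posSemidef hξ) (Matrix.PosDef.posSemidef hm)
  rw [inner_sub_right, inner_smul_right, real_inner_self_eq_norm_sq, sub_nonneg] at this
  refine le_trans (le_of_eq ?_) this
  field_simp

/-- Half of `Im Z₀` keeps the integrand integrable. The other half provides decay `e^(-δ‖ξ‖)`: one
factor `e^(-δ‖ξ‖/2)` pays for moving `Im Z` by at most `δ/2`, the other absorbs the factor `‖ξ‖` of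
the derivative through `x e^(-x) ≤ 1`. -/
theorem differentiableOn_fourierLaplace (hlam : (n : ℝ) < lam) {h : SymMat n ℝ → ℂ}
    (hh : MemLp h 2 (coneVolume n)) :
    DifferentiableOn ℂ (fourierLaplace n lam h) (siegelDomain n) := by
  intro Z₀ hZ₀
  refine DifferentiableAt.differentiableWithinAt ?_
  have hZ : Z₀.im ∈ posCone n := hZ₀
  have h2 : (1 / 2 : ℝ) • Z₀.im ∈ posCone n := smul_mem_posCone (by norm_num) hZ
  obtain ⟨δ, hδ, hb⟩ := Metric.nhds_basis_closedBall.mem_iff.1 (isOpen_posCone.mem_nhds h2)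
  set s : Set (SymMat n ℂ) := {Z | ‖Z.im - Z₀.im‖ ≤ δ / 2} with hs
  have hsn : s ∈ 𝓝 Z₀ := by
    have : Continuous fun Z : SymMat n ℂ => ‖Z.im - Z₀.im‖ := by fun_prop
    have h3 : ∀ᶠ Z in 𝓝 Z₀, ‖Z.im - Z₀.im‖ < δ / 2 :=
      this.continuousAt.eventually_lt continuousAt_const (by simpa using hδ)
    filter_upwards [h3] with Z hZ
    exact hZ.le
  have hk : AEStronglyMeasurable (fun ξ => h ξ * (detPow lam ξ : ℂ)) (coneVolume n) :=
    hh.1.mul (Complex.measurable_ofReal.comp measurable_detPow).aestronglyMeasurable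
  have hnorm : ∀ Z ξ, ‖Complex.exp ((Complex.I • trPairing n ξ) Z)‖ =
      Real.exp (-inner ℝ ξ Z.im) := fun Z ξ => norm_exp_I_mul_trMulC ξ Z
  have hint : Integrable (fun ξ => (h ξ * (detPow lam ξ : ℂ)) *
      Complex.exp ((Complex.I • trPairing n ξ) Z₀)) (coneVolume n) := by
    refine (integrable_laplace hlam hh hZ).mono
      (hk.mul (Continuous.aestronglyMeasurable (by fun_prop))) (ae_of_all _ fun ξ => ?_)
    rw [norm_mul, norm_mul, norm_mul, hnorm, Complex.ofReal_mul, norm_mul,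
      Complex.norm_real (Real.exp _), Real.norm_of_nonneg (Real.exp_pos _).le]
    exact le_of_eq (by ring)
  refine DifferentiableAt.const_mul ?_ _
  refine differentiableAt_integral_exp hk (Complex.I • trPairing n) hsn
    (bound := fun ξ => ‖h ξ * ((detPow lam ξ * Real.exp (-inner ℝ ξ ((1 / 2 : ℝ) • Z₀.im)) : ℝ) : ℂ)‖
      * (2 / δ)) ((integrable_laplace hlam hh h2).norm.mul_const _) hint ?_
  filter_upwards [ae_restrict_mem measurableSet_posCone] with ξ hξ Z hZs
  have e1 : (Complex.I • trPairing n) ξ = Complex.I • trPairing n ξ := rfl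
  rw [e1, hnorm, norm_mul, norm_mul, Complex.ofReal_mul, norm_mul,
      Complex.norm_real (Real.exp _), Real.norm_of_nonneg (Real.exp_pos _).le, ← mul_assoc,
      mul_assoc, mul_assoc (_ * _)]
  refine mul_le_mul_of_nonneg_left ?_ (by positivity)
  have hi1 := le_inner_of_ball_subset hδ hb hξ
  have hi2 : -(‖ξ‖ * (δ / 2)) ≤ inner ℝ ξ (Z.im - Z₀.im) := by
    have := abs_le.1 (abs_real_inner_le_norm ξ (Z.im - Z₀.im))
    have h4 : ‖ξ‖ * ‖Z.im - Z₀.im‖ ≤ ‖ξ‖ * (δ / 2) :=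
      mul_le_mul_of_nonneg_left hZs (norm_nonneg _)
    linarith [this.1]
  have hi3 : inner ℝ ξ ((1 / 2 : ℝ) • Z₀.im) + δ / 2 * ‖ξ‖ ≤ inner ℝ ξ Z.im := by
    rw [inner_sub_right] at hi2
    rw [inner_smul_right] at hi1 ⊢
    linarith
  calc Real.exp (-inner ℝ ξ Z.im) * ‖ξ‖
      ≤ Real.exp (-inner ℝ ξ ((1 / 2 : ℝ) • Z₀.im) - δ / 2 * ‖ξ‖) * ‖ξ‖ := by
        gcongr; linarith
    _ = Real.exp (-inner ℝ ξ ((1 / 2 : ℝ) • Z₀.im)) *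
        (Real.exp (-(δ / 2 * ‖ξ‖)) * (δ / 2 * ‖ξ‖)) * (2 / δ) := by
        rw [sub_eq_add_neg, Real.exp_add]; field_simp
    _ ≤ Real.exp (-inner ℝ ξ ((1 / 2 : ℝ) • Z₀.im)) * 1 * (2 / δ) := by
        gcongr
        rw [Real.exp_neg, inv_mul_le_iff₀ (Real.exp_pos _), mul_one]
        linarith [Real.add_one_le_exp (δ / 2 * ‖ξ‖)]
    _ = _ := by rw [mul_one]

/-- `U⁻¹ S h` is the Fourier--Laplace transform of `h`. -/
theorem uOperator_symm_sOperator_coeFn (hlam : (n : ℝ) < lam) (h : L2Cone n) :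
    (uOperator n lam).symm (sOperator hlam h) =ᵐ[siegelWeighted n lam] fourierLaplace n lam h := by
  have hm := (Lp.stronglyMeasurable h).measurable
  have hG : StronglyMeasurable (sFun n lam h) := (measurable_sFun hm).stronglyMeasurable
  have hcone : ∀ᵐ Y ∂(coneWeighted n lam), Y ∈ posCone n :=
    (withDensity_absolutelyContinuous _ _).ae_le (ae_restrict_mem measurableSet_posCone)
  have hsl : ∀ Y : SymMat n ℝ, (fun ξ => sFun n lam h (ξ, Y)) = (posCone n).indicator
      fun ξ => (sConst n lam : ℂ) *
        (h ξ * ((detPow lam ξ * Real.exp (-inner ℝ ξ Y) : ℝ) : ℂ)) := by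
    intro Y
    ext ξ
    by_cases hξ : ξ ∈ posCone n
    · rw [indicator_of_mem hξ, sFun_of_mem hξ]; push_cast; ring
    · rw [indicator_of_notMem hξ, sFun_of_notMem hξ]
  have hint : ∀ᵐ Y ∂(coneWeighted n lam), Integrable fun ξ => sFun n lam h (ξ, Y) := by
    filter_upwards [hcone] with Y hY
    rw [hsl, integrable_indicator_iff measurableSet_posCone]
    exact (integrable_laplace hlam (Lp.memLp h) hY).const_mul _
  have key := symm_coeFn_of_integrable_slices (fourierTensor_tensorL2 (n := n) (lam := lam))
    (sOperator hlam h) hG (isSOperator_sOperator hlam h) hint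
  have hc := coordEquiv_coeFn ((uOperator n lam).symm (sOperator hlam h))
  have e1 : coordEquiv n lam ((uOperator n lam).symm (sOperator hlam h)) =
      (fourierTensor n lam).symm (sOperator hlam h) := by
    change coordEquiv n lam ((coordEquiv n lam).symm ((fourierTensor n lam).symm _)) = _
    rw [LinearIsometryEquiv.apply_symm_apply]
  rw [e1] at hc
  have hfin : ∀ᵐ p ∂((volume : Measure (SymMat n ℝ)).prod (coneWeighted n lam)),
      (uOperator n lam).symm (sOperator hlam h) (reImHomeomorph n p) =
        fourierLaplace n lam h (reImHomeomorph n p) := by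
    filter_upwards [key, hc] with p h1 h2
    have : (uOperator n lam).symm (sOperator hlam h) (reImHomeomorph n p) =
      (uOperator n lam).symm (sOperator hlam h) (ofReIm p.1 p.2) := rfl
    rw [this, ← h2, h1, fourierConst_eq]
    change _ = fourierLaplace n lam h (ofReIm p.1 p.2)
    have e2 : (fun ξ => Complex.exp (Complex.I * (inner ℝ p.1 ξ : ℝ)) * sFun n lam h (ξ, p.2)) =
        (posCone n).indicator fun ξ => (sConst n lam : ℂ) * ((h ξ * (detPow lam ξ : ℂ)) *
          Complex.exp (Complex.I * ξ.trMulC (ofReIm p.1 p.2))) := by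
      ext ξ
      rw [congrFun (hsl p.2) ξ]
      by_cases hξ : ξ ∈ posCone n
      · rw [indicator_of_mem hξ, indicator_of_mem hξ, exp_I_mul_trMulC_ofReIm]; push_cast; ring
      · rw [indicator_of_notMem hξ, indicator_of_notMem hξ, mul_zero]
    rw [e2, integral_indicator measurableSet_posCone, integral_const_mul, ← mul_assoc,
      fourierLaplace, ← Complex.ofReal_mul, sConst]
    congr 2
    have : (2 * Real.pi) ^ ((n : ℝ) * ((n : ℝ) + 1) / 4) ≠ 0 := by positivity
    field_simp
  exact ae_siegelWeighted_iff.2 hfin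

end FourierLaplace

end

section

/-! ### Shifting a contour without decay at infinity. -/

section Contour

variable {E : Type*} [NormedAddCommGroup E] [NormedSpace ℝ E] [MeasurableSpace E] [BorelSpace E]
  [SecondCountableTopology E] {μ : Measure E} [SFinite μ] [μ.IsAddRightInvariant]

theorem measurePreserving_shear (v : E) : MeasurePreserving
    (fun p : ℝ × E => (p.1, p.2 + p.1 • v)) ((volume.restrict (Ioc (0 : ℝ) 1)).prod μ)
      ((volume.restrict (Ioc (0 : ℝ) 1)).prod μ) := by
  refine (MeasurePreserving.id _).skew_product (g := fun (t : ℝ) (X : E) => X + t • v)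
    (by fun_prop) (ae_of_all _ fun t => ?_)
  exact (measurePreserving_add_right μ (t • v)).map_eq

/-- Averaging over the segments from `X` to `X + v` leaves the integral unchanged by translation
invariance. It supplies the horizontal sides of the rectangle in Cauchy's theorem. -/
theorem integral_integral_shear (v : E) {F : E → ℂ} (hF : Integrable F μ) :
    Integrable (fun X => ∫ t in (0 : ℝ)..1, F (X + t • v)) μ ∧
      ∫ X, (∫ t in (0 : ℝ)..1, F (X + t • v)) ∂μ = ∫ X, F X ∂μ := by
  have h1 : Integrable (fun p : ℝ × E => F p.2) ((volume.restrict (Ioc (0 : ℝ) 1)).prod μ) :=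
    hF.comp_snd _
  have h2 : Integrable (fun p : ℝ × E => F (p.2 + p.1 • v))
      ((volume.restrict (Ioc (0 : ℝ) 1)).prod μ) :=
    (measurePreserving_shear v).integrable_comp_of_integrable h1
  simp only [intervalIntegral.integral_of_le zero_le_one]
  refine ⟨h2.integral_prod_right, ?_⟩
  rw [← integral_prod_symm _ h2, integral_prod _ h2]
  simp only [integral_add_right_eq_self F]
  simp

/-- Shift of the contour of integration in the direction `v`. -/
theorem integral_eq_integral_of_contour_shift (v : E) (Ψ : E → ℂ → ℂ)
    (hshift : ∀ X (t : ℝ) ζ, Ψ (X + t • v) ζ = Ψ X (ζ + t))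
    (hdiff : ∀ X, DifferentiableOn ℂ (Ψ X) {ζ | ζ.im ∈ Icc (0 : ℝ) 1})
    (h0 : Integrable (fun X => Ψ X 0) μ) (h1 : Integrable (fun X => Ψ X Complex.I) μ)
    (hs : Integrable (fun p : ℝ × E => Ψ p.2 (p.1 * Complex.I))
      ((volume.restrict (Ioc (0 : ℝ) 1)).prod μ)) :
    ∫ X, Ψ X 0 ∂μ = ∫ X, Ψ X Complex.I ∂μ := by
  obtain ⟨i0, e0⟩ := integral_integral_shear v h0
  obtain ⟨i1, e1⟩ := integral_integral_shear v h1
  set c : E → ℂ := fun X => ∫ s in (0 : ℝ)..1, Ψ X (s * Complex.I) with hc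
  have hci : Integrable c μ := by
    simp only [hc, intervalIntegral.integral_of_le zero_le_one]
    exact hs.integral_prod_right
  -- Cauchy's theorem on the unit square. The vertical sides are `c X` and its translate `c (X +
  -- v)`, which cancel after integration over `X`; integrability of `c` replaces decay.
  have hrect : ∀ X, (∫ t in (0 : ℝ)..1, Ψ (X + t • v) 0) - (∫ t in (0 : ℝ)..1,
      Ψ (X + t • v) Complex.I) = Complex.I * c X - Complex.I * c (X + v) := by
    intro X
    have := Complex.integral_boundary_rect_eq_zero_of_differentiableOn (Ψ X) 0 (1 + Complex.I)
      ((hdiff X).mono fun ζ hζ => by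
        have := hζ.2
        simpa using this)
    simp only [Complex.zero_re, Complex.zero_im, Complex.add_re, Complex.one_re, Complex.I_re,
      Complex.add_im, Complex.one_im, Complex.I_im, add_zero, zero_add, Complex.ofReal_zero,
      zero_mul, Complex.ofReal_one, one_mul, smul_eq_mul] at this
    have hcv : c (X + v) = ∫ s in (0 : ℝ)..1, Ψ X (1 + s * Complex.I) := by
      simp only [hc]
      refine intervalIntegral.integral_congr fun s _ => ?_
      have := hshift X 1 (s * Complex.I)
      rw [one_smul] at this
      rw [this, Complex.ofReal_one, add_comm]
    simp only [hshift, zero_add, add_comm Complex.I]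
    rw [hcv]
    linear_combination this
  rw [← e0, ← e1, ← sub_eq_zero, ← integral_sub i0 i1]
  simp only [hrect]
  rw [integral_sub (hci.const_mul _) ((hci.comp_add_right v).const_mul _), integral_const_mul,
    integral_const_mul, integral_add_right_eq_self, sub_self]

/-- Integrals over segments of a locally integrable function are finite for almost every
starting point. -/
theorem ae_lintegral_segment_lt_top [ProperSpace E] {O : Set E} (hO : IsOpen O) (hconv : Convex ℝ O)
    {N : E → ℝ≥0∞} (hN : Measurable N)
    (hK : ∀ K ⊆ O, IsCompact K → ∫⁻ Y in K, N Y ∂μ < ∞) (v : E) :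
    ∀ᵐ Y ∂μ, Y ∈ O → v + Y ∈ O → ∫⁻ s in Ioc (0 : ℝ) 1, N (Y + s • v) < ∞ := by
  rw [ae_iff]
  refine measure_null_of_locally_null _ fun Y₀ hY₀ => ?_
  simp only [mem_ofPred_eq, Classical.not_imp] at hY₀
  obtain ⟨h1, h2, -⟩ := hY₀
  set σ : Set E := (fun s : ℝ => Y₀ + s • v) '' Icc 0 1 with hσ
  have hσc : IsCompact σ := isCompact_Icc.image (by fun_prop)
  have hσO : σ ⊆ O := by
    rintro _ ⟨s, hs, rfl⟩
    have := hconv h1 h2 (sub_nonneg.2 hs.2) hs.1 (by ring)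
    convert this using 1
    module
  -- Segments starting within `δ` of `Y₀` stay in this compact thickening, so Tonelli bounds the
  -- double integral over starting points and `s` by the integral of `N` over it.
  obtain ⟨δ, hδ, hthick⟩ := hσc.exists_cthickening_subset_open hO hσO
  have hKc : IsCompact (Metric.cthickening δ σ) := hσc.cthickening
  have hfin := hK _ hthick hKc
  have hmem : ∀ Y ∈ Metric.ball Y₀ δ, ∀ s ∈ Ioc (0 : ℝ) 1, Y + s • v ∈ Metric.cthickening δ σ := by
    intro Y hY s hs
    refine Metric.mem_cthickening_of_dist_le _ (Y₀ + s • v) δ σ ⟨s, ⟨hs.1.le, hs.2⟩, rfl⟩ ?_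
    rw [dist_add_right]
    exact (Metric.mem_ball.1 hY).le
  have hNm : Measurable fun p : E × ℝ => N (p.1 + p.2 • v) := hN.comp (by fun_prop)
  have hint : ∫⁻ Y in Metric.ball Y₀ δ, (∫⁻ s in Ioc (0 : ℝ) 1, N (Y + s • v)) ∂μ ≠ ∞ := by
    rw [lintegral_lintegral_swap hNm.aemeasurable]
    have hle : ∀ s ∈ Ioc (0 : ℝ) 1, ∫⁻ Y in Metric.ball Y₀ δ, N (Y + s • v) ∂μ ≤
        ∫⁻ Y in Metric.cthickening δ σ, N Y ∂μ := by
      intro s hs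
      rw [← lintegral_indicator Metric.isClosed_cthickening.measurableSet,
        ← lintegral_indicator measurableSet_ball,
        ← lintegral_add_right_eq_self ((Metric.cthickening δ σ).indicator N) (s • v)]
      refine lintegral_mono fun Y => ?_
      by_cases hY : Y ∈ Metric.ball Y₀ δ
      · rw [indicator_of_mem hY, indicator_of_mem (hmem Y hY s hs)]
      · rw [indicator_of_notMem hY]; exact zero_le
    refine ne_top_of_le_ne_top hfin.ne ((setLIntegral_mono' measurableSet_Ioc hle).trans ?_)
    simp
  have hae := ae_lt_top' hNm.lintegral_prod_right'.aemeasurable hint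
  rw [ae_restrict_iff' measurableSet_ball] at hae
  refine ⟨_ ∩ Metric.ball Y₀ δ, inter_mem self_mem_nhdsWithin
    (mem_nhdsWithin_of_mem_nhds (Metric.ball_mem_nhds Y₀ hδ)), ?_⟩
  refine measure_mono_null ?_ (ae_iff.1 hae)
  rintro Y ⟨hY1, hY2⟩ hY3
  simp only [mem_ofPred_eq, Classical.not_imp] at hY1
  exact hY1.2.2 (hY3 hY2)

end Contour

open SymMat

variable {n : ℕ} {lam : ℝ}

/-! ### Divergence of the Laplace transform of the weight off the closed cone. -/

section Divergence

/-- Self-duality of the cone. If `X` pairs nonnegatively with `y yᵀ + ε 1` for all `ε > 0`, its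
quadratic form is nonnegative, and `X` is the limit of the positive definite `X + ε 1`. -/
theorem exists_inner_neg_of_notMem_closure {X : SymMat n ℝ} (hX : X ∉ closure (posCone n)) :
    ∃ Y ∈ posCone n, inner ℝ X Y < 0 := by
  by_contra! hcon
  refine hX ?_
  have hq : ∀ y : Fin n → ℝ, 0 ≤ y ⬝ᵥ (X.toMatrix.mulVec y) := by
    intro y
    have e : y ⬝ᵥ (X.toMatrix.mulVec y) = inner ℝ X (rankOne y) := by
      rw [inner_eq_trace]
      have : (rankOne y).toMatrix = Matrix.vecMulVec y y := rfl
      rw [this, Matrix.mul_vecMulVec, Matrix.trace_vecMulVec, dotProduct_comm]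
    have hε : ∀ ε > 0, 0 ≤ inner ℝ X (rankOne y) + ε * inner ℝ X (symOne n) := by
      intro ε hε
      have hmem : rankOne y + ε • symOne n ∈ posCone n := by
        refine mem_posCone_iff.2 fun x hx => ?_
        rw [toMatrix_add, toMatrix_smul, Matrix.add_mulVec, dotProduct_add, dotProduct_rankOne,
          Matrix.smul_mulVec, dotProduct_smul]
        have := mem_posCone_iff.1 (symOne_mem (n := n)) x hx
        have := mul_pos hε this
        rw [smul_eq_mul]
        positivity
      have := hcon _ hmem
      rwa [inner_add_right, inner_smul_right] at this
    rw [e]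
    have hlim : Tendsto (fun ε : ℝ => inner ℝ X (rankOne y) + ε * inner ℝ X (symOne n))
        (𝓝[>] 0) (𝓝 (inner ℝ X (rankOne y) + 0 * inner ℝ X (symOne n))) :=
      (Continuous.tendsto (by fun_prop) _).mono_left nhdsWithin_le_nhds
    rw [zero_mul, add_zero] at hlim
    exact ge_of_tendsto hlim (eventually_mem_nhdsWithin.mono fun ε hε' => hε ε hε')
  have hlim : Tendsto (fun ε : ℝ => X + ε • symOne n) (𝓝[>] 0) (𝓝 (X + (0 : ℝ) • symOne n)) :=
    (Continuous.tendsto (by fun_prop) _).mono_left nhdsWithin_le_nhds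
  rw [zero_smul, add_zero] at hlim
  refine mem_closure_of_tendsto hlim (eventually_mem_nhdsWithin.mono fun ε hε => ?_)
  refine mem_posCone_iff.2 fun x hx => ?_
  rw [toMatrix_add, toMatrix_smul, Matrix.add_mulVec, dotProduct_add, Matrix.smul_mulVec,
    dotProduct_smul]
  have h1 := mul_pos (mem_Ioi.1 hε) (mem_posCone_iff.1 (symOne_mem (n := n)) x hx)
  have := hq x
  rw [smul_eq_mul]
  positivity

theorem detWeight_smul {t : ℝ} (ht : 0 < t) {Y : SymMat n ℝ} (hY : Y ∈ posCone n) :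
    detWeight n lam (t • Y) = t ^ ((n : ℝ) * (lam - n - 1)) * detWeight n lam Y := by
  rw [detWeight_eq (smul_mem_posCone ht hY), detWeight_eq hY, det_two_smul,
    Real.mul_rpow (by positivity) (det_pos_of_mem hY).le, ← Real.rpow_natCast,
    ← Real.rpow_mul ht.le]
  ring

/-- The Laplace transform of the weight diverges outside the closed cone. -/
theorem lintegral_exp_coneWeighted_eq_top (hlam : (n : ℝ) < lam) {X : SymMat n ℝ}
    (hX : X ∉ closure (posCone n)) :
    ∫⁻ Y, ENNReal.ofReal (Real.exp (-2 * inner ℝ X Y)) ∂(coneWeighted n lam) = ∞ := by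
  obtain ⟨Y₀, hY₀, hneg⟩ := exists_inner_neg_of_notMem_closure hX
  have hm : Measurable fun Y : SymMat n ℝ => ENNReal.ofReal (Real.exp (-2 * inner ℝ X Y)) := by
    refine (Continuous.measurable ?_).ennreal_ofReal
    fun_prop
  rw [lintegral_coneWeighted hlam hm.aemeasurable]
  suffices h : ∫⁻ Y in posCone n, ENNReal.ofReal (Real.exp (-2 * inner ℝ X Y)) *
      ENNReal.ofReal (detWeight n lam Y) = ∞ by
    rw [h, ENNReal.mul_top]
    simpa using weightConst_pos hlam
  set δ : ℝ := -inner ℝ X Y₀ / 2 with hδ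
  have hδ0 : 0 < δ := by rw [hδ]; linarith
  -- On `t O` the exponential is at least `e^(2δt)`; dilating this piece gives lower bounds for the
  -- whole integral that tend to infinity with `t`.
  set O : Set (SymMat n ℝ) := posCone n ∩ {Y | inner ℝ X Y < -δ} with hO
  have hOo : IsOpen O := isOpen_posCone.inter (isOpen_lt (by fun_prop) continuous_const)
  have hOne : O.Nonempty := ⟨Y₀, hY₀, by simp only [mem_ofPred_eq, hδ]; linarith⟩
  set c₀ : ℝ≥0∞ := ∫⁻ Y in O, ENNReal.ofReal (detWeight n lam Y) with hc₀
  have hc₀pos : c₀ ≠ 0 := by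
    rw [hc₀, Ne, lintegral_eq_zero_iff (measurable_detWeight lam).ennreal_ofReal]
    intro h
    have h1 : ∀ᵐ Y ∂(volume.restrict O), False := by
      filter_upwards [h, ae_restrict_mem hOo.measurableSet] with Y hY1 hY2
      have := detWeight_pos (lam := lam) hY2.1
      simp only [Pi.zero_apply, ENNReal.ofReal_eq_zero] at hY1
      linarith
    have h2 : volume O = 0 := by simpa [ae_iff] using h1
    exact (hOo.measure_pos volume hOne).ne' h2
  set J := ∫⁻ Y in posCone n, ENNReal.ofReal (Real.exp (-2 * inner ℝ X Y)) *
      ENNReal.ofReal (detWeight n lam Y) with hJ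
  -- The Jacobian of the dilation plus the degree of homogeneity of the weight; whatever its sign, a
  -- power loses to the exponential.
  set q : ℝ := (Module.finrank ℝ (SymMat n ℝ) : ℝ) + (n : ℝ) * (lam - n - 1) with hq
  have hbound : ∀ t > 0, ENNReal.ofReal (Real.exp (2 * δ * t) / t ^ (-q)) * c₀ ≤ J := by
    intro t ht
    have hsc := lintegral_comp_smul ((posCone n).indicator fun Y =>
      ENNReal.ofReal (Real.exp (-2 * inner ℝ X Y)) * ENNReal.ofReal (detWeight n lam Y)) ht.ne'
    rw [lintegral_indicator measurableSet_posCone, ← hJ] at hsc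
    have hlow : ENNReal.ofReal (Real.exp (2 * δ * t) * t ^ ((n : ℝ) * (lam - n - 1))) * c₀ ≤
        ∫⁻ Y, (posCone n).indicator (fun Y => ENNReal.ofReal (Real.exp (-2 * inner ℝ X Y)) *
          ENNReal.ofReal (detWeight n lam Y)) (t • Y) := by
      rw [hc₀, ← lintegral_const_mul' _ _ ENNReal.ofReal_ne_top,
        ← lintegral_indicator hOo.measurableSet]
      refine lintegral_mono fun Y => ?_
      by_cases hY : Y ∈ O
      · rw [indicator_of_mem hY, indicator_of_mem (smul_mem_posCone ht hY.1),
          detWeight_smul ht hY.1, ENNReal.ofReal_mul (by positivity),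
          ENNReal.ofReal_mul (by positivity), mul_assoc]
        have h3 : inner ℝ X Y < -δ := hY.2
        have h4 : 2 * δ * t ≤ -2 * inner ℝ X (t • Y) := by
          rw [inner_smul_right]
          nlinarith
        exact mul_le_mul_left (ENNReal.ofReal_le_ofReal (Real.exp_le_exp.2 h4)) _
      · rw [indicator_of_notMem hY]; exact zero_le
    rw [hsc] at hlow
    have hpos : 0 < t ^ Module.finrank ℝ (SymMat n ℝ) := by positivity
    have e : Real.exp (2 * δ * t) / t ^ (-q) = t ^ Module.finrank ℝ (SymMat n ℝ) *
        (Real.exp (2 * δ * t) * t ^ ((n : ℝ) * (lam - n - 1))) := by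
      rw [Real.rpow_neg ht.le, div_inv_eq_mul, hq, Real.rpow_add ht, Real.rpow_natCast]
      ring
    rw [e, ENNReal.ofReal_mul hpos.le, mul_assoc]
    calc _ ≤ ENNReal.ofReal (t ^ Module.finrank ℝ (SymMat n ℝ)) *
          (ENNReal.ofReal |(t ^ Module.finrank ℝ (SymMat n ℝ))⁻¹| * J) := by gcongr
      _ = J := by
        rw [← mul_assoc, ← ENNReal.ofReal_mul hpos.le, abs_of_pos (inv_pos.2 hpos),
          mul_inv_cancel₀ hpos.ne', ENNReal.ofReal_one, one_mul]
  have hlim : Tendsto (fun t : ℝ => ENNReal.ofReal (Real.exp (2 * δ * t) / t ^ (-q)) * c₀) atTop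
      (𝓝 (∞ * c₀)) := by
    refine ENNReal.Tendsto.mul_const ?_ (Or.inl ENNReal.top_ne_zero)
    exact ENNReal.tendsto_ofReal_atTop.comp
      (tendsto_exp_mul_div_rpow_atTop (-q) (2 * δ) (by positivity))
  rw [ENNReal.top_mul hc₀pos] at hlim
  exact top_le_iff.1 (le_of_tendsto hlim ((eventually_gt_atTop 0).mono hbound))

end Divergence

end

section

/-! ### Comparing two functions slice by slice. -/

section Slices

variable {α β : Type*} [MeasurableSpace α] [MeasurableSpace β] {μ : Measure α} {ν : Measure β}
  [SFinite μ] [SigmaFinite ν]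

/-- Two functions with the same slicewise integrals over enough sets are equal. -/
theorem ae_eq_of_forall_ae_setIntegral_eq {G₁ G₂ : α × β → ℂ} (hG₁ : StronglyMeasurable G₁)
    (hG₂ : StronglyMeasurable G₂) (A : ℕ → Set α) (hA : ∀ m, MeasurableSet (A m))
    (hμA : ∀ m, μ (A m) < ∞) (hAu : ⋃ m, A m = univ)
    (h₁ : ∀ m, ∀ᵐ y ∂ν, ∫⁻ x in A m, ‖G₁ (x, y)‖ₑ ∂μ < ∞)
    (h₂ : ∀ m, ∀ᵐ y ∂ν, ∫⁻ x in A m, ‖G₂ (x, y)‖ₑ ∂μ < ∞)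
    (h : ∀ m A', MeasurableSet A' → A' ⊆ A m →
      ∀ᵐ y ∂ν, ∫ x in A', G₁ (x, y) ∂μ = ∫ x in A', G₂ (x, y) ∂μ) :
    G₁ =ᵐ[μ.prod ν] G₂ := by
  let N₁ : ℕ → β → ℝ≥0∞ := fun m y => ∫⁻ x in A m, ‖G₁ (x, y)‖ₑ ∂μ
  let N₂ : ℕ → β → ℝ≥0∞ := fun m y => ∫⁻ x in A m, ‖G₂ (x, y)‖ₑ ∂μ
  have hN₁ : ∀ m, Measurable (N₁ m) := fun m => hG₁.measurable.enorm.lintegral_prod_left'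
  have hN₂ : ∀ m, Measurable (N₂ m) := fun m => hG₂.measurable.enorm.lintegral_prod_left'
  -- Bounding both slice norms by `k` makes `G₁` and `G₂` integrable over rectangles. The pairs `(m,
  -- k)` are enumerated by `Nat.unpair` below.
  let B : ℕ → ℕ → Set β := fun m k => (N₁ m ⁻¹' Iic (k : ℝ≥0∞) ∩ N₂ m ⁻¹' Iic (k : ℝ≥0∞)) ∩
    spanningSets ν k
  have hB : ∀ m k, MeasurableSet (B m k) := fun m k =>
    ((hN₁ m measurableSet_Iic).inter (hN₂ m measurableSet_Iic)).inter
      (measurableSet_spanningSets ν k)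
  have hνB : ∀ m k, ν (B m k) < ∞ := fun m k =>
    (measure_mono inter_subset_right).trans_lt (measure_spanningSets_lt_top ν k)
  have hint : ∀ (G : α × β → ℂ), StronglyMeasurable G → ∀ m k,
      (∀ y ∈ B m k, ∫⁻ x in A m, ‖G (x, y)‖ₑ ∂μ ≤ k) →
      IntegrableOn G (A m ×ˢ B m k) (μ.prod ν) := by
    intro G hG m k hle
    refine ⟨hG.aestronglyMeasurable, ?_⟩
    rw [HasFiniteIntegral, ← Measure.prod_restrict,
      lintegral_prod_symm _ hG.measurable.enorm.aemeasurable]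
    refine (setLIntegral_mono' (hB m k) hle).trans_lt ?_
    rw [setLIntegral_const]
    exact ENNReal.mul_lt_top (ENNReal.natCast_lt_top k) (hνB m k)
  have hint₁ : ∀ m k, IntegrableOn G₁ (A m ×ˢ B m k) (μ.prod ν) := fun m k =>
    hint G₁ hG₁ m k fun y hy => hy.1.1
  have hint₂ : ∀ m k, IntegrableOn G₂ (A m ×ˢ B m k) (μ.prod ν) := fun m k =>
    hint G₂ hG₂ m k fun y hy => hy.1.2
  have hzero : (fun p => G₁ p - G₂ p) =ᵐ[μ.prod ν] 0 := by
    refine ae_eq_zero_of_setIntegral_prod_eq_zero_of_cover (fun j => A j.unpair.1)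
      (fun j => B j.unpair.1 j.unpair.2) (fun j => hA _) (fun j => hB _ _) (fun j => hμA _)
      (fun j => hνB _ _) ?_ (fun j => (hint₁ _ _).sub (hint₂ _ _)) ?_
    · have e₁ := (Measure.quasiMeasurePreserving_snd (μ := μ) (ν := ν)).ae (ae_all_iff.2 h₁)
      have e₂ := (Measure.quasiMeasurePreserving_snd (μ := μ) (ν := ν)).ae (ae_all_iff.2 h₂)
      filter_upwards [e₁, e₂] with p hp₁ hp₂
      obtain ⟨m, hm⟩ := mem_iUnion.1 (hAu ▸ mem_univ p.1)
      obtain ⟨k₁, hk₁⟩ := ENNReal.exists_nat_gt (hp₁ m).ne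
      obtain ⟨k₂, hk₂⟩ := ENNReal.exists_nat_gt (hp₂ m).ne
      set k₃ := spanningSetsIndex ν p.2
      set k := max k₁ (max k₂ k₃)
      refine ⟨Nat.pair m k, ?_⟩
      simp only [Nat.unpair_pair]
      refine ⟨hm, ⟨?_, ?_⟩, ?_⟩
      · exact hk₁.le.trans (by exact_mod_cast le_max_left _ _)
      · exact hk₂.le.trans (by exact_mod_cast (le_max_left _ _).trans (le_max_right _ _))
      · exact monotone_spanningSets ν ((le_max_right k₂ k₃).trans (le_max_right _ _))
          (mem_spanningSetsIndex ν p.2)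
    · intro j A' B' hA' hB' hAA hBB
      have i₁ := (hint₁ _ _).mono_set (prod_mono hAA hBB)
      have i₂ := (hint₂ _ _).mono_set (prod_mono hAA hBB)
      rw [integral_sub i₁ i₂, sub_eq_zero]
      rw [IntegrableOn, ← Measure.prod_restrict] at i₁ i₂
      rw [← Measure.prod_restrict, integral_prod_symm _ i₁, integral_prod_symm _ i₂]
      exact integral_congr_ae (ae_restrict_of_ae (h _ A' hA' hAA))
  filter_upwards [hzero] with p hp
  exact sub_eq_zero.1 hp

end Slices

open SymMat

variable {n : ℕ} {lam : ℝ}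

/-! ### Entire band-limited test functions. -/

section BandLimited

variable {A : Set (SymMat n ℝ)}

/-- The entire function with spectrum in `A`. -/
def bandKernel (A : Set (SymMat n ℝ)) (Z : SymMat n ℂ) : ℂ :=
  ((1 / (2 * Real.pi) ^ ((Module.finrank ℝ (SymMat n ℝ) : ℝ) / 2) : ℝ) : ℂ) *
    ∫ ξ in A, Complex.exp (-Complex.I * ξ.trMulC Z)

theorem norm_exp_neg_I_mul_trMulC (ξ : SymMat n ℝ) (Z : SymMat n ℂ) :
    ‖Complex.exp (-Complex.I * ξ.trMulC Z)‖ = Real.exp (inner ℝ ξ Z.im) := by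
  rw [neg_mul, Complex.exp_neg, norm_inv, norm_exp_I_mul_trMulC, Real.exp_neg, inv_inv]

theorem volume_lt_top_of_subset_closedBall {R : ℝ} (hA : A ⊆ Metric.closedBall 0 R) :
    volume A < ∞ := (measure_mono hA).trans_lt measure_closedBall_lt_top

theorem differentiable_bandKernel (hAm : MeasurableSet A) {R : ℝ}
    (hA : A ⊆ Metric.closedBall 0 R) : Differentiable ℂ (bandKernel A) := by
  intro Z₀
  have : IsFiniteMeasure (volume.restrict A) :=
    ⟨by simpa using volume_lt_top_of_subset_closedBall hA⟩
  have hnorm : ∀ Z ξ, ‖Complex.exp ((-Complex.I • trPairing n ξ) Z)‖ =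
      Real.exp (inner ℝ ξ Z.im) := fun Z ξ => norm_exp_neg_I_mul_trMulC ξ Z
  have hle : ∀ (Z : SymMat n ℂ) (ξ : SymMat n ℝ) (ρ : ℝ), ‖Z.im‖ ≤ ρ → ξ ∈ A →
      inner ℝ ξ Z.im ≤ |R| * ρ := by
    intro Z ξ ρ hZ hξ
    have h1 : ‖ξ‖ ≤ |R| := (mem_closedBall_zero_iff.1 (hA hξ)).trans (le_abs_self R)
    exact (real_inner_le_norm _ _).trans (mul_le_mul h1 hZ (norm_nonneg _) (abs_nonneg R))
  have hs : {Z : SymMat n ℂ | ‖Z.im‖ < ‖Z₀.im‖ + 1} ∈ 𝓝 Z₀ :=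
    (isOpen_lt (by fun_prop) continuous_const).mem_nhds (by simp)
  have key := differentiableAt_integral_exp (μ := volume.restrict A) (k := fun _ => 1)
    aestronglyMeasurable_const (-Complex.I • trPairing n) hs
    (bound := fun _ => Real.exp (|R| * (‖Z₀.im‖ + 1)) * |R|) (integrable_const _) ?_ ?_
  · simp only [one_mul] at key
    exact key.const_mul _
  · simp only [one_mul]
    refine Integrable.of_bound (C := Real.exp (|R| * ‖Z₀.im‖))
      (Continuous.aestronglyMeasurable (by fun_prop)) ?_
    filter_upwards [ae_restrict_mem hAm] with ξ hξ
    exact (hnorm _ _).trans_le (Real.exp_le_exp.2 (hle _ _ _ le_rfl hξ))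
  · filter_upwards [ae_restrict_mem hAm] with ξ hξ Z hZ
    rw [norm_one, one_mul]
    have e1 : (-Complex.I • trPairing n) ξ = -Complex.I • trPairing n ξ := rfl
    rw [e1, hnorm]
    exact mul_le_mul (Real.exp_le_exp.2 (hle _ _ _ (le_of_lt hZ) hξ))
      ((mem_closedBall_zero_iff.1 (hA hξ)).trans (le_abs_self R)) (norm_nonneg _)
      (Real.exp_pos _).le

/-- The function `ξ ↦ χ_A(ξ) e^⟨ξ, Y⟩`. -/
def expIndicator (A : Set (SymMat n ℝ)) (Y ξ : SymMat n ℝ) : ℂ :=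
  A.indicator (fun ξ => ((Real.exp (inner ℝ ξ Y) : ℝ) : ℂ)) ξ

theorem measurable_expIndicator (hAm : MeasurableSet A) (Y : SymMat n ℝ) :
    Measurable (expIndicator A Y) :=
  Measurable.indicator (Continuous.measurable (by fun_prop)) hAm

theorem norm_expIndicator_le {R : ℝ} (hA : A ⊆ Metric.closedBall 0 R) (Y ξ : SymMat n ℝ) :
    ‖expIndicator A Y ξ‖ ≤ A.indicator (fun _ => Real.exp (|R| * ‖Y‖)) ξ := by
  by_cases hξ : ξ ∉ A
  · simp [expIndicator, hξ]
  rw [not_not] at hξ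
  rw [expIndicator, indicator_of_mem hξ]
  rw [indicator_of_mem hξ, Complex.norm_real, Real.norm_of_nonneg (Real.exp_pos _).le]
  have h1 : ‖ξ‖ ≤ |R| := (mem_closedBall_zero_iff.1 (hA hξ)).trans (le_abs_self R)
  exact Real.exp_le_exp.2 ((real_inner_le_norm _ _).trans (by gcongr))

theorem integrable_expIndicator (hAm : MeasurableSet A) {R : ℝ}
    (hA : A ⊆ Metric.closedBall 0 R) (Y : SymMat n ℝ) : Integrable (expIndicator A Y) :=
  (integrable_indicator_iff hAm |>.2 (integrableOn_const
    (volume_lt_top_of_subset_closedBall hA).ne)).mono'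
    (measurable_expIndicator hAm Y).aestronglyMeasurable (ae_of_all _ (norm_expIndicator_le hA Y))

theorem lintegral_expIndicator_le (hAm : MeasurableSet A) {R : ℝ}
    (hA : A ⊆ Metric.closedBall 0 R) (Y : SymMat n ℝ) :
    ∫⁻ ξ, ‖expIndicator A Y ξ‖ₑ ^ 2 ≤ ENNReal.ofReal (Real.exp (|R| * ‖Y‖)) ^ 2 * volume A := by
  rw [← setLIntegral_const, ← lintegral_indicator hAm]
  refine lintegral_mono fun ξ => ?_
  have := norm_expIndicator_le hA Y ξ
  by_cases hξ : ξ ∈ A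
  · rw [indicator_of_mem hξ] at this ⊢
    rw [← ofReal_norm]
    gcongr
  · simp [expIndicator, hξ]

theorem memLp_expIndicator (hAm : MeasurableSet A) {R : ℝ}
    (hA : A ⊆ Metric.closedBall 0 R) (Y : SymMat n ℝ) : MemLp (expIndicator A Y) 2 := by
  rw [memLp_two_iff_lintegral (measurable_expIndicator hAm Y).aestronglyMeasurable]
  exact (lintegral_expIndicator_le hAm hA Y).trans_lt (ENNReal.mul_lt_top
    (ENNReal.pow_lt_top ENNReal.ofReal_lt_top) (volume_lt_top_of_subset_closedBall hA))

/-- The conjugate is what makes the bilinear integral of `bandKernel A` against a slice an `L²`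
inner product, so Parseval applies while the kernel itself stays holomorphic. -/
theorem bandKernel_ofReIm_ae_eq (hAm : MeasurableSet A) {R : ℝ}
    (hA : A ⊆ Metric.closedBall 0 R) (Y : SymMat n ℝ) :
    (fun X => bandKernel A (ofReIm X Y)) =ᵐ[volume] fun X => starRingEnd ℂ
      ((unitaryFourier (SymMat n ℝ)).symm ((memLp_expIndicator hAm hA Y).toLp _) X) := by
  filter_upwards [unitaryFourier_symm_coeFn (integrable_expIndicator hAm hA Y)
    (memLp_expIndicator hAm hA Y)] with X hX
  rw [hX, map_mul, Complex.conj_ofReal, bandKernel, ← integral_conj, ← integral_indicator hAm]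
  congr 1
  refine integral_congr_ae (ae_of_all _ fun ξ => ?_)
  by_cases hξ : ξ ∈ A
  · simp only [expIndicator, indicator_of_mem hξ, map_mul, Complex.conj_ofReal, ← Complex.exp_conj,
      Complex.conj_I]
    rw [Complex.ofReal_exp, ← Complex.exp_add, trMulC_ofReIm, real_inner_comm]
    congr 1
    linear_combination (-(inner ℝ ξ Y : ℝ) : ℂ) * Complex.I_mul_I
  · simp [expIndicator, indicator_of_notMem hξ]

/-- Plancherel on the slice. The bound is uniform for bounded `Y`, as the contour shift requires. -/
theorem lintegral_bandKernel_le (hAm : MeasurableSet A) {R : ℝ}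
    (hA : A ⊆ Metric.closedBall 0 R) (Y : SymMat n ℝ) :
    ∫⁻ X, ‖bandKernel A (ofReIm X Y)‖ₑ ^ 2 ≤
      ENNReal.ofReal (Real.exp (|R| * ‖Y‖)) ^ 2 * volume A := by
  refine le_trans (le_of_eq ?_) (lintegral_expIndicator_le hAm hA Y)
  set q := (memLp_expIndicator hAm hA Y).toLp _ with hq
  have h1 : ∫⁻ X, ‖bandKernel A (ofReIm X Y)‖ₑ ^ 2 =
      ∫⁻ X, ‖(unitaryFourier (SymMat n ℝ)).symm q X‖ₑ ^ 2 := by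
    refine lintegral_congr_ae ((bandKernel_ofReIm_ae_eq hAm hA Y).mono fun X hX => ?_)
    simp only [hX]
    rw [RCLike.enorm_conj]
  have h2 : ∫⁻ ξ, ‖expIndicator A Y ξ‖ₑ ^ 2 = ∫⁻ ξ, ‖q ξ‖ₑ ^ 2 :=
    lintegral_congr_ae ((memLp_expIndicator hAm hA Y).coeFn_toLp.mono fun ξ hξ => by
      simp only [hq, hξ])
  rw [h1, h2, ← lintegral_enorm_sq_eq, ← lintegral_enorm_sq_eq, ← Lp.enorm_def, ← Lp.enorm_def]
  congr 1
  exact (unitaryFourier (SymMat n ℝ)).symm.enorm_map q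

end BandLimited

end

section

/-! ### The contour shift for slices of a Bergman function. -/

open SymMat

variable {n : ℕ} {lam : ℝ}

theorem ae_ae_snd_of_ae_prod {α β : Type*} [MeasurableSpace α] [MeasurableSpace β] {μ : Measure α}
    {ν : Measure β} [SFinite μ] [SFinite ν] {P : α × β → Prop} (h : ∀ᵐ p ∂(μ.prod ν), P p) :
    ∀ᵐ y ∂ν, ∀ᵐ x ∂μ, P (x, y) :=
  Measure.ae_ae_of_ae_prod
    ((Measure.measurePreserving_swap (μ := ν) (ν := μ)).quasiMeasurePreserving.ae h)

theorem ofReIm_add_smul (X Y v : SymMat n ℝ) (ζ : ℂ) :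
    ofReIm X Y + ζ • ofReIm v 0 = ofReIm (X + ζ.re • v) (Y + ζ.im • v) := by
  ext i j
  simp only [toMatrix_add, toMatrix_smul, toMatrix_ofReIm, Matrix.add_apply, Matrix.smul_apply,
    toMatrix_zero, Matrix.zero_apply, smul_eq_mul, Complex.ofReal_zero, mul_zero, add_zero,
    Complex.ofReal_add, Complex.ofReal_mul]
  conv_lhs => rw [← Complex.re_add_im ζ]
  ring

/-- The density is strictly positive on the cone. Passing to Lebesgue measure allows null sets to be
translated in `Y`. -/
theorem ae_coneWeighted_iff (hlam : (n : ℝ) < lam) {P : SymMat n ℝ → Prop} :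
    (∀ᵐ Y ∂(coneWeighted n lam), P Y) ↔ ∀ᵐ Y, Y ∈ posCone n → P Y := by
  rw [coneWeighted, ae_withDensity_iff
    ((measurable_detWeight lam).const_mul (weightConst n lam)).ennreal_ofReal, coneVolume,
    ae_restrict_iff' measurableSet_posCone]
  refine eventually_congr (ae_of_all _ fun Y => ?_)
  refine imp_congr_right fun hY => ?_
  have : ENNReal.ofReal (weightConst n lam * detWeight n lam Y) ≠ 0 := by
    simpa using mul_pos (weightConst_pos hlam) (detWeight_pos hY)
  simp [this]

section SliceNorm

/-- The squared norm of a slice. -/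
def sliceNorm (g : SymMat n ℂ → ℂ) (Y : SymMat n ℝ) : ℝ≥0∞ := ∫⁻ X, ‖g (ofReIm X Y)‖ₑ ^ 2

theorem measurable_sliceNorm {g : SymMat n ℂ → ℂ} (hg : Measurable g) : Measurable (sliceNorm g) :=
  Measurable.lintegral_prod_left'
    (f := fun p : SymMat n ℝ × SymMat n ℝ => ‖g (ofReIm p.1 p.2)‖ₑ ^ 2)
    ((hg.comp continuous_ofReIm.measurable).enorm.pow_const 2)

theorem lintegral_sliceNorm {g : SymMat n ℂ → ℂ} (hg : Measurable g) :
    ∫⁻ Y, sliceNorm g Y ∂(coneWeighted n lam) = ∫⁻ Z, ‖g Z‖ₑ ^ 2 ∂(siegelWeighted n lam) := by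
  rw [← (measurePreserving_reImHomeomorph lam).lintegral_comp (hg.enorm.pow_const 2)]
  change _ = ∫⁻ p : SymMat n ℝ × SymMat n ℝ, ‖(g ∘ fun p => ofReIm p.1 p.2) p‖ₑ ^ 2 ∂_
  rw [lintegral_prod_symm _ ((hg.comp continuous_ofReIm.measurable).enorm.pow_const 2).aemeasurable]
  rfl

/-- The weight is continuous and positive on `K`, hence bounded below there. -/
theorem lintegral_compact_lt_top (hlam : (n : ℝ) < lam) {N : SymMat n ℝ → ℝ≥0∞}
    (hN : Measurable N) (hfin : ∫⁻ Y, N Y ∂(coneWeighted n lam) < ∞) {K : Set (SymMat n ℝ)}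
    (hK : K ⊆ posCone n) (hKc : IsCompact K) : ∫⁻ Y in K, N Y < ∞ := by
  have hcont : ContinuousOn (detWeight n lam) K := fun Y hY => by
    have h2 : Continuous fun Y : SymMat n ℝ => ((2 : ℝ) • Y).det := by fun_prop
    exact (h2.continuousAt.rpow_const
      (Or.inl (det_pos_of_mem (smul_mem_posCone two_pos (hK hY))).ne')).continuousWithinAt
  obtain rfl | hne := K.eq_empty_or_nonempty
  · simp
  obtain ⟨Y₀, hY₀, hmin⟩ := hKc.exists_isMinOn hne hcont
  have hc := detWeight_pos (lam := lam) (hK hY₀)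
  set c := detWeight n lam Y₀
  rw [lintegral_coneWeighted hlam hN.aemeasurable] at hfin
  have h1 : ∫⁻ Y in posCone n, N Y * ENNReal.ofReal (detWeight n lam Y) < ∞ := by
    refine ENNReal.lt_top_of_mul_ne_top_right hfin.ne ?_
    simpa using weightConst_pos hlam
  have h2 : (∫⁻ Y in K, N Y) * ENNReal.ofReal c < ∞ := by
    rw [← lintegral_mul_const _ hN]
    refine lt_of_le_of_lt ?_ h1
    refine (setLIntegral_mono' hKc.isClosed.measurableSet fun Y hY => ?_).trans
      (lintegral_mono_set hK)
    exact mul_le_mul_right (ENNReal.ofReal_le_ofReal (hmin hY)) _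
  exact ENNReal.lt_top_of_mul_ne_top_left h2.ne (by simpa using hc)

end SliceNorm

section ContourShift

variable {A : Set (SymMat n ℝ)} {g : SymMat n ℂ → ℂ}

theorem measurable_indicator_siegelDomain (hg : DifferentiableOn ℂ g (siegelDomain n)) :
    Measurable ((siegelDomain n).indicator g) := by
  classical
  rw [← piecewise_eq_indicator]
  exact hg.continuousOn.measurable_piecewise continuousOn_const isOpen_siegelDomain.measurableSet

/-- Both factors are holomorphic along the complex line `ζ ↦ X + iY + ζ v`, and both are square
integrable on the slices involved, so Cauchy–Schwarz supplies every integrability condition of the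
contour shift. Convexity of the cone keeps the strip inside the domain. -/
theorem integral_bandKernel_shift (hAm : MeasurableSet A) {R : ℝ} (hA : A ⊆ Metric.closedBall 0 R)
    (hg : DifferentiableOn ℂ g (siegelDomain n)) {g₀ : SymMat n ℂ → ℂ} (hg₀ : Measurable g₀)
    (hgg : EqOn g₀ g (siegelDomain n)) {v Y : SymMat n ℝ}
    (hY : Y ∈ posCone n) (hvY : v + Y ∈ posCone n)
    (h0 : sliceNorm g₀ Y < ∞) (h1 : sliceNorm g₀ (v + Y) < ∞)
    (hs : ∫⁻ s in Ioc (0 : ℝ) 1, sliceNorm g₀ (Y + s • v) < ∞) :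
    ∫ X, bandKernel A (ofReIm X 0) * g₀ (ofReIm X Y) =
      ∫ X, bandKernel A (ofReIm X v) * g₀ (ofReIm X (v + Y)) := by
  have hd := differentiable_bandKernel hAm hA
  have hbm : Measurable (bandKernel A) := hd.continuous.measurable
  have hcone : ∀ s ∈ Icc (0 : ℝ) 1, Y + s • v ∈ posCone n := by
    intro s hs
    have := convex_posCone hY hvY (sub_nonneg.2 hs.2) hs.1 (by ring)
    convert this using 1
    module
  have hm1 : ∀ Y' : SymMat n ℝ, Measurable fun X : SymMat n ℝ => ofReIm X Y' := fun Y' =>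
    (continuous_ofReIm.comp (continuous_id.prodMk continuous_const)).measurable
  have hmem1 : ∀ Y', MemLp (fun X => bandKernel A (ofReIm X Y')) 2 := fun Y' => by
    refine (memLp_two_iff_lintegral (hbm.comp (hm1 Y')).aestronglyMeasurable).2 ?_
    exact (lintegral_bandKernel_le hAm hA Y').trans_lt (ENNReal.mul_lt_top
      (ENNReal.pow_lt_top ENNReal.ofReal_lt_top) (volume_lt_top_of_subset_closedBall hA))
  have hmem2 : ∀ Y', sliceNorm g₀ Y' < ∞ → MemLp (fun X => g₀ (ofReIm X Y')) 2 := fun Y' h =>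
    (memLp_two_iff_lintegral (hg₀.comp (hm1 Y')).aestronglyMeasurable).2 h
  have key := integral_eq_integral_of_contour_shift (μ := volume) v
    (fun X ζ => bandKernel A (ofReIm X 0 + ζ • ofReIm v 0) * g₀ (ofReIm X Y + ζ • ofReIm v 0))
    ?_ ?_ ?_ ?_ ?_
  · simp only [ofReIm_add_smul, zero_smul, add_zero,
      Complex.I_re, Complex.I_im, one_smul, zero_add, add_comm Y v] at key
    exact key
  · intro X t ζ
    have : ∀ Y', ofReIm (X + t • v) Y' = ofReIm X Y' + (t : ℂ) • ofReIm v 0 := fun Y' => by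
      rw [ofReIm_add_smul, Complex.ofReal_re, Complex.ofReal_im, zero_smul, add_zero]
    simp only [this, add_smul]
    congr 2 <;> abel
  · intro X
    refine DifferentiableOn.mul ?_ ?_
    · refine (hd.comp ?_).differentiableOn
      fun_prop
    · have hmaps : MapsTo (fun ζ : ℂ => ofReIm X Y + ζ • ofReIm v 0)
          {ζ | ζ.im ∈ Icc (0 : ℝ) 1} (siegelDomain n) := by
        intro ζ hζ
        change (ofReIm X Y + ζ • ofReIm v 0).im ∈ posCone n
        rw [ofReIm_add_smul, im_ofReIm]
        exact hcone _ hζ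
      refine DifferentiableOn.congr (f := fun ζ : ℂ => g (ofReIm X Y + ζ • ofReIm v 0)) ?_
        fun ζ hζ => hgg (hmaps hζ)
      exact hg.comp (Differentiable.differentiableOn (by fun_prop)) hmaps
  · simp only [zero_smul, add_zero]
    exact (hmem1 0).integrable_mul (hmem2 Y h0)
  · simp only [ofReIm_add_smul, Complex.I_re, Complex.I_im, zero_smul, one_smul, add_zero,
      zero_add, add_comm Y v]
    exact (hmem1 v).integrable_mul (hmem2 _ h1)
  · simp only [ofReIm_add_smul, Complex.mul_re, Complex.mul_im, Complex.ofReal_re,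
      Complex.ofReal_im, Complex.I_re, Complex.I_im, mul_zero, sub_self, mul_one,
      add_zero, zero_smul, zero_add]
    have hq : ∀ Y' : SymMat n ℝ, Measurable fun p : ℝ × SymMat n ℝ =>
        ofReIm p.2 (Y' + p.1 • v) := fun Y' => by
      have : Continuous fun p : ℝ × SymMat n ℝ => (p.2, Y' + p.1 • v) := by fun_prop
      exact (continuous_ofReIm.comp this).measurable
    have hq0 := hq 0
    simp only [zero_add] at hq0
    have hb : Measurable fun p : ℝ × SymMat n ℝ => bandKernel A (ofReIm p.2 (p.1 • v)) :=
      hbm.comp hq0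
    have hb' : Measurable fun p : ℝ × SymMat n ℝ => g₀ (ofReIm p.2 (Y + p.1 • v)) :=
      hg₀.comp (hq Y)
    refine MemLp.integrable_mul (p := 2) (q := 2) ?_ ?_
    · rw [memLp_two_iff_lintegral hb.aestronglyMeasurable,
        lintegral_prod _ (hb.enorm.pow_const 2).aemeasurable]
      refine lt_of_le_of_lt (setLIntegral_mono' (g := fun _ =>
        ENNReal.ofReal (Real.exp (|R| * ‖v‖)) ^ 2 * volume A) measurableSet_Ioc
        fun s hs => ?_) ?_
      · refine (lintegral_bandKernel_le hAm hA (s • v)).trans ?_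
        have : ‖s • v‖ ≤ ‖v‖ := by
          rw [norm_smul, Real.norm_of_nonneg hs.1.le]
          exact mul_le_of_le_one_left (norm_nonneg _) hs.2
        gcongr
      · rw [setLIntegral_const]
        exact ENNReal.mul_lt_top (ENNReal.mul_lt_top
          (ENNReal.pow_lt_top ENNReal.ofReal_lt_top) (volume_lt_top_of_subset_closedBall hA))
          measure_Ioc_lt_top
    · rw [memLp_two_iff_lintegral hb'.aestronglyMeasurable,
        lintegral_prod _ (hb'.enorm.pow_const 2).aemeasurable]
      exact hs

/-- Parseval's formula on slices against a band-limited function. -/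
theorem ae_integral_bandKernel_mul (hAm : MeasurableSet A) {R : ℝ}
    (hA : A ⊆ Metric.closedBall 0 R) (v : SymMat n ℝ) (f : L2Siegel n lam) {g₀ : SymMat n ℂ → ℂ}
    (hf : f =ᵐ[siegelWeighted n lam] g₀) :
    ∀ᵐ Y ∂(coneWeighted n lam), ∫ X, bandKernel A (ofReIm X v) * g₀ (ofReIm X Y) =
      ∫ ξ in A, (Real.exp (inner ℝ ξ v) : ℂ) * uOperator n lam f (ξ, Y) := by
  set q := (memLp_expIndicator hAm hA v).toLp _ with hq
  have h1 := ae_integral_conj_mul_eq (fourierTensor_tensorL2 (n := n) (lam := lam))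
    ((unitaryFourier (SymMat n ℝ)).symm q) (coordEquiv n lam f)
  have h2 := ae_ae_snd_of_ae_prod ((coordEquiv_coeFn f).and (ae_siegelWeighted_iff.1 hf))
  filter_upwards [h1, h2] with Y hY1 hY2
  rw [LinearIsometryEquiv.apply_symm_apply] at hY1
  refine Eq.trans (integral_congr_ae ?_) (hY1.trans ?_)
  · filter_upwards [hY2, bandKernel_ofReIm_ae_eq hAm hA v] with X hX1 hX2
    rw [hX2, hX1.1]
    congr 1
    exact hX1.2.symm
  · rw [← integral_indicator hAm]
    refine integral_congr_ae ?_
    filter_upwards [(memLp_expIndicator hAm hA v).coeFn_toLp] with ξ hξ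
    rw [hq, hξ]
    by_cases hξA : ξ ∈ A
    · simp only [expIndicator, indicator_of_mem hξA, Complex.conj_ofReal]
      rfl
    · simp [expIndicator, hξA]

/-- The partial Fourier transform of a holomorphic function transforms by an exponential under
translations of the imaginary part: integrated form. -/
theorem ae_setIntegral_uOperator_eq (hlam : (n : ℝ) < lam) (hAm : MeasurableSet A) {R : ℝ}
    (hA : A ⊆ Metric.closedBall 0 R) (hg : DifferentiableOn ℂ g (siegelDomain n))
    {f : L2Siegel n lam} (hf : f =ᵐ[siegelWeighted n lam] g) (v : SymMat n ℝ) :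
    ∀ᵐ Y, Y ∈ posCone n → v + Y ∈ posCone n → ∫ ξ in A, uOperator n lam f (ξ, Y) =
      ∫ ξ in A, (Real.exp (inner ℝ ξ v) : ℂ) * uOperator n lam f (ξ, v + Y) := by
  set g₀ := (siegelDomain n).indicator g with hg₀
  have hm : Measurable g₀ := measurable_indicator_siegelDomain hg
  have hgg : EqOn g₀ g (siegelDomain n) := fun Z hZ => indicator_of_mem hZ g
  have hdom : ∀ᵐ Z ∂(siegelWeighted n lam), Z ∈ siegelDomain n :=
    (withDensity_absolutelyContinuous _ _).ae_le
      (ae_restrict_mem isOpen_siegelDomain.measurableSet)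
  have hf₀ : f =ᵐ[siegelWeighted n lam] g₀ := by
    filter_upwards [hf, hdom] with Z hZ hZ'
    rw [hZ, hgg hZ']
  have hfin : ∫⁻ Y, sliceNorm g₀ Y ∂(coneWeighted n lam) < ∞ := by
    rw [lintegral_sliceNorm hm]
    exact (memLp_two_iff_lintegral hm.aestronglyMeasurable).1 ((memLp_congr_ae hf₀).1 (Lp.memLp f))
  have hN := measurable_sliceNorm hm
  have htr : ∀ {P : SymMat n ℝ → Prop}, (∀ᵐ Y ∂(coneWeighted n lam), P Y) →
      ∀ᵐ Y, v + Y ∈ posCone n → P (v + Y) := fun {P} h =>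
    (measurePreserving_add_left volume v).quasiMeasurePreserving.ae ((ae_coneWeighted_iff hlam).1 h)
  have hlt := ae_lt_top hN hfin.ne
  have hP0 := ae_integral_bandKernel_mul hAm hA 0 f hf₀
  have hP1 := ae_integral_bandKernel_mul hAm hA v f hf₀
  filter_upwards [(ae_coneWeighted_iff hlam).1 hlt, htr hlt, (ae_coneWeighted_iff hlam).1 hP0,
    htr hP1, ae_lintegral_segment_lt_top isOpen_posCone convex_posCone hN
      (fun K hK hKc => lintegral_compact_lt_top hlam hN hfin hK hKc) v] with Y h1 h2 h3 h4 h5 hY hvY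
  have h3' := h3 hY
  simp only [inner_zero_right, Real.exp_zero, Complex.ofReal_one, one_mul] at h3'
  -- Parseval at shift `0` over `Y` and at shift `v` over `v + Y` turns the claim into the contour
  -- shift.
  rw [← h3', ← h4 hvY]
  exact integral_bandKernel_shift hAm hA hg hm hgg hY hvY (h1 hY) (h2 hvY) (h5 hY hvY)

end ContourShift

end

section

open SymMat

variable {n : ℕ} {lam : ℝ}

theorem ae_prod_restrict_iff {α β : Type*} [MeasurableSpace α] [MeasurableSpace β] {μ : Measure α}
    {ν : Measure β} [SFinite μ] [SFinite ν] {D : Set β} (hD : MeasurableSet D) {P : α × β → Prop} :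
    (∀ᵐ p ∂(μ.prod (ν.restrict D)), P p) ↔ ∀ᵐ p ∂(μ.prod ν), p.2 ∈ D → P p := by
  have h : μ.prod (ν.restrict D) = (μ.prod ν).restrict (univ ×ˢ D) := by
    rw [← Measure.prod_restrict, Measure.restrict_univ]
  rw [h, ae_restrict_iff' (MeasurableSet.univ.prod hD)]
  simp

theorem ae_prod_coneWeighted {P : SymMat n ℝ × SymMat n ℝ → Prop}
    (h : ∀ᵐ p ∂((volume : Measure (SymMat n ℝ)).prod volume), p.2 ∈ posCone n → P p) :
    ∀ᵐ p ∂((volume : Measure (SymMat n ℝ)).prod (coneWeighted n lam)), P p :=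
  (Measure.AbsolutelyContinuous.rfl.prod (withDensity_absolutelyContinuous _ _)).ae_le
    ((ae_prod_restrict_iff measurableSet_posCone).2 h)

/-! ### The Paley–Wiener theorem. -/

section PaleyWiener

variable {g : SymMat n ℂ → ℂ}

theorem ae_lintegral_slice_lt_top (hlam : (n : ℝ) < lam) (G : L2Tensor n lam) :
    ∀ᵐ Y, Y ∈ posCone n → ∫⁻ ξ, ‖G (ξ, Y)‖ₑ ^ 2 < ∞ := by
  refine (ae_coneWeighted_iff hlam).1 ?_
  have hm : Measurable fun p => ‖G p‖ₑ ^ 2 :=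
    (Lp.stronglyMeasurable G).measurable.enorm.pow_const 2
  have h := (memLp_two_iff_lintegral (Lp.stronglyMeasurable G).aestronglyMeasurable).1 (Lp.memLp G)
  rw [lintegral_prod_symm _ hm.aemeasurable] at h
  exact ae_lt_top hm.lintegral_prod_left' h.ne

theorem setLIntegral_lt_top_of_sq {α : Type*} [MeasurableSpace α] {μ : Measure α} {f : α → ℂ}
    (hf : AEStronglyMeasurable f μ) (h : ∫⁻ x, ‖f x‖ₑ ^ 2 ∂μ < ∞) {A : Set α} (hA : μ A < ∞) :
    ∫⁻ x in A, ‖f x‖ₑ ∂μ < ∞ := by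
  have : IsFiniteMeasure (μ.restrict A) := ⟨by simpa using hA⟩
  exact ((((memLp_two_iff_lintegral hf).2 h).restrict A).integrable one_le_two).2

/-- The partial Fourier transform of a holomorphic function transforms by an exponential under
translations of the imaginary part. -/
theorem ae_uOperator_eq (hlam : (n : ℝ) < lam) (hg : DifferentiableOn ℂ g (siegelDomain n))
    {f : L2Siegel n lam} (hf : f =ᵐ[siegelWeighted n lam] g) (v : SymMat n ℝ) :
    ∀ᵐ q ∂((volume : Measure (SymMat n ℝ)).prod volume), q.2 ∈ posCone n → v + q.2 ∈ posCone n →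
      uOperator n lam f q = (Real.exp (inner ℝ q.1 v) : ℂ) * uOperator n lam f (q.1, v + q.2) := by
  set G := uOperator n lam f with hG
  have hGm := Lp.stronglyMeasurable G
  set D : Set (SymMat n ℝ) := posCone n ∩ (fun Y => v + Y) ⁻¹' posCone n with hD
  have hDm : MeasurableSet D :=
    measurableSet_posCone.inter (measurableSet_posCone.preimage (by fun_prop))
  have hG2 : StronglyMeasurable fun q : SymMat n ℝ × SymMat n ℝ =>
      (Real.exp (inner ℝ q.1 v) : ℂ) * G (q.1, v + q.2) := by
    refine StronglyMeasurable.mul (Continuous.stronglyMeasurable (by fun_prop)) ?_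
    exact hGm.comp_measurable (by fun_prop)
  have hsl := ae_lintegral_slice_lt_top hlam G
  have hsl2 := (measurePreserving_add_left volume v).quasiMeasurePreserving.ae hsl
  have hball : ∀ m : ℕ, volume (Metric.closedBall (0 : SymMat n ℝ) m) < ∞ :=
    fun m => measure_closedBall_lt_top
  have hslm : ∀ Y, AEStronglyMeasurable (fun ξ => G (ξ, Y)) volume := fun Y =>
    (hGm.comp_measurable (g := fun ξ => (ξ, Y)) (by fun_prop)).aestronglyMeasurable
  -- Subsets of balls are bounded, so the integrated identity applies to each of them; `L²` slices
  -- are integrable over balls.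
  have key := ae_eq_of_forall_ae_setIntegral_eq (μ := volume) (ν := volume.restrict D) hGm hG2
    (fun m : ℕ => Metric.closedBall 0 m) (fun m => Metric.isClosed_closedBall.measurableSet)
    hball (Metric.iUnion_closedBall_nat 0) ?_ ?_ ?_
  · filter_upwards [(ae_prod_restrict_iff hDm).1 key] with q hq h1 h2
    exact hq ⟨h1, h2⟩
  · intro m
    rw [ae_restrict_iff' hDm]
    filter_upwards [hsl] with Y hY hYD
    exact setLIntegral_lt_top_of_sq (hslm Y) (hY hYD.1) (hball m)
  · intro m
    rw [ae_restrict_iff' hDm]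
    filter_upwards [hsl2] with Y hY hYD
    have h1 := setLIntegral_lt_top_of_sq (hslm (v + Y)) (hY hYD.2) (hball m)
    refine lt_of_le_of_lt (setLIntegral_mono' (g := fun ξ => ENNReal.ofReal (Real.exp (m * ‖v‖)) *
      ‖G (ξ, v + Y)‖ₑ) Metric.isClosed_closedBall.measurableSet fun ξ hξ => ?_)
      (lt_of_eq_of_lt (lintegral_const_mul' _ _ ENNReal.ofReal_ne_top)
        (ENNReal.mul_lt_top ENNReal.ofReal_lt_top h1))
    rw [enorm_mul]
    gcongr
    rw [← ofReal_norm, Complex.norm_real, Real.norm_of_nonneg (Real.exp_pos _).le]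
    refine ENNReal.ofReal_le_ofReal (Real.exp_le_exp.2 ((real_inner_le_norm _ _).trans ?_))
    have := mem_closedBall_zero_iff.1 hξ
    gcongr
  · intro m A' hA' hAm
    rw [ae_restrict_iff' hDm]
    filter_upwards [ae_setIntegral_uOperator_eq hlam hA' hAm hg hf v] with Y hY hYD
    exact hY hYD.1 hYD.2

/-- The partial Fourier transform of a holomorphic function is an exponential in the second
variable. -/
theorem exists_uOperator_ae_eq (hlam : (n : ℝ) < lam) (hg : DifferentiableOn ℂ g (siegelDomain n))
    {f : L2Siegel n lam} (hf : f =ᵐ[siegelWeighted n lam] g) :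
    ∃ k : SymMat n ℝ → ℂ, Measurable k ∧
      uOperator n lam f =ᵐ[(volume : Measure (SymMat n ℝ)).prod (coneWeighted n lam)]
        fun p => k p.1 * (Real.exp (-inner ℝ p.1 p.2) : ℂ) := by
  set G := uOperator n lam f with hG
  have hGm := Lp.stronglyMeasurable G
  -- With this factor the exponential law becomes invariance under translations of the second
  -- variable within the cone.
  let H : SymMat n ℝ × SymMat n ℝ → ℂ := fun p => (Real.exp (inner ℝ p.1 p.2) : ℂ) * G p
  have hH : StronglyMeasurable H :=
    StronglyMeasurable.mul (Continuous.stronglyMeasurable (by fun_prop)) hGm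
  have hO : (volume : Measure (SymMat n ℝ)) (posCone n) ≠ 0 :=
    (isOpen_posCone.measure_pos volume ⟨_, symOne_mem⟩).ne'
  obtain ⟨Y₀, -, h⟩ := exists_ae_eq_of_forall_translation (κ := volume) measurableSet_posCone hO hH
    (fun v => by
      filter_upwards [ae_uOperator_eq hlam hg hf v] with q hq h1 h2
      simp only [H]
      rw [hq h1 h2, ← mul_assoc, ← Complex.ofReal_mul, ← Real.exp_add, inner_add_right, add_comm])
  refine ⟨fun ξ => H (ξ, Y₀), hH.measurable.comp (by fun_prop), ae_prod_coneWeighted ?_⟩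
  filter_upwards [h] with q hq hqΩ
  rw [← hq hqΩ]
  simp only [H]
  rw [mul_right_comm, ← Complex.ofReal_mul, ← Real.exp_add, add_neg_cancel, Real.exp_zero,
    Complex.ofReal_one, one_mul]

theorem volume_frontier_posCone : volume (frontier (posCone n)) = 0 :=
  convex_posCone.addHaar_frontier volume

theorem enorm_exp_sq (r : ℝ) :
    ‖((Real.exp r : ℝ) : ℂ)‖ₑ ^ 2 = ENNReal.ofReal (Real.exp (2 * r)) := by
  rw [← ofReal_norm, ← ENNReal.ofReal_pow (norm_nonneg _), Complex.norm_real,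
    Real.norm_eq_abs, sq_abs, ← Real.exp_nat_mul]
  norm_num

/-- A square integrable function `k(X) e^{-⟨X, Y⟩}` is supported in the cone. -/
theorem ae_eq_zero_of_memLp_mul_exp (hlam : (n : ℝ) < lam) {k : SymMat n ℝ → ℂ} (hk : Measurable k)
    (h : MemLp (fun p : SymMat n ℝ × SymMat n ℝ => k p.1 * (Real.exp (-inner ℝ p.1 p.2) : ℂ)) 2
      ((volume : Measure (SymMat n ℝ)).prod (coneWeighted n lam))) :
    ∀ᵐ X, X ∉ posCone n → k X = 0 := by
  have hm : Measurable fun p : SymMat n ℝ × SymMat n ℝ =>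
      k p.1 * (Real.exp (-inner ℝ p.1 p.2) : ℂ) :=
    (hk.comp measurable_fst).mul (Continuous.measurable (by fun_prop))
  have h2 := (memLp_two_iff_lintegral h.1).1 h
  rw [lintegral_prod _ (hm.enorm.pow_const 2).aemeasurable] at h2
  have h3 := ae_lt_top (hm.enorm.pow_const 2).lintegral_prod_right' h2.ne
  have h4 : ∀ᵐ X, X ∉ frontier (posCone n) := measure_eq_zero_iff_ae_notMem.1 volume_frontier_posCone
  filter_upwards [h3, h4] with X hX hXf hXΩ
  by_contra hne
  refine hX.ne ?_
  have hcl : X ∉ closure (posCone n) := fun hc =>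
    hXf (by rw [isOpen_posCone.frontier_eq]; exact ⟨hc, hXΩ⟩)
  simp only [enorm_mul, mul_pow, enorm_exp_sq]
  rw [lintegral_const_mul']
  · have e : ∀ Y, 2 * -inner ℝ X Y = -2 * inner ℝ X Y := fun Y => by ring
    simp only [e]
    rw [lintegral_exp_coneWeighted_eq_top hlam hcl, ENNReal.mul_top]
    simpa using hne
  · finiteness

/-- A theorem of Paley--Wiener type. -/
theorem exists_uOperator_eq_sOperator (hlam : (n : ℝ) < lam) {f : L2Siegel n lam}
    (hf : f ∈ bergmanSpace n lam) : ∃ h : L2Cone n, uOperator n lam f = sOperator hlam h := by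
  obtain ⟨g, hg, hfg⟩ := hf
  obtain ⟨k, hk, hG⟩ := exists_uOperator_ae_eq hlam hg hfg
  have hmem := (memLp_congr_ae hG).1 (Lp.memLp (uOperator n lam f))
  have hzero := ae_eq_zero_of_memLp_mul_exp hlam hk hmem
  -- This undoes the constants of `S` on the cone; off the cone both `k` and `sFun` vanish, almost
  -- everywhere and identically respectively.
  set h : SymMat n ℝ → ℂ := fun X => k X * ((sConst n lam * detPow lam X : ℝ) : ℂ)⁻¹ with hh
  have hhm : Measurable h :=
    hk.mul (Complex.measurable_ofReal.comp (measurable_detPow.const_mul _)).inv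
  have hs : sFun n lam h =ᵐ[(volume : Measure (SymMat n ℝ)).prod (coneWeighted n lam)]
      uOperator n lam f := by
    filter_upwards [hG, Measure.quasiMeasurePreserving_fst.ae hzero] with p hp hp0
    obtain ⟨X, Y⟩ := p
    rw [hp]
    by_cases hX : X ∈ posCone n
    · rw [sFun_of_mem hX, hh]
      have h1 : (sConst n lam : ℂ) ≠ 0 := by exact_mod_cast (sConst_pos hlam).ne'
      have h2 : (detPow lam X : ℂ) ≠ 0 := by exact_mod_cast (detPow_pos hX).ne'
      push_cast
      field_simp
    · rw [sFun_of_notMem hX, hp0 hX, zero_mul]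
  have hhL : MemLp h 2 (coneVolume n) :=
    (memLp_sFun_iff hlam hhm).1 ((memLp_congr_ae hs).2 (Lp.memLp _))
  refine ⟨hhL.toLp h, Lp.ext ?_⟩
  exact hs.symm.trans ((sFun_ae_congr hhL.coeFn_toLp.symm).trans
    (isSOperator_sOperator hlam _).symm)

end PaleyWiener

/-! ### The Bergman space as the range of an isometry. -/

section Bergman

/-- The isometry `U⁻¹ S` of `L²(Ω)` onto the Bergman space. -/
def bergmanIsometry (hlam : (n : ℝ) < lam) : L2Cone n →ₗᵢ[ℂ] L2Siegel n lam :=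
  (uOperator n lam).symm.toLinearIsometry.comp (sOperator hlam)

theorem bergmanIsometry_coeFn (hlam : (n : ℝ) < lam) (h : L2Cone n) :
    bergmanIsometry hlam h =ᵐ[siegelWeighted n lam] fourierLaplace n lam h :=
  uOperator_symm_sOperator_coeFn hlam h

/-- One inclusion is Paley–Wiener, the other is holomorphy of the Fourier–Laplace transform. -/
theorem bergmanSpace_eq_range (hlam : (n : ℝ) < lam) :
    bergmanSpace n lam = LinearMap.range (bergmanIsometry (n := n) hlam).toLinearMap := by
  ext f
  constructor
  · intro hf
    obtain ⟨h, hh⟩ := exists_uOperator_eq_sOperator hlam hf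
    refine ⟨h, ?_⟩
    change (uOperator n lam).symm (sOperator hlam h) = f
    rw [← hh, LinearIsometryEquiv.symm_apply_apply]
  · rintro ⟨h, rfl⟩
    exact ⟨fourierLaplace n lam h, differentiableOn_fourierLaplace hlam (Lp.memLp h),
      bergmanIsometry_coeFn hlam h⟩

theorem completeSpace_bergmanSpace (hlam : (n : ℝ) < lam) :
    CompleteSpace (bergmanSpace n lam) := by
  rw [bergmanSpace_eq_range hlam]
  have h : IsComplete (range (bergmanIsometry (n := n) hlam)) :=
    (bergmanIsometry hlam).isometry.isUniformInducing.isComplete_range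
  exact h.completeSpace_coe

end Bergman

end

section

open SymMat

variable {n : ℕ} {lam : ℝ}

/-! ### Invariant symbols and moment map symbols. -/

section Invariance

namespace SymMat

theorem isSymm_adjugate (X : SymMat n ℝ) : X.toMatrix.adjugate.IsSymm := by
  rw [Matrix.IsSymm, Matrix.adjugate_transpose, X.isSymm_toMatrix]

/-- Adjugate and determinant are continuous, so this gives measurability of the inverse on all
matrices, singular ones included, where both sides are zero. -/
theorem inv_eq_smul (X : SymMat n ℝ) : X.inv = X.det⁻¹ • ofMatrix X.toMatrix.adjugate X.isSymm_adjugate := by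
  ext1
  simp [inv, Matrix.inv_def, det, Ring.inverse_eq_inv']

theorem measurable_inv : Measurable (inv : SymMat n ℝ → SymMat n ℝ) := by
  have h : Continuous fun X : SymMat n ℝ => ofMatrix X.toMatrix.adjugate X.isSymm_adjugate :=
    continuous_of_toMatrix (continuous_toMatrix.matrix_adjugate)
  have e : (inv : SymMat n ℝ → SymMat n ℝ) = fun X => X.det⁻¹ • ofMatrix X.toMatrix.adjugate X.isSymm_adjugate :=
    funext inv_eq_smul
  rw [e]
  exact continuous_det.measurable.inv.smul h.measurable

theorem inv_inv_of_mem {X : SymMat n ℝ} (hX : X ∈ posCone n) : X.inv.inv = X := by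
  ext1
  exact Matrix.nonsing_inv_nonsing_inv _ (det_pos_of_mem hX).ne'.isUnit

end SymMat

theorem ae_siegelVolume_add {P : SymMat n ℂ → Prop} (h : ∀ᵐ Z ∂(siegelVolume n), P Z)
    (S : SymMat n ℝ) : ∀ᵐ Z ∂(siegelVolume n), P (Z + ofReIm S 0) := by
  rw [ae_siegelVolume_iff] at h ⊢
  have := ((measurePreserving_add_right (volume : Measure (SymMat n ℝ)) S).prod
    (MeasurePreserving.id (coneVolume n))).quasiMeasurePreserving.ae h
  filter_upwards [this] with p hp
  have e : reImHomeomorph n p + ofReIm S 0 = reImHomeomorph n (p.1 + S, p.2) := by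
    change ofReIm p.1 p.2 + ofReIm S 0 = ofReIm (p.1 + S) p.2
    rw [ofReIm_add, add_zero]
  rw [e]
  exact hp

theorem ae_mem_siegelDomain : ∀ᵐ Z ∂(siegelVolume n), Z ∈ siegelDomain n :=
  ae_restrict_mem isOpen_siegelDomain.measurableSet

/-- An invariant symbol depends only on the imaginary part. -/
theorem exists_ae_eq_im_of_isSymInvariant {a : SymMat n ℂ → ℂ}
    (ha : AEStronglyMeasurable a (siegelVolume n)) (h : IsSymInvariant a) :
    ∃ α : SymMat n ℝ → ℂ, Measurable α ∧ a =ᵐ[siegelVolume n] fun Z => α Z.im := by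
  obtain ⟨a', ha', haa⟩ := ha
  let H : SymMat n ℝ × SymMat n ℝ → ℂ := fun q => a' (ofReIm q.2 q.1)
  have hH : StronglyMeasurable H :=
    ha'.comp_measurable (continuous_ofReIm.measurable.comp measurable_swap)
  have hsw := (Measure.measurePreserving_swap (μ := coneVolume n)
    (ν := (volume : Measure (SymMat n ℝ)))).quasiMeasurePreserving
  -- The real part is the translated variable, with no restriction on it; a generic `X₀` then gives
  -- `α(Y) = a'(X₀ + iY)`.
  obtain ⟨X₀, -, hX₀⟩ := exists_ae_eq_of_forall_translation (κ := coneVolume n)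
    (m := (volume : Measure (SymMat n ℝ))) MeasurableSet.univ
    (isOpen_univ.measure_pos volume ⟨0, mem_univ _⟩).ne' hH (fun v => by
      have h1 : ∀ᵐ Z ∂(siegelVolume n), a' (Z + ofReIm v 0) = a' Z := by
        filter_upwards [haa, ae_siegelVolume_add haa v, h v] with Z h1 h2 h3
        rw [← h1, ← h2, h3]
      filter_upwards [hsw.ae (ae_siegelVolume_iff.1 h1)] with q hq _ _
      have e : reImHomeomorph n q.swap + ofReIm v 0 = ofReIm (v + q.2) q.1 := by
        change ofReIm q.2 q.1 + ofReIm v 0 = _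
        rw [ofReIm_add, add_zero, add_comm]
      rw [e] at hq
      exact hq)
  refine ⟨fun Y => H (Y, X₀), hH.measurable.comp (by fun_prop), ?_⟩
  have h2 : ∀ᵐ Z ∂(siegelVolume n), a' Z = H (Z.im, X₀) := by
    rw [ae_siegelVolume_iff]
    have hsw' := (Measure.measurePreserving_swap (μ := (volume : Measure (SymMat n ℝ)))
      (ν := coneVolume n)).quasiMeasurePreserving
    filter_upwards [hsw'.ae hX₀] with p hp
    have e : (reImHomeomorph n p).im = p.2 := im_ofReIm _ _
    rw [e]
    exact hp (mem_univ _)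
  filter_upwards [haa, h2] with Z h3 h4
  rw [h3, h4]

theorem isSymInvariant_of_ae_eq_im {a : SymMat n ℂ → ℂ} {α : SymMat n ℝ → ℂ}
    (h : a =ᵐ[siegelVolume n] fun Z => α Z.im) : IsSymInvariant a := by
  intro S
  filter_upwards [h, ae_siegelVolume_add h S] with Z h1 h2
  rw [h1, h2, im_add_ofReIm_zero]

theorem isSymInvariant_iff_isMomentSymbol {a : SymMat n ℂ → ℂ}
    (ha : AEStronglyMeasurable a (siegelVolume n)) : IsSymInvariant a ↔ IsMomentSymbol a := by
  constructor
  · intro h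
    obtain ⟨α, hα, hae⟩ := exists_ae_eq_im_of_isSymInvariant ha h
    -- On the cone `W ↦ (-W/2)⁻¹` inverts `Y ↦ -2 Y⁻¹`.
    refine ⟨fun W => α (((-1 / 2 : ℝ) • W).inv),
      hα.comp (measurable_inv.comp (measurable_const_smul _)), ?_⟩
    filter_upwards [hae, ae_mem_siegelDomain] with Z h1 h2
    have h3 : Z.im ∈ posCone n := h2
    rw [h1, parabolicMoment, smul_smul]
    norm_num
    rw [inv_inv_of_mem h3]
  · rintro ⟨f, -, hf⟩
    exact isSymInvariant_of_ae_eq_im (α := fun Y => f ((-2 : ℝ) • Y.inv)) hf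

end Invariance

end

section

open SymMat

variable {n : ℕ} {lam : ℝ}

/-! ### The spectral function `γ` and the compression `S* M_α S`. -/

section SpectralFunction

variable {α : SymMat n ℝ → ℂ}

/-- The Laplace transform of the weight, as a Bochner integral. -/
theorem integrable_exp_detWeight (hlam : (n : ℝ) < lam) {X : SymMat n ℝ} (hX : X ∈ posCone n) :
    IntegrableOn (fun Y => Real.exp (-2 * inner ℝ X Y) * detWeight n lam Y) (posCone n) ∧
    ∫ Y in posCone n, Real.exp (-2 * inner ℝ X Y) * detWeight n lam Y =
      coneGamma n (lam - ((n : ℝ) + 1) / 2) /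
        (2 ^ ((n : ℝ) * ((n : ℝ) + 1) / 2) * X.det ^ (lam - ((n : ℝ) + 1) / 2)) := by
  have h := lintegral_exp_detWeight hlam hX
  have hm : Measurable fun Y : SymMat n ℝ => Real.exp (-2 * inner ℝ X Y) * detWeight n lam Y :=
    (Continuous.measurable (by fun_prop)).mul (measurable_detWeight lam)
  have h0 : 0 ≤ᵐ[volume.restrict (posCone n)] fun Y : SymMat n ℝ =>
      Real.exp (-2 * inner ℝ X Y) * detWeight n lam Y := by
    filter_upwards [ae_restrict_mem measurableSet_posCone] with Y hY
    exact mul_nonneg (Real.exp_pos _).le (detWeight_pos hY).le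
  constructor
  · refine ⟨hm.aestronglyMeasurable, ?_⟩
    rw [hasFiniteIntegral_iff_ofReal h0, h]
    exact ENNReal.ofReal_lt_top
  · rw [integral_eq_lintegral_of_nonneg_ae h0 hm.aestronglyMeasurable, h,
      ENNReal.toReal_ofReal]
    have := coneGamma_sub_pos hlam
    have := det_pos_of_mem hX
    positivity

theorem norm_gammaIntegrand_le {C : ℝ} {X Y : SymMat n ℝ} (hY : Y ∈ posCone n) (h : ‖α Y‖ ≤ C) :
    ‖gammaIntegrand n lam α X Y‖ ≤ C * (Real.exp (-2 * inner ℝ X Y) * detWeight n lam Y) := by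
  rw [gammaIntegrand, norm_mul, norm_mul, Complex.norm_real, Complex.norm_real,
    Real.norm_of_nonneg (Real.exp_pos _).le, Real.norm_of_nonneg (detWeight_pos hY).le,
    trMul_eq_inner, mul_assoc]
  have := detWeight_pos (lam := lam) hY
  gcongr

theorem integrableOn_gammaIntegrand (hlam : (n : ℝ) < lam)
    (hα : AEStronglyMeasurable α (coneVolume n)) {C : ℝ} (hC : ∀ᵐ Y ∂(coneVolume n), ‖α Y‖ ≤ C)
    {X : SymMat n ℝ} (hX : X ∈ posCone n) :
    IntegrableOn (gammaIntegrand n lam α X) (posCone n) := by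
  have hm : AEStronglyMeasurable (gammaIntegrand n lam α X) (coneVolume n) := by
    refine (hα.mul (Continuous.aestronglyMeasurable ?_)).mul
      (Complex.measurable_ofReal.comp (measurable_detWeight lam)).aestronglyMeasurable
    simp only [trMul_eq_inner]
    fun_prop
  refine ((integrable_exp_detWeight hlam hX).1.const_mul C).mono' hm ?_
  filter_upwards [hC, ae_restrict_mem measurableSet_posCone] with Y hY hYΩ
  exact norm_gammaIntegrand_le hYΩ hY

/-- The constant of the spectral function. -/
def gammaConst (n : ℕ) (lam : ℝ) (X : SymMat n ℝ) : ℝ :=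
  (2 : ℝ) ^ ((n : ℝ) * ((n : ℝ) + 1) / 2) * X.det ^ (lam - ((n : ℝ) + 1) / 2) /
    coneGamma n (lam - ((n : ℝ) + 1) / 2)

theorem gammaFun_eq (X : SymMat n ℝ) : gammaFun n lam α X =
    (gammaConst n lam X : ℂ) * ∫ Y in posCone n, gammaIntegrand n lam α X Y := rfl

theorem gammaConst_nonneg (hlam : (n : ℝ) < lam) {X : SymMat n ℝ} (hX : X ∈ posCone n) :
    0 ≤ gammaConst n lam X := by
  have := coneGamma_sub_pos hlam
  have := det_pos_of_mem hX
  unfold gammaConst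
  positivity

/-- The constant normalises the kernel to a probability density on `Ω`, so `γ(X)` is an average of
`α`. -/
theorem norm_gammaFun_le (hlam : (n : ℝ) < lam) {C : ℝ}
    (hC : ∀ᵐ Y ∂(coneVolume n), ‖α Y‖ ≤ C) {X : SymMat n ℝ} (hX : X ∈ posCone n) :
    ‖gammaFun n lam α X‖ ≤ C := by
  have hi := integrable_exp_detWeight hlam hX
  have h1 : ‖∫ Y in posCone n, gammaIntegrand n lam α X Y‖ ≤
      ∫ Y in posCone n, C * (Real.exp (-2 * inner ℝ X Y) * detWeight n lam Y) := by
    refine norm_integral_le_of_norm_le (hi.1.const_mul C) ?_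
    filter_upwards [hC, ae_restrict_mem measurableSet_posCone] with Y hY hYΩ
    exact norm_gammaIntegrand_le hYΩ hY
  rw [integral_const_mul, hi.2] at h1
  rw [gammaFun_eq, norm_mul, Complex.norm_real, Real.norm_of_nonneg (gammaConst_nonneg hlam hX)]
  refine (mul_le_mul_of_nonneg_left h1 (gammaConst_nonneg hlam hX)).trans (le_of_eq ?_)
  have h2 := (coneGamma_sub_pos hlam).ne'
  have h3 := (Real.rpow_pos_of_pos (det_pos_of_mem hX) (lam - ((n : ℝ) + 1) / 2)).ne'
  have h4 : (2 : ℝ) ^ ((n : ℝ) * ((n : ℝ) + 1) / 2) ≠ 0 := by positivity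
  rw [gammaConst]
  generalize lam - ((n : ℝ) + 1) / 2 = s at h2 h3 ⊢
  field_simp

theorem gammaFun_congr {α' : SymMat n ℝ → ℂ} (h : α =ᵐ[coneVolume n] α') :
    gammaFun n lam α = gammaFun n lam α' := by
  ext X
  rw [gammaFun_eq, gammaFun_eq]
  congr 1
  refine integral_congr_ae ?_
  filter_upwards [h] with Y hY
  rw [gammaIntegrand, gammaIntegrand, hY]

theorem stronglyMeasurable_gammaFun (hα : StronglyMeasurable α) :
    StronglyMeasurable (gammaFun n lam α) := by
  have h1 : StronglyMeasurable fun p : SymMat n ℝ × SymMat n ℝ =>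
      gammaIntegrand n lam α p.1 p.2 := by
    refine ((hα.comp_measurable measurable_snd).mul (Continuous.stronglyMeasurable ?_)).mul
      (Complex.measurable_ofReal.comp
        ((measurable_detWeight lam).comp measurable_snd)).stronglyMeasurable
    simp only [trMul_eq_inner]
    fun_prop
  have h2 : Measurable (gammaConst n lam) :=
    ((continuous_det.measurable.pow_const _).const_mul _).div_const _
  exact (Complex.measurable_ofReal.comp h2).stronglyMeasurable.mul
    (h1.integral_prod_right' (ν := volume.restrict (posCone n)))

theorem memLp_gammaFun (hlam : (n : ℝ) < lam) (hα : AEStronglyMeasurable α (coneVolume n)) {C : ℝ}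
    (hC : ∀ᵐ Y ∂(coneVolume n), ‖α Y‖ ≤ C) : MemLp (gammaFun n lam α) ∞ (coneVolume n) := by
  refine memLp_top_of_bound ?_ C ?_
  · rw [gammaFun_congr hα.ae_eq_mk]
    exact (stronglyMeasurable_gammaFun hα.stronglyMeasurable_mk).aestronglyMeasurable
  · filter_upwards [ae_restrict_mem measurableSet_posCone] with X hX
    exact norm_gammaFun_le hlam hC hX

/-- The right side is the factor that appears when two functions `sFun` are paired over the slice at
`X`. -/
theorem gammaConst_eq (hlam : (n : ℝ) < lam) {X : SymMat n ℝ} (hX : X ∈ posCone n) :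
    gammaConst n lam X = sConst n lam ^ 2 * detPow lam X ^ 2 * weightConst n lam := by
  rw [sConst_sq hlam, detPow_sq hX, gammaConst, weightConst,
    Real.mul_rpow zero_le_two Real.pi_pos.le]
  have h1 := (coneGamma_pos_of_lt hlam).ne'
  have h2 := (coneGamma_sub_pos hlam).ne'
  have h3 : Real.pi ^ ((n : ℝ) * ((n : ℝ) + 1) / 2) ≠ 0 := by positivity
  field_simp

/-- Pairing of `S k` with `α S h` on the slice over `X`. -/
theorem integral_sFun_mul (hlam : (n : ℝ) < lam) (h k : SymMat n ℝ → ℂ) {X : SymMat n ℝ}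
    (hX : X ∈ posCone n) :
    ∫ Y, inner ℂ (sFun n lam k (X, Y)) (α Y * sFun n lam h (X, Y)) ∂(coneWeighted n lam) =
      inner ℂ (k X) (gammaFun n lam α X * h X) := by
  have hpt : ∀ Y ∈ posCone n, (ENNReal.ofReal (weightConst n lam * detWeight n lam Y)).toReal •
      inner ℂ (sFun n lam k (X, Y)) (α Y * sFun n lam h (X, Y)) =
      (gammaConst n lam X : ℂ) * (starRingEnd ℂ (k X) * h X) * gammaIntegrand n lam α X Y := by
    intro Y hY
    rw [ENNReal.toReal_ofReal (mul_pos (weightConst_pos hlam) (detWeight_pos hY)).le,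
      sFun_of_mem hX, sFun_of_mem hX, gammaIntegrand, gammaConst_eq hlam hX, trMul_eq_inner,
      show -2 * inner ℝ X Y = -inner ℝ X Y + -inner ℝ X Y by ring, Real.exp_add]
    simp only [RCLike.inner_apply, map_mul, Complex.conj_ofReal, Complex.real_smul,
      Complex.ofReal_mul, Complex.ofReal_pow]
    ring
  rw [coneWeighted, integral_withDensity_eq_integral_toReal_smul
    ((measurable_detWeight lam).const_mul _).ennreal_ofReal
    (ae_of_all _ fun _ => ENNReal.ofReal_lt_top)]
  have : ∫ Y, (ENNReal.ofReal (weightConst n lam * detWeight n lam Y)).toReal •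
      inner ℂ (sFun n lam k (X, Y)) (α Y * sFun n lam h (X, Y)) ∂(coneVolume n) =
      ∫ Y in posCone n, (gammaConst n lam X : ℂ) * (starRingEnd ℂ (k X) * h X) *
        gammaIntegrand n lam α X Y := setIntegral_congr_fun measurableSet_posCone hpt
  rw [this, integral_const_mul, gammaFun_eq]
  simp only [RCLike.inner_apply]
  ring

/-- `S* M_α S = M_γ`, in weak form. -/
theorem inner_sOperator_mul (hlam : (n : ℝ) < lam) {G : L2Tensor n lam} (h k : L2Cone n)
    (hG : G =ᵐ[(volume : Measure (SymMat n ℝ)).prod (coneWeighted n lam)]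
      fun p => α p.2 * sOperator hlam h p)
    (hγ : MemLp (gammaFun n lam α) ∞ (coneVolume n)) :
    inner ℂ (sOperator hlam k) G = inner ℂ k (mulOp (gammaFun n lam α) hγ h) := by
  have hae : (fun p => inner ℂ (sOperator hlam k p) (G p))
      =ᵐ[(volume : Measure (SymMat n ℝ)).prod (coneWeighted n lam)]
      fun p => inner ℂ (sFun n lam k p) (α p.2 * sFun n lam h p) := by
    filter_upwards [hG, isSOperator_sOperator hlam h, isSOperator_sOperator hlam k] with p h1 h2 h3
    rw [h1, h2, h3]
  rw [L2.inner_def, L2.inner_def, integral_congr_ae hae,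
    integral_prod _ ((integrable_congr hae).1 (L2.integrable_inner _ _))]
  have h1 : ∀ X, ∫ Y, inner ℂ (sFun n lam k (X, Y)) (α Y * sFun n lam h (X, Y))
      ∂(coneWeighted n lam) =
      (posCone n).indicator (fun X => inner ℂ (k X) (gammaFun n lam α X * h X)) X := by
    intro X
    by_cases hX : X ∈ posCone n
    · rw [indicator_of_mem hX, integral_sFun_mul hlam _ _ hX]
    · simp [indicator_of_notMem hX, sFun_of_notMem hX]
  simp only [h1]
  rw [integral_indicator measurableSet_posCone]
  refine integral_congr_ae ?_
  filter_upwards [mulOp_coeFn (gammaFun n lam α) hγ h] with X hX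
  rw [hX]

end SpectralFunction

/-! ### `U` commutes with multiplication by functions of `Im Z`. -/

section Multiplication

theorem span_range_tensorL2 {α β : Type*} [MeasurableSpace α] [MeasurableSpace β]
    {μ : Measure α} {ν : Measure β} [SigmaFinite μ] [SigmaFinite ν] :
    Dense (Submodule.span ℂ (range fun q : Lp ℂ 2 μ × Lp ℂ 2 ν => tensorL2 μ ν q.1 q.2) :
      Set (Lp ℂ 2 (μ.prod ν))) := by
  rw [Submodule.dense_iff_topologicalClosure_eq_top, Submodule.topologicalClosure_eq_top_iff,
    Submodule.eq_bot_iff]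
  intro f hf
  refine eq_zero_of_inner_tensorL2 fun φ ψ => ?_
  exact (Submodule.mem_orthogonal _ _).1 hf _ (Submodule.subset_span ⟨(φ, ψ), rfl⟩)

variable {α : SymMat n ℝ → ℂ}

/-- `ℱ ⊗ I` commutes with multiplication by functions of the second variable. -/
theorem fourierTensor_mulOp (hα : MemLp α ∞ (coneWeighted n lam))
    (hα' : MemLp (fun p : SymMat n ℝ × SymMat n ℝ => α p.2) ∞
      ((volume : Measure (SymMat n ℝ)).prod (coneWeighted n lam))) (F : L2Tensor n lam) :
    fourierTensor n lam (mulOp _ hα' F) = mulOp _ hα' (fourierTensor n lam F) := by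
  have hmul : ∀ (φ : Lp ℂ 2 (volume : Measure (SymMat n ℝ))) ψ,
      mulOp _ hα' (tensorL2 _ _ φ ψ) = tensorL2 _ _ φ (mulOp α hα ψ) := by
    intro φ ψ
    refine Lp.ext ?_
    filter_upwards [mulOp_coeFn _ hα' (tensorL2 _ _ φ ψ), tensorL2_coeFn φ ψ,
      tensorL2_coeFn φ (mulOp α hα ψ),
      Measure.quasiMeasurePreserving_snd.ae (mulOp_coeFn α hα ψ)] with p h1 h2 h3 h4
    rw [h1, h2, h3, h4]
    ring
  let T : L2Tensor n lam →L[ℂ] L2Tensor n lam :=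
    (fourierTensor n lam).toContinuousLinearEquiv
  have key : T ∘L mulOp _ hα' = mulOp _ hα' ∘L T := by
    refine ContinuousLinearMap.ext_on span_range_tensorL2 ?_
    rintro _ ⟨⟨φ, ψ⟩, rfl⟩
    change fourierTensor n lam (mulOp _ hα' (tensorL2 _ _ φ ψ)) =
      mulOp _ hα' (fourierTensor n lam (tensorL2 _ _ φ ψ))
    rw [hmul, fourierTensor_tensorL2, fourierTensor_tensorL2, hmul]
  exact DFunLike.congr_fun key F

/-- `U` carries multiplication by a function of `Im Z` into multiplication by the same function of
the second variable. -/
theorem uOperator_mulOp_coeFn {a : SymMat n ℂ → ℂ} (ha : MemLp a ∞ (siegelWeighted n lam))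
    (haα : a =ᵐ[siegelWeighted n lam] fun Z => α Z.im) (hα : MemLp α ∞ (coneWeighted n lam))
    (f : L2Siegel n lam) : uOperator n lam (mulOp a ha f)
      =ᵐ[(volume : Measure (SymMat n ℝ)).prod (coneWeighted n lam)]
        fun p => α p.2 * uOperator n lam f p := by
  have hα' : MemLp (fun p : SymMat n ℝ × SymMat n ℝ => α p.2) ∞
      ((volume : Measure (SymMat n ℝ)).prod (coneWeighted n lam)) := by
    refine ⟨hα.1.comp_snd, lt_of_le_of_lt ?_ hα.2⟩
    rw [eLpNorm_exponent_top, eLpNorm_exponent_top]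
    refine essSup_le_of_ae_le _ ?_
    exact Measure.quasiMeasurePreserving_snd.ae (ae_le_eLpNormEssSup (f := α))
  have h1 : coordEquiv n lam (mulOp a ha f) = mulOp _ hα' (coordEquiv n lam f) := by
    refine Lp.ext ?_
    filter_upwards [coordEquiv_coeFn (mulOp a ha f), coordEquiv_coeFn f,
      mulOp_coeFn _ hα' (coordEquiv n lam f), ae_siegelWeighted_iff.1 haα,
      ae_siegelWeighted_iff.1 (mulOp_coeFn a ha f)] with p h1 h2 h3 h4 h5
    have e : reImHomeomorph n p = ofReIm p.1 p.2 := rfl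
    rw [e] at h4 h5
    rw [h1, h3, h2, h5, h4, im_ofReIm]
  have h2 : uOperator n lam (mulOp a ha f) = mulOp _ hα' (uOperator n lam f) := by
    change fourierTensor n lam (coordEquiv n lam (mulOp a ha f)) = _
    rw [h1, fourierTensor_mulOp hα hα']
    rfl
  rw [h2]
  exact mulOp_coeFn _ hα' _

end Multiplication

/-! ### Toeplitz operators under `R`. -/

section Main

theorem exists_ae_norm_le_of_memLp_top {α : Type*} [MeasurableSpace α] {μ : Measure α} {f : α → ℂ}
    (hf : MemLp f ∞ μ) : ∃ C : ℝ, ∀ᵐ x ∂μ, ‖f x‖ ≤ C := by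
  have h := hf.2
  rw [eLpNorm_exponent_top] at h
  refine ⟨(eLpNormEssSup f μ).toReal, ?_⟩
  filter_upwards [ae_le_eLpNormEssSup (f := f) (μ := μ)] with x hx
  rw [← toReal_enorm]
  exact ENNReal.toReal_mono h.ne hx

/-- By Fubini the bound on `a` holds along almost every slice of fixed `X`; a single such slice
bounds `α`. -/
theorem exists_ae_norm_le_of_ae_eq_im {a : SymMat n ℂ → ℂ} (ha : MemLp a ∞ (siegelVolume n))
    {α : SymMat n ℝ → ℂ} (h : a =ᵐ[siegelVolume n] fun Z => α Z.im) :
    ∃ C : ℝ, ∀ᵐ Y ∂(coneVolume n), ‖α Y‖ ≤ C := by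
  obtain ⟨C, hC⟩ := exists_ae_norm_le_of_memLp_top ha
  refine ⟨C, ?_⟩
  have h1 : ∀ᵐ Z ∂(siegelVolume n), ‖α Z.im‖ ≤ C := by
    filter_upwards [hC, h] with Z h1 h2
    rwa [← h2]
  obtain ⟨X, hX⟩ := (Measure.ae_ae_of_ae_prod (ae_siegelVolume_iff.1 h1)).exists
  filter_upwards [hX] with Y hY
  have e : (reImHomeomorph n (X, Y)).im = Y := im_ofReIm _ _
  rwa [e] at hY

/-- Unitarity gives `S* U = (U⁻¹ S)*`, so the partial isometry statements become general facts about
the adjoint of an isometry. -/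
theorem rOperator_eq_adjoint (hlam : (n : ℝ) < lam) :
    rOperator (uOperator n lam) (sOperator hlam) =
      ContinuousLinearMap.adjoint (bergmanIsometry hlam).toContinuousLinearMap := by
  rw [ContinuousLinearMap.eq_adjoint_iff]
  intro f h
  change inner ℂ (ContinuousLinearMap.adjoint (sOperator hlam).toContinuousLinearMap
    (uOperator n lam f)) h = inner ℂ f ((uOperator n lam).symm (sOperator hlam h))
  rw [ContinuousLinearMap.adjoint_inner_left, ← (uOperator n lam).inner_map_map f,
    LinearIsometryEquiv.apply_symm_apply]
  rfl

theorem adjoint_isometry_apply {E F : Type*} [NormedAddCommGroup E] [InnerProductSpace ℂ E]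
    [CompleteSpace E] [NormedAddCommGroup F] [InnerProductSpace ℂ F] [CompleteSpace F]
    (W : E →ₗᵢ[ℂ] F) (h : E) :
    ContinuousLinearMap.adjoint W.toContinuousLinearMap (W h) = h := by
  refine ext_inner_right ℂ fun k => ?_
  rw [ContinuousLinearMap.adjoint_inner_left]
  exact W.inner_map_map h k

theorem apply_adjoint_isometry {E F : Type*} [NormedAddCommGroup E] [InnerProductSpace ℂ E]
    [CompleteSpace E] [NormedAddCommGroup F] [InnerProductSpace ℂ F] [CompleteSpace F]
    (W : E →ₗᵢ[ℂ] F) {K : Submodule ℂ F} [K.HasOrthogonalProjection]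
    (hK : K = LinearMap.range W.toLinearMap) (f : F) :
    W (ContinuousLinearMap.adjoint W.toContinuousLinearMap f) = K.starProjection f := by
  refine (Submodule.eq_starProjection_of_mem_of_inner_eq_zero ?_ ?_).symm
  · rw [hK]; exact ⟨_, rfl⟩
  · intro w hw
    rw [hK] at hw
    obtain ⟨h, rfl⟩ := hw
    change inner ℂ (f - W (ContinuousLinearMap.adjoint W.toContinuousLinearMap f)) (W h) = 0
    rw [inner_sub_left, W.inner_map_map, ContinuousLinearMap.adjoint_inner_left, sub_eq_zero]
    rfl

/-- The projection is `W W*`, which `W*` absorbs because `W* W = 1`. What remains, `⟨W k, a W h⟩`,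
is carried by `U` to `⟨S k, α S h⟩`. -/
theorem rOperator_toeplitz (hlam : (n : ℝ) < lam) [CompleteSpace (bergmanSpace n lam)]
    {a : SymMat n ℂ → ℂ} (ha : MemLp a ∞ (siegelVolume n)) {α : SymMat n ℝ → ℂ}
    (hα : AEStronglyMeasurable α (coneVolume n)) (haα : a =ᵐ[siegelVolume n] fun Z => α Z.im)
    (hγ : MemLp (gammaFun n lam α) ∞ (coneVolume n)) (h : L2Cone n) (f : bergmanSpace n lam)
    (hf : (f : L2Siegel n lam) = bergmanIsometry hlam h) :
    ContinuousLinearMap.adjoint (bergmanIsometry hlam).toContinuousLinearMap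
      (toeplitz n lam a ha f) = mulOp (gammaFun n lam α) hγ h := by
  set W := bergmanIsometry (n := n) hlam with hW
  have ha' := memLp_siegelWeighted lam ha
  obtain ⟨C, hC⟩ := exists_ae_norm_le_of_ae_eq_im ha haα
  have hac : coneWeighted n lam ≪ coneVolume n := withDensity_absolutelyContinuous _ _
  have hαw : MemLp α ∞ (coneWeighted n lam) :=
    memLp_top_of_bound (hα.mono_ac hac) C (hac.ae_le hC)
  have hac' : siegelWeighted n lam ≪ siegelVolume n := withDensity_absolutelyContinuous _ _
  have e1 : ((toeplitz n lam a ha f : bergmanSpace n lam) : L2Siegel n lam) =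
      W (ContinuousLinearMap.adjoint W.toContinuousLinearMap (mulOp a ha' (f : L2Siegel n lam))) :=
    (apply_adjoint_isometry W (bergmanSpace_eq_range hlam) _).symm
  rw [e1, adjoint_isometry_apply]
  refine ext_inner_left ℂ fun k => ?_
  rw [ContinuousLinearMap.adjoint_inner_right]
  have e2 : inner ℂ (W.toContinuousLinearMap k) (mulOp a ha' (f : L2Siegel n lam)) =
      inner ℂ (sOperator hlam k) (uOperator n lam (mulOp a ha' (f : L2Siegel n lam))) := by
    rw [← (uOperator n lam).inner_map_map (W.toContinuousLinearMap k)]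
    congr 1
    exact (uOperator n lam).apply_symm_apply _
  rw [e2]
  refine inner_sOperator_mul hlam h k ?_ hγ
  have h1 := uOperator_mulOp_coeFn ha' (hac'.ae_le haα) hαw (f : L2Siegel n lam)
  have e3 : uOperator n lam (f : L2Siegel n lam) = sOperator hlam h := by
    rw [hf]; exact (uOperator n lam).apply_symm_apply _
  rwa [e3] at h1

end Main

end

end SiegelToeplitz

end


theorem mainTheorem4 (n : ℕ) (hn : 1 ≤ n) (lam : ℝ) (hlam : (n : ℝ) < lam) :
    -- the Bergman space is a Hilbert space, and `R = S^* U` exists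
    ∃ (_ : CompleteSpace (bergmanSpace n lam))
      (U : L2Siegel n lam ≃ₗᵢ[ℂ] L2Tensor n lam) (S : L2Cone n →ₗᵢ[ℂ] L2Tensor n lam)
      (R : L2Siegel n lam →L[ℂ] L2Cone n),
      IsPartialFourier U ∧ IsSOperator S ∧ R = rOperator U S ∧
      -- `R` is a partial isometry with initial space the Bergman space and final space `L²(Ω_n)`
      ContinuousLinearMap.adjoint R ∘L R = (bergmanSpace n lam).starProjection ∧
      R ∘L ContinuousLinearMap.adjoint R = ContinuousLinearMap.id ℂ (L2Cone n) ∧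
      (∀ h : L2Cone n,
        ContinuousLinearMap.adjoint R h =ᵐ[siegelWeighted n lam] fourierLaplace n lam h) ∧
      ∀ (a : SymMat n ℂ → ℂ) (ha : MemLp a ∞ (siegelVolume n)),
        (IsSymInvariant a ↔ IsMomentSymbol a) ∧
        (IsSymInvariant a →
          -- `a` depends only on `Y = Im Z`
          (∃ α : SymMat n ℝ → ℂ, Measurable α ∧ a =ᵐ[siegelVolume n] fun Z => α Z.im) ∧
          ∀ α : SymMat n ℝ → ℂ, AEStronglyMeasurable α (coneVolume n) →
            (a =ᵐ[siegelVolume n] fun Z => α Z.im) →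
            (∀ X ∈ posCone n, IntegrableOn (gammaIntegrand n lam α X) (posCone n)) ∧
            ∃ hγ : MemLp (gammaFun n lam α) ∞ (coneVolume n),
              -- `R T_a = M_γ R` on the Bergman space
              (∀ f : bergmanSpace n lam,
                R (toeplitz n lam a ha f) = mulOp (gammaFun n lam α) hγ (R f)) ∧
              -- `R T_a R^* = M_γ` on `L²(Ω_n)`
              (∀ (h : L2Cone n) (f : bergmanSpace n lam),
                (f : L2Siegel n lam) = ContinuousLinearMap.adjoint R h →
                R (toeplitz n lam a ha f) = mulOp (gammaFun n lam α) hγ h)) := by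
  have hcomplete := completeSpace_bergmanSpace (n := n) hlam
  have hR := rOperator_eq_adjoint (n := n) hlam
  set W := bergmanIsometry (n := n) hlam with hW
  have hadj : ContinuousLinearMap.adjoint (rOperator (uOperator n lam) (sOperator hlam)) =
      W.toContinuousLinearMap := by
    rw [hR, ContinuousLinearMap.adjoint_adjoint]
  refine ⟨hcomplete, uOperator n lam, sOperator hlam, _, isPartialFourier_uOperator,
    isSOperator_sOperator hlam, rfl, ?_, ?_, ?_, ?_⟩
  · rw [hadj, hR]
    ext1 f
    exact apply_adjoint_isometry W (bergmanSpace_eq_range hlam) f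
  · rw [hadj, hR]
    ext1 h
    exact adjoint_isometry_apply W h
  · intro h
    rw [hadj]
    exact bergmanIsometry_coeFn hlam h
  · intro a ha
    refine ⟨isSymInvariant_iff_isMomentSymbol ha.1, fun hinv =>
      ⟨exists_ae_eq_im_of_isSymInvariant ha.1 hinv, fun α hα haα => ?_⟩⟩
    obtain ⟨C, hC⟩ := exists_ae_norm_le_of_ae_eq_im ha haα
    refine ⟨fun X hX => integrableOn_gammaIntegrand hlam hα hC hX, memLp_gammaFun hlam hα hC,
      fun f => ?_, fun h f hf => ?_⟩
    -- A Bergman function is fixed by the projection `W W*`, so it is `W h` with `h = R f`.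
    · have hf : (f : L2Siegel n lam) =
          W (ContinuousLinearMap.adjoint W.toContinuousLinearMap (f : L2Siegel n lam)) := by
        rw [apply_adjoint_isometry W (bergmanSpace_eq_range hlam)]
        exact ((bergmanSpace n lam).starProjection_mem_subspace_eq_self f).symm
      rw [hR]
      exact rOperator_toeplitz hlam ha hα haα _ _ f hf
    · rw [hadj] at hf
      rw [hR]
      exact rOperator_toeplitz hlam ha hα haα _ h f hf
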